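/- Let $X$ be a complex manifold of dimension $d$, $D\subset X$ a normal crossing divisor with connected complement $U=X\setminus D$, $b\in U$, $\rho:\pi_1(U,b)\to U(N)$ a representation, and $\tilde{\mathfrak g}$ the local system on $U$ with fibre $\mathfrak{gl}_N(\mathbb C)=\mathfrak u(N)\otimes\mathbb C$ attached to $\mathrm{Ad}\circ\rho$. Let $z_1,\dots,z_d$ be holomorphic coordinates on an open set of $X$ in which $D$ is given by $\prod_{i\in J}z_i=0$ for some (possibly empty) $J\subset\{1,\dots,d\}$, and let $r_i=|z_i|$. *The sheaves $\mathcal B^{p,q}(\tilde{\mathfrak g})$.* Let $P$ be an open polydisc in these coordinates. Over $P\setminus D$ the local system $\tilde{\mathfrak g}$ splits into local systems of rank one. Let $L$ be one of them, spanned by a multivalued horizontal section $s$ with monodromy $e^{-\sqrt{-1}\theta_i}$, $0\le\theta_i<2\pi$, around $z_i=0$ ($\theta_i=0$ if $i\notin J$), and let $S=\{i:\theta_i\neq0\}$. A (multivalued) form $\beta$ of type $(p',q')$ satisfies condition C if its coefficients are smooth on $P\setminus\bigcup_{i\in S}\{z_i=0\}$ and, locally on $P$ (that is, on each compact subset of $P$),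 are bounded if $p'=q'=0$, while if $p'+q'>0$ the coefficient of $dz_{I}\wedge d\bar z_{K}$ is $O\big(\prod_{i\in S}r_i^{\varepsilon-\delta_i-\sigma_i}\big)$ for some $\varepsilon>0$, where $\delta_i=1$ if $i\in I$ and $0$ otherwise, $\sigma_i=1$ if $i\in K$ and $0$ otherwise. A form $\alpha\otimes s$ of type $(p,q)$ with values in $L$, for which the single-valued form $\prod_i z_i^{-\theta_i/2\pi}\alpha$ is defined and smooth on $P\setminus\bigcup_{i\in S}\{z_i=0\}$, is a section of $\mathcal B^{p,q}$ over $P$ if $\alpha$, $d'\alpha$, $d''\alpha$ and $d'd''\alpha$ satisfy condition C. A form of type $(p,q)$ with values in $\tilde{\mathfrak g}$ is a section of $\mathcal B^{p,q}(\tilde{\mathfrak g})$ over $P$ if all its components in such a splitting are; it is a section over an open subset $W$ of the coordinate domain if its restriction to every polydisc in $W$ is. (Away from $D$ these are just the smooth $\tilde{\mathfrak g}$-valued $(p,q)$-forms.) Here $d'$ and $d''$ are the $(1,0)$- and $(0,1)$-parts of the flat covariant derivative. **Lemma.** Let $p\ge0$, $q>0$, and let $\bar\Delta$ be a closed polydisc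 (with positive radii) contained in the coordinate domain; it may meet $D$ or not. Let $\omega$ be a section of $\mathcal B^{p,q}(\tilde{\mathfrak g})$ over an open neighbourhood $W$ of $\bar\Delta$ in the coordinate domain, with $d''\omega=0$. Then there are an open neighbourhood $W'\subset W$ of $\bar\Delta$ and a section $\alpha$ of $\mathcal B^{p,q-1}(\tilde{\mathfrak g})$ over $W'$ such that $d''\alpha=\omega$ on $W'$. -/

import Mathlib

open Set
open scoped Manifold ContDiff Matrix.Norms.Frobenius

namespace LogDolbeault

noncomputable section

/-! ### Polydiscs and normal crossing divisors -/

/-- The open polydisc in `ℂ^d` with centre `c` and polyradius `R`. -/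
def openPolydisc {d : ℕ} (c : Fin d → ℂ) (R : Fin d → ℝ) : Set (Fin d → ℂ) :=
  {z | ∀ i, ‖z i - c i‖ < R i}

/-- The closed polydisc in `ℂ^d` with centre `c` and polyradius `R`. -/
def closedPolydisc {d : ℕ} (c : Fin d → ℂ) (R : Fin d → ℝ) : Set (Fin d → ℂ) :=
  {z | ∀ i, ‖z i - c i‖ ≤ R i}

section Divisor

variable {d : ℕ} {X : Type*} [TopologicalSpace X]

/-- In the coordinates `z = e`, the set `D` is given by `∏_{i ∈ J} z_i = 0`. -/
def IsAdapted (e : OpenPartialHomeomorph X (Fin d → ℂ)) (J : Finset (Fin d)) (D : Set X) : Prop :=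
  ∀ x ∈ e.source, x ∈ D ↔ ∃ i ∈ J, e x i = 0

/-- `D` is a normal crossing divisor on the complex manifold `X`: around every point of `X` there
are holomorphic coordinates in which `D` is a union of coordinate hyperplanes (an empty union
at the points outside `D`). -/
def IsNormalCrossing (d : ℕ) [ChartedSpace (Fin d → ℂ) X] (D : Set X) : Prop :=
  ∀ x : X, ∃ e ∈ IsManifold.maximalAtlas 𝓘(ℂ, Fin d → ℂ) ω X, ∃ J : Finset (Fin d),
    x ∈ e.source ∧ IsAdapted e J D

end Divisor

/-! ### Differential forms in coordinates

A form `∑ F I K dz_I ∧ dz̄_K` is given by its coefficients, the differentials in `dz_I` and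
`dz̄_K` being ordered increasingly. -/

section Forms

variable {d : ℕ} {V : Type*} [NormedAddCommGroup V] [NormedSpace ℂ V]

/-- `∂/∂z_j` -/
def delZ (j : Fin d) (g : (Fin d → ℂ) → V) (z : Fin d → ℂ) : V :=
  (1 / 2 : ℂ) • (fderiv ℝ g z (Pi.single j 1) - Complex.I • fderiv ℝ g z (Pi.single j Complex.I))

/-- `∂/∂z̄_j` -/
def delZbar (j : Fin d) (g : (Fin d → ℂ) → V) (z : Fin d → ℂ) : V :=
  (1 / 2 : ℂ) • (fderiv ℝ g z (Pi.single j 1) + Complex.I • fderiv ℝ g z (Pi.single j Complex.I))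

/-- The coefficients of a form on a domain of `ℂ^d`. -/
abbrev Form (d : ℕ) (V : Type*) := Finset (Fin d) → Finset (Fin d) → (Fin d → ℂ) → V

/-- The operator `d''`. -/
def dbar (F : Form d V) : Form d V := fun I K z =>
  ∑ j ∈ K, (-1 : ℂ) ^ (I.card + (K.filter (· < j)).card) • delZbar j (F I (K.erase j)) z

/-- The operator `d'` on forms `F ⊗ μ`, where `∇ μ = ∑ θ_i / 2π · dz_i / z_i ⊗ μ`; so
`d' (F ⊗ μ) = (twistedDel θ F) ⊗ μ`. -/
def twistedDel (θ : Fin d → ℝ) (F : Form d ℂ) : Form d ℂ := fun I K z =>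
  ∑ j ∈ I, (-1 : ℂ) ^ (I.filter (· < j)).card *
    (delZ j (F (I.erase j) K) z + (θ j / (2 * Real.pi) : ℝ) / z j * F (I.erase j) K z)

/-- Condition C on the polydisc `P` for the multivalued form `α = ∏ z_i^{θ_i / 2π} · F` of type
`(p, q)`. Only the hyperplanes `z_i = 0` with `θ_i ≠ 0` (non-trivial monodromy) count: `α` is smooth
outside their union, its coefficients are locally bounded on `P` for `p = q = 0`, and locally
on `P` they are `O(∏ r_i^{ε - δ_i - σ_i})` for some `ε > 0` otherwise. Here `r_i = |z_i|`, and
`δ_i`, `σ_i` are the exponents of `dz_i`, `dz̄_i`. -/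
def ConditionC (p q : ℕ) (θ : Fin d → ℝ) (P : Set (Fin d → ℂ)) (F : Form d ℂ) : Prop :=
  (∀ I K, ContDiffOn ℝ ∞ (F I K) (P ∩ {z | ∀ i, θ i ≠ 0 → z i ≠ 0})) ∧
  ∀ A ⊆ P, IsCompact A → ∃ ε > (0 : ℝ), ∃ C : ℝ, ∀ I K, ∀ z ∈ A, (∀ i, θ i ≠ 0 → z i ≠ 0) →
    (∏ i, ‖z i‖ ^ (θ i / (2 * Real.pi))) * ‖F I K z‖ ≤
      if p + q = 0 then C else
        C * ∏ i with θ i ≠ 0,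
          ‖z i‖ ^ (ε - (if i ∈ I then 1 else 0) - (if i ∈ K then 1 else 0))

/-- The form `F ⊗ μ` of type `(p, q)`, where `∇ μ = ∑ θ_i / 2π · dz_i / z_i ⊗ μ`, i.e. the form
`α ⊗ s` with the multivalued horizontal section `s = ∏ z_i^{-θ_i / 2π} μ` and
`α = ∏ z_i^{θ_i / 2π} F`, is a section over `P`: all of `α`, `d'α`, `d''α`, `d'd''α` satisfy
condition C. -/
def IsRankOneSection (p q : ℕ) (θ : Fin d → ℝ) (P : Set (Fin d → ℂ)) (F : Form d ℂ) : Prop :=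
  (∀ I K, ¬(I.card = p ∧ K.card = q) → F I K = 0) ∧
  ConditionC p q θ P F ∧
  ConditionC (p + 1) q θ P (twistedDel θ F) ∧
  ConditionC p (q + 1) θ P (dbar F) ∧
  ConditionC (p + 1) (q + 1) θ P (twistedDel θ (dbar F))

end Forms

/-! ### The local system `g̃` and forms with coefficients in it

Let `U = X \ D`, `b ∈ U`, and let `ρ` be a unitary representation of `π₁(U, b)`. The fibre of `g̃`
over `u ∈ U` is identified with the complexified Lie algebra `gl_N(ℂ)` of `U(N)` by transport along
a path from `b` to `u`. A section of `g̃` is thus a function of a point `u` and a homotopy class of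
paths from `b` to `u` (a point of the universal cover of `U`), subject to an equivariance; and
horizontal sections are those that do not change when the path is continued. -/

section LocalSystem

variable {d N : ℕ} {X : Type*} [TopologicalSpace X] {D : Set X} {b : ↥Dᶜ}

/-- Functions on the universal cover of `U = X \ D` with values in `gl_N(ℂ)`. -/
abbrev CoverFun (N : ℕ) {D : Set X} (b : ↥Dᶜ) :=
  ∀ u : ↥Dᶜ, Path.Homotopic.Quotient b u → Matrix (Fin N) (Fin N) ℂ

/-- The coefficients `η I K` of a form `∑ η I K dz_I ∧ dz̄_K` with values in `g̃`. -/
abbrev CoverForm (d N : ℕ) {D : Set X} (b : ↥Dᶜ) :=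
  Finset (Fin d) → Finset (Fin d) → CoverFun N b

/-- The points of `U = X \ D` in the coordinate domain with coordinates in `P`. -/
def domainOver (D : Set X) (e : OpenPartialHomeomorph X (Fin d → ℂ)) (P : Set (Fin d → ℂ)) : Set ↥Dᶜ :=
  {u | (u : X) ∈ e.source ∧ e (u : X) ∈ P}

/-- `s` is a section over `Y ⊆ U` of the local system `g̃` attached to `Ad ∘ ρ`. (In Mathlib the
product of `γ₁` and `γ₂` in the fundamental group is the path `γ₂` followed by `γ₁`.) -/
def IsEquivariant (ρ : FundamentalGroup ↥Dᶜ b →* Matrix.unitaryGroup (Fin N) ℂ)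
    (Y : Set ↥Dᶜ) (s : CoverFun N b) : Prop :=
  ∀ u ∈ Y, ∀ (γ : FundamentalGroup ↥Dᶜ b) (c : Path.Homotopic.Quotient b u),
    s u (γ.toPath.trans c) =
      ((ρ γ)⁻¹ : Matrix.unitaryGroup (Fin N) ℂ).1 * s u c * (ρ γ).1

open Classical in
/-- The branch at `u` of `s` determined by the path `c` from `b` to `u`, in coordinates: its value
at the point with coordinates `z` is the value of `s` at the class of `c` followed by the path
that is a straight line segment in the coordinates (if there is such a path in `U`, which is so
for `z` near `e u`). This is `s` in a local horizontal frame of `g̃`. -/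
def branch (e : OpenPartialHomeomorph X (Fin d → ℂ)) (s : CoverFun N b)
    (u : ↥Dᶜ) (c : Path.Homotopic.Quotient b u) (z : Fin d → ℂ) : Matrix (Fin N) (Fin N) ℂ :=
  if h : ∃ (v : ↥Dᶜ) (γ : Path u v), ∀ t, (γ t : X) ∈ e.source ∧
      e (γ t : X) = AffineMap.lineMap (k := ℝ) (e (u : X)) z (t : ℝ)
  then s h.choose (c.trans (Path.Homotopic.Quotient.mk h.choose_spec.choose)) else 0

/-- The operator `d''` on forms with values in `g̃` (in coordinates, and in local horizontal
frames). -/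
def coverDbar (e : OpenPartialHomeomorph X (Fin d → ℂ)) (η : CoverForm d N b) :
    CoverForm d N b := fun I K u c =>
  dbar (fun I' K' => branch e (η I' K') u c) I K (e (u : X))

/-- `μ` is a section of `g̃` over the part of `U` in `P` such that `∏ z_i^{-θ_i / 2π} μ` is a
multivalued horizontal section (so this section has monodromy `e^{-√-1 θ_i}` around `z_i = 0`).
Along a path, `ℓ i` is a continuous logarithm of `z_i`. -/
def IsEigenSection (e : OpenPartialHomeomorph X (Fin d → ℂ))
    (ρ : FundamentalGroup ↥Dᶜ b →* Matrix.unitaryGroup (Fin N) ℂ)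
    (P : Set (Fin d → ℂ)) (θ : Fin d → ℝ) (μ : CoverFun N b) : Prop :=
  IsEquivariant ρ (domainOver D e P) μ ∧
  ∀ (u v : ↥Dᶜ) (γ : Path u v) (ℓ : C(unitInterval, Fin d → ℂ)),
    (∀ t, γ t ∈ domainOver D e P) → (∀ t i, θ i ≠ 0 → Complex.exp (ℓ t i) = e (γ t : X) i) →
    ∀ c : Path.Homotopic.Quotient b u,
      μ v (c.trans (Path.Homotopic.Quotient.mk γ)) =
        Complex.exp (∑ i, (θ i / (2 * Real.pi) : ℝ) * (ℓ 1 i - ℓ 0 i)) • μ u c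

/-- A splitting over `P` of `g̃` (of rank `N²`) into local systems of rank one; the `a`-th one has
monodromy `e^{-√-1 θ_{a,i}}`, `0 ≤ θ_{a,i} < 2π`, around the component `z_i = 0` of `D`, and
`μ a` spans its canonical extension. -/
structure IsSplitting (e : OpenPartialHomeomorph X (Fin d → ℂ)) (J : Finset (Fin d))
    (ρ : FundamentalGroup ↥Dᶜ b →* Matrix.unitaryGroup (Fin N) ℂ) (P : Set (Fin d → ℂ))
    (θ : Fin (N * N) → Fin d → ℝ) (μ : Fin (N * N) → CoverFun N b) : Prop where
  theta_mem : ∀ a i, θ a i ∈ Ico 0 (2 * Real.pi)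
  theta_eq_zero : ∀ a i, i ∉ J → θ a i = 0
  eigen : ∀ a, IsEigenSection e ρ P (θ a) (μ a)
  basis : ∀ u ∈ domainOver D e P, ∀ c, LinearIndependent ℂ (fun a => μ a u c)

/-- `η` is a section of the sheaf `B^{p,q}(g̃)` over the polydisc `P`: for a splitting of `g̃` over
`P` into local systems of rank one, each component of `η` is a section. -/
def IsPolydiscSection (e : OpenPartialHomeomorph X (Fin d → ℂ)) (J : Finset (Fin d))
    (ρ : FundamentalGroup ↥Dᶜ b →* Matrix.unitaryGroup (Fin N) ℂ) (p q : ℕ)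
    (P : Set (Fin d → ℂ)) (η : CoverForm d N b) : Prop :=
  ∃ (θ : Fin (N * N) → Fin d → ℝ) (μ : Fin (N * N) → CoverFun N b) (F : Fin (N * N) → Form d ℂ),
    IsSplitting e J ρ P θ μ ∧
    (∀ a, IsRankOneSection p q (θ a) P (F a)) ∧
    ∀ I K, ∀ u ∈ domainOver D e P, ∀ c, η I K u c = ∑ a, F a I K (e (u : X)) • μ a u c

/-- `η` is a section of the sheaf `B^{p,q}(g̃)` over the open set with coordinates in `W`: its
restriction to every polydisc in `W` is a section. -/
def IsSection (e : OpenPartialHomeomorph X (Fin d → ℂ)) (J : Finset (Fin d))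
    (ρ : FundamentalGroup ↥Dᶜ b →* Matrix.unitaryGroup (Fin N) ℂ) (p q : ℕ)
    (W : Set (Fin d → ℂ)) (η : CoverForm d N b) : Prop :=
  ∀ (c : Fin d → ℂ) (R : Fin d → ℝ), (∀ i, 0 < R i) → openPolydisc c R ⊆ W →
    IsPolydiscSection e J ρ p q (openPolydisc c R) η

end LocalSystem

end

end LogDolbeault

/-! Over a slightly larger polydisc the form is a combination of the frame sections `μ a` of one
splitting. In a horizontal frame these vary holomorphically, so d'' acts on the coefficients alone
(`coverDbar_eq`), and it suffices to solve the equation with growth conditions in rank one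
(`rankOne_primitive`).

In rank one put z_i = e^{w_i} - c_i, where c_i = 0 if θ_i ≠ 0 and c_i is otherwise a shift keeping
e^{w_i} away from 0. Multiplying the coefficients by `pre` passes to the frames dw_I ∧ dw̄_K ⊗ s.
There d' and d'' have constant coefficients, condition C becomes a bound by the weight ∏ e^{ε_i Re
w_i}, and the monodromy becomes the multiplier e^{2πiλ_i} under w_i ↦ w_i + 2πi, with λ_i = θ_i/2π.
The exponents can be chosen with λ_i - 1 < ε_i < λ_i for all i: a small positive number below λ_i if
θ_i ≠ 0, and -1/2 if θ_i = 0, where e^{w_i} is bounded away from 0 and ∞ on the region in question.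

In this range ∂/∂w̄_i is inverted by a convolution. The kernel e^{(1-λ)τ}/(e^τ - 1) has the
multiplier complementary to that of the functions, and against the weight it decays at both ends of
the cylinder (`norm_expKernel_le`). A bump in Im τ whose 2π-translates add up to 1 turns it into a
kernel on ℂ with its only pole at 0. Cauchy–Pompeiu and a cancellation between translates
(`integral_planeDbar_cylKernel`) then show that it is an exact inverse (`Cv_cylinder`).

The rest is the Dolbeault–Grothendieck induction: by `dbar_contr`, inverting ∂/∂w̄_i and contracting
with it gives a homotopy operator that removes dw̄_i (`elimination_step`). Condition C bounds only
the form and its d', whereas differentiation under these non-compact integrals calls for bounds on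
all derivatives. Hence every variable is first smoothed by a compactly supported kernel, at the
price of an exact term (`smoothing_step`). All these convolutions commute with d', so the bound on
d' passes to the primitive. -/

namespace LogDolbeault

noncomputable section

/-! ### The Cauchy–Pompeiu formula on the whole plane. -/

section Plane

open MeasureTheory Filter Topology Complex

/-- `∂/∂τ̄` for functions of one complex variable. -/
def planeDbar (φ : ℂ → ℂ) (τ : ℂ) : ℂ :=
  (1 / 2 : ℂ) * (fderiv ℝ φ τ 1 + I * fderiv ℝ φ τ I)

lemma integrableOn_polar {f : ℂ → ℝ} (hm : Measurable f) (hf : Integrable f) :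
    IntegrableOn (fun p : ℝ × ℝ => p.1 * f (Complex.polarCoord.symm p)) polarCoord.target := by
  have hsm : Measurable (fun p : ℝ × ℝ => Complex.polarCoord.symm p) := by
    have : Continuous (fun p : ℝ × ℝ => Complex.polarCoord.symm p) := by
      simp only [Complex.polarCoord_symm_apply]; fun_prop
    exact this.measurable
  refine ⟨(measurable_fst.mul (hm.comp hsm)).aestronglyMeasurable, ?_⟩
  have h := hf.2
  rw [hasFiniteIntegral_iff_enorm] at h ⊢
  rw [← Complex.lintegral_comp_polarCoord_symm] at h
  refine lt_of_le_of_lt (le_of_eq ?_) h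
  refine setLIntegral_congr_fun polarCoord.open_target.measurableSet (fun p hp => ?_)
  have hp1 : 0 < p.1 := hp.1
  simp only [enorm_mul, smul_eq_mul, Real.enorm_eq_ofReal hp1.le]

lemma polar_radial {φ : ℂ → ℂ} (hφ : ContDiff ℝ 1 φ) (r θ : ℝ) :
    HasDerivAt (fun r : ℝ => φ (r * (Real.cos θ + Real.sin θ * I)))
      (fderiv ℝ φ (r * (Real.cos θ + Real.sin θ * I)) (Real.cos θ + Real.sin θ * I)) r := by
  have h1 : HasDerivAt (fun r : ℝ => (r : ℂ) * (Real.cos θ + Real.sin θ * I))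
      (Real.cos θ + Real.sin θ * I : ℂ) r := by
    simpa using (Complex.ofRealCLM.hasDerivAt (x := r)).mul_const (Real.cos θ + Real.sin θ * I : ℂ)
  exact ((hφ.differentiable one_ne_zero) _).hasFDerivAt.comp_hasDerivAt r h1

lemma polar_angular {φ : ℂ → ℂ} (hφ : ContDiff ℝ 1 φ) (r θ : ℝ) :
    HasDerivAt (fun θ : ℝ => φ (r * (Real.cos θ + Real.sin θ * I)))
      (r * fderiv ℝ φ (r * (Real.cos θ + Real.sin θ * I)) (-Real.sin θ + Real.cos θ * I)) θ := by
  have h1 : HasDerivAt (fun θ : ℝ => (r : ℂ) * (Real.cos θ + Real.sin θ * I))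
      (r * (-Real.sin θ + Real.cos θ * I) : ℂ) θ := by
    have hc := (Real.hasDerivAt_cos θ).ofReal_comp
    have hs := (Real.hasDerivAt_sin θ).ofReal_comp
    simpa using (hc.add (hs.mul_const I)).const_mul (r : ℂ)
  have h2 := ((hφ.differentiable one_ne_zero) (r * (Real.cos θ + Real.sin θ * I))).hasFDerivAt.comp_hasDerivAt θ h1
  rw [← Complex.real_smul (x := r) (z := fderiv ℝ φ _ _), ← map_smul, Complex.real_smul]
  exact h2

/-- In polar coordinates the Jacobian r cancels the pole and the integrand is half of ∂_r φ + (i/r)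
∂_θ φ. The first term integrates to -φ(0) along almost every ray, the second to 0 around every
circle. Compact support is not assumed, because the cylinder kernel extends to infinity in the real
direction. -/
theorem cauchyPompeiu {φ : ℂ → ℂ} (hφ : ContDiff ℝ 1 φ)
    (hint : Integrable (fun τ => ‖τ‖⁻¹ * ‖fderiv ℝ φ τ‖))
    (h0 : Tendsto φ (cocompact ℂ) (𝓝 0)) :
    ∫ τ, τ⁻¹ * planeDbar φ τ = -(Real.pi : ℂ) * φ 0 := by
  have hDc : Continuous (fderiv ℝ φ) := hφ.continuous_fderiv one_ne_zero
  have hmeas : Measurable (fun τ => ‖τ‖⁻¹ * ‖fderiv ℝ φ τ‖) :=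
    (measurable_norm.inv).mul hDc.norm.measurable
  have hpol := integrableOn_polar hmeas hint
  set E : ℝ × ℝ → ℂ := fun p => p.1 * (Real.cos p.2 + Real.sin p.2 * I) with hE
  have hEc : Continuous E := by simp only [hE]; fun_prop
  set A : ℝ × ℝ → ℂ := fun p => fderiv ℝ φ (E p) (Real.cos p.2 + Real.sin p.2 * I) with hA
  set B : ℝ × ℝ → ℂ := fun p => fderiv ℝ φ (E p) (-Real.sin p.2 + Real.cos p.2 * I) with hB
  have hAc : Continuous A := (hDc.comp hEc).clm_apply (by fun_prop)
  have hBc : Continuous B := (hDc.comp hEc).clm_apply (by fun_prop)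
  have hn1 : ∀ θ : ℝ, ‖(Real.cos θ + Real.sin θ * I : ℂ)‖ = 1 := fun θ => by
    simp [Complex.norm_cos_add_sin_mul_I θ]
  have hn2 : ∀ θ : ℝ, ‖(-Real.sin θ + Real.cos θ * I : ℂ)‖ = 1 := fun θ => by
    have : (-Real.sin θ + Real.cos θ * I : ℂ) = I * (Real.cos θ + Real.sin θ * I) := by
      ring_nf; simp
    rw [this, norm_mul, hn1]; simp
  have key : ∀ p ∈ polarCoord.target, p.1 * (‖Complex.polarCoord.symm p‖⁻¹ *
      ‖fderiv ℝ φ (Complex.polarCoord.symm p)‖) = ‖fderiv ℝ φ (E p)‖ := by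
    intro p hp
    have hp1 : 0 < p.1 := hp.1
    have : Complex.polarCoord.symm p = E p := by simp [hE]
    rw [Complex.norm_polarCoord_symm, abs_of_pos hp1, this]
    field_simp
  have hD : IntegrableOn (fun p => ‖fderiv ℝ φ (E p)‖) polarCoord.target :=
    hpol.congr_fun key polarCoord.open_target.measurableSet
  have hAi : IntegrableOn A polarCoord.target :=
    Integrable.mono' hD hAc.aestronglyMeasurable (Eventually.of_forall fun p => by
      simpa only [hn1, mul_one] using (fderiv ℝ φ (E p)).le_opNorm (Real.cos p.2 + Real.sin p.2 * I))
  have hBi : IntegrableOn B polarCoord.target :=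
    Integrable.mono' hD hBc.aestronglyMeasurable (Eventually.of_forall fun p => by
      simpa only [hn2, mul_one] using (fderiv ℝ φ (E p)).le_opNorm (-Real.sin p.2 + Real.cos p.2 * I))
  have htar : polarCoord.target = Ioi (0 : ℝ) ×ˢ Ioo (-Real.pi) Real.pi := rfl
  have hAint : ∫ p in polarCoord.target, A p = -(2 * Real.pi : ℂ) * φ 0 := by
    rw [htar] at hAi ⊢
    rw [Measure.volume_eq_prod, ← setIntegral_prod_swap, setIntegral_prod (fun z : ℝ × ℝ => A z.swap) hAi.swap]
    -- Fubini gives integrability along almost every ray only, so the exceptional rays are carried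
    -- as an alternative and discarded in `h2`.
    have h1 : ∀ θ ∈ Ioo (-Real.pi) Real.pi, ∫ r in Ioi (0 : ℝ), A (r, θ) = -φ 0 ∨
        ¬ IntegrableOn (fun r => A (r, θ)) (Ioi 0) := by
      intro θ _
      by_cases hi : IntegrableOn (fun r => A (r, θ)) (Ioi 0)
      · left
        have := integral_Ioi_of_hasDerivAt_of_tendsto' (a := (0 : ℝ)) (m := (0 : ℂ))
          (fun r _ => polar_radial hφ r θ) hi ?_
        · rw [ofReal_zero, zero_mul, zero_sub] at this
          exact this
        · refine h0.comp ?_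
          rw [← Metric.cobounded_eq_cocompact, ← comap_norm_atTop, tendsto_comap_iff]
          unfold Function.comp
          have : ∀ r : ℝ, ‖(r : ℂ) * (Real.cos θ + Real.sin θ * I)‖ = |r| := fun r => by
            rw [norm_mul, hn1]; simp
          simp only [this]
          exact tendsto_abs_atTop_atTop
      · right; exact hi
    have h2 : ∀ᵐ θ ∂(volume.restrict (Ioo (-Real.pi) Real.pi)),
        ∫ r in Ioi (0 : ℝ), A (r, θ) = -φ 0 := by
      have hsec := hAi.swap
      rw [IntegrableOn, ← Measure.prod_restrict] at hsec
      have h3 := hsec.prod_right_ae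
      filter_upwards [h3, ae_restrict_mem measurableSet_Ioo] with θ h4 h5
      rcases h1 θ h5 with h | h
      · exact h
      · exact absurd h4 h
    simp only [Prod.swap_prod_mk]
    rw [integral_congr_ae (g := fun _ => -φ 0) h2]
    simp [Real.pi_pos.le]
    left; ring
  have hBint : ∫ p in polarCoord.target, B p = 0 := by
    rw [htar] at hBi ⊢
    rw [Measure.volume_eq_prod, setIntegral_prod _ hBi]
    refine setIntegral_eq_zero_of_forall_eq_zero fun r hr => ?_
    have hr : (0 : ℝ) < r := hr
    have h1 := intervalIntegral.integral_eq_sub_of_hasDerivAt (a := -Real.pi) (b := Real.pi)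
      (fun θ _ => polar_angular hφ r θ)
      (((hBc.comp (Continuous.prodMk_right r)).const_mul (r : ℂ)).intervalIntegrable _ _)
    rw [intervalIntegral.integral_of_le (by linarith [Real.pi_pos]), integral_Ioc_eq_integral_Ioo] at h1
    have h2 : ∫ θ in Ioo (-Real.pi) Real.pi, (r : ℂ) * B (r, θ) = 0 := by
      rw [h1]; simp
    rw [integral_const_mul] at h2
    exact (mul_eq_zero.mp h2).resolve_left (by exact_mod_cast hr.ne')
  rw [← Complex.integral_comp_polarCoord_symm]
  -- Here r τ⁻¹ = e^{-iθ}, which undoes the rotation from the frame (1, i) to the radial and angular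
  -- directions.
  have hfin : ∀ p ∈ polarCoord.target, p.1 • ((Complex.polarCoord.symm p)⁻¹ *
      planeDbar φ (Complex.polarCoord.symm p)) = (1 / 2 : ℂ) * (A p + I * B p) := by
    intro p hp
    have hp1 : (p.1 : ℂ) ≠ 0 := by exact_mod_cast (ne_of_gt hp.1 : p.1 ≠ 0)
    have h1 : Complex.polarCoord.symm p = E p := by simp [hE]
    rw [h1, planeDbar]
    have hl : ∀ a b : ℝ, fderiv ℝ φ (E p) (a + b * I) =
        a * fderiv ℝ φ (E p) 1 + b * fderiv ℝ φ (E p) I := fun a b => by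
      have : (a + b * I : ℂ) = a • (1 : ℂ) + b • I := by simp
      rw [this, map_add, map_smul, map_smul]; simp
    have hA' : A p = Real.cos p.2 * fderiv ℝ φ (E p) 1 + Real.sin p.2 * fderiv ℝ φ (E p) I := hl _ _
    have hB' : B p = -Real.sin p.2 * fderiv ℝ φ (E p) 1 + Real.cos p.2 * fderiv ℝ φ (E p) I := by
      have := hl (-Real.sin p.2) (Real.cos p.2)
      rw [ofReal_neg] at this
      exact this
    have hu : (Real.cos p.2 + Real.sin p.2 * I : ℂ) ≠ 0 := by
      rw [← norm_ne_zero_iff, hn1]; exact one_ne_zero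
    have hsq : (Real.cos p.2 : ℂ) ^ 2 + (Real.sin p.2 : ℂ) ^ 2 = 1 := by
      exact_mod_cast Real.cos_sq_add_sin_sq p.2
    have hEp : E p = p.1 * (Real.cos p.2 + Real.sin p.2 * I) := rfl
    have hinv : (E p)⁻¹ = (p.1 : ℂ)⁻¹ * (Real.cos p.2 - Real.sin p.2 * I) := by
      rw [hEp, mul_inv]; congr 1
      refine inv_eq_of_mul_eq_one_left ?_
      linear_combination hsq - (Real.sin p.2 : ℂ) ^ 2 * I_sq
    rw [hinv, hA', hB', Complex.real_smul]
    field_simp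
    linear_combination (-(Real.sin p.2 : ℂ) * fderiv ℝ φ (E p) I) * I_sq
  rw [setIntegral_congr_fun polarCoord.open_target.measurableSet hfin, integral_const_mul,
    integral_add hAi (hBi.const_mul I), integral_const_mul, hAint, hBint]
  ring

end Plane

/-! ### A Cauchy kernel with monodromy on the cylinder ℂ/2πiℤ. -/

section Kernel

open MeasureTheory Filter Topology Complex

lemma integrable_inv_norm_mul_exp {a : ℝ} (ha : 0 < a) :
    Integrable (fun τ : ℂ => ‖τ‖⁻¹ * Real.exp (-a * ‖τ‖)) := by
  have h := (integrable_fun_norm_addHaar (E := ℂ) (F := ℝ) volume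
    (f := fun r : ℝ => r⁻¹ * Real.exp (-a * r))).mpr ?_
  · exact h
  · have h1 := integrableOn_exp_mul_Ioi (neg_neg_of_pos ha) 0
    refine h1.congr_fun (fun r hr => ?_) measurableSet_Ioi
    have : (r : ℝ) ≠ 0 := ne_of_gt hr
    simp [Complex.finrank_real_complex]
    field_simp

/-- A smooth step from `0` to `1`. -/
def cutStep (y : ℝ) : ℝ := Real.smoothTransition ((y - 1) / 2)

lemma contDiff_cutStep : ContDiff ℝ ∞ cutStep := by
  unfold cutStep
  exact Real.smoothTransition.contDiff.comp (by fun_prop)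

lemma cutStep_of_le {y : ℝ} (h : y ≤ 1) : cutStep y = 0 :=
  Real.smoothTransition.zero_of_nonpos (by linarith)

lemma cutStep_of_ge {y : ℝ} (h : 3 ≤ y) : cutStep y = 1 :=
  Real.smoothTransition.one_of_one_le (by linarith)

/-- A smooth bump on the strip `|y| < 2π` whose `2π`-translates add up to `1`. -/
def stripBump (y : ℝ) : ℝ := cutStep (y + 2 * Real.pi) - cutStep y

lemma contDiff_stripBump : ContDiff ℝ ∞ stripBump := by
  unfold stripBump
  exact (contDiff_cutStep.comp (by fun_prop)).sub contDiff_cutStep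

lemma abs_stripBump_le (y : ℝ) : |stripBump y| ≤ 2 := by
  unfold stripBump cutStep
  have h1 := Real.smoothTransition.nonneg ((y - 1) / 2)
  have h2 := Real.smoothTransition.le_one ((y - 1) / 2)
  have h3 := Real.smoothTransition.nonneg ((y + 2 * Real.pi - 1) / 2)
  have h4 := Real.smoothTransition.le_one ((y + 2 * Real.pi - 1) / 2)
  rw [abs_le]; constructor <;> linarith

lemma stripBump_of_ge {y : ℝ} (h : 3 ≤ y) : stripBump y = 0 := by
  rw [stripBump, cutStep_of_ge h, cutStep_of_ge (by linarith [Real.pi_pos])]; simp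

/-- The bump already vanishes for y ≤ 1 - 2π; the integer -6 is a convenient bound below that and
still above -2π. -/
lemma stripBump_of_le {y : ℝ} (h : y ≤ -6) : stripBump y = 0 := by
  have := Real.pi_lt_d2
  have := Real.pi_gt_three
  rw [stripBump, cutStep_of_le (y := y) (by linarith), cutStep_of_le (by linarith)]; simp

/-- The kernel `e^{(1-l)τ} / (e^τ - 1)`. -/
def expKernel (l : ℝ) (τ : ℂ) : ℂ := exp ((1 - l) * τ) / (exp τ - 1)

/-- The function `τ e^{(1-l)τ} / (e^τ - 1)`, extended over `τ = 0`. -/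
def regKernel (l : ℝ) (τ : ℂ) : ℂ := exp ((1 - l) * τ) / dslope exp 0 τ

lemma regKernel_eq {l : ℝ} {τ : ℂ} (h : τ ≠ 0) : regKernel l τ = τ * expKernel l τ := by
  rw [regKernel, expKernel, dslope_of_ne _ h, slope_def_field, sub_zero, exp_zero]
  field_simp

lemma regKernel_zero (l : ℝ) : regKernel l 0 = 1 := by
  rw [regKernel, dslope_same]; simp

lemma exp_ne_one_of_abs_im_lt {τ : ℂ} (h : |τ.im| < 2 * Real.pi) (h0 : τ ≠ 0) : exp τ ≠ 1 := by
  intro h1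
  obtain ⟨n, rfl⟩ := Complex.exp_eq_one_iff.mp h1
  have him : ((n : ℂ) * (2 * Real.pi * I)).im = n * (2 * Real.pi) := by simp
  rw [him, abs_mul, abs_of_pos Real.two_pi_pos] at h
  have hn : |(n : ℝ)| < 1 := by
    by_contra hc
    push Not at hc
    nlinarith [Real.two_pi_pos]
  have : n = 0 := by
    rw [← Int.abs_lt_one_iff]; exact_mod_cast hn
  simp [this] at h0

lemma differentiable_dslope_exp : Differentiable ℂ (dslope exp 0) := by
  have := (Complex.differentiableOn_dslope (f := exp) (s := univ) (c := 0) univ_mem).mpr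
    differentiable_exp.differentiableOn
  exact differentiableOn_univ.mp this

/-- The only zero of e^τ - 1 in this strip is τ = 0, and it is simple, so the divided difference
removes it. -/
lemma dslope_exp_ne_zero {τ : ℂ} (h : |τ.im| < 2 * Real.pi) : dslope exp 0 τ ≠ 0 := by
  by_cases h0 : τ = 0
  · simp [h0]
  · rw [dslope_of_ne _ h0, slope_def_field, sub_zero, exp_zero]
    exact div_ne_zero (sub_ne_zero.mpr (exp_ne_one_of_abs_im_lt h h0)) h0

lemma differentiableAt_regKernel {l : ℝ} {τ : ℂ} (h : |τ.im| < 2 * Real.pi) :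
    DifferentiableAt ℂ (regKernel l) τ := by
  unfold regKernel
  exact DifferentiableAt.div (by fun_prop) differentiable_dslope_exp.differentiableAt
    (dslope_exp_ne_zero h)

lemma contDiffAt_regKernel {l : ℝ} {τ : ℂ} (h : |τ.im| < 2 * Real.pi) :
    ContDiffAt ℝ ∞ (regKernel l) τ := by
  have h1 : ContDiffAt ℂ ∞ (regKernel l) τ := by
    unfold regKernel
    refine ContDiffAt.div (by fun_prop) differentiable_dslope_exp.contDiff.contDiffAt
      (dslope_exp_ne_zero h)
  exact h1.restrict_scalars ℝ

/-- The function `h` for which `h(τ) / τ` is the kernel of the solution operator on the cylinder. -/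
def cylKernel (l : ℝ) (τ : ℂ) : ℂ := (stripBump τ.im : ℂ) * regKernel l τ

lemma cylKernel_zero (l : ℝ) : cylKernel l 0 = 1 := by
  rw [cylKernel, regKernel_zero, stripBump, zero_im, cutStep_of_ge, cutStep_of_le] <;>
  simp; linarith [Real.pi_gt_three]

lemma cylKernel_eventually_zero {l : ℝ} {τ : ℂ} (h : 3 < τ.im ∨ τ.im < -6) :
    cylKernel l =ᶠ[𝓝 τ] 0 := by
  rcases h with h | h
  · filter_upwards [(isOpen_lt continuous_const continuous_im).mem_nhds h] with x hx
    rw [cylKernel, stripBump_of_ge (le_of_lt hx)]; simp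
  · filter_upwards [(isOpen_lt continuous_im continuous_const).mem_nhds h] with x hx
    rw [cylKernel, stripBump_of_le (le_of_lt hx)]; simp

/-- Since 3 and 6 are below 2π, the strip where `regKernel` is holomorphic and the open set where
the bump vanishes cover the plane. Local properties of `cylKernel` can therefore be checked on each
separately. -/
lemma strip_trichotomy (τ : ℂ) : |τ.im| < 2 * Real.pi ∨ (3 < τ.im ∨ τ.im < -6) := by
  have := Real.pi_gt_three
  by_cases h1 : 3 < τ.im
  · right; left; exact h1
  by_cases h2 : τ.im < -6
  · right; right; exact h2
  left; rw [abs_lt]; constructor <;> linarith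

lemma contDiff_stripBump_im : ContDiff ℝ ∞ (fun τ : ℂ => (stripBump τ.im : ℂ)) :=
  ofRealCLM.contDiff.comp (contDiff_stripBump.comp imCLM.contDiff)

lemma contDiff_cylKernel (l : ℝ) : ContDiff ℝ ∞ (cylKernel l) := by
  rw [contDiff_iff_contDiffAt]
  intro τ
  rcases strip_trichotomy τ with h | h
  · exact contDiff_stripBump_im.contDiffAt.mul (contDiffAt_regKernel h)
  · exact contDiffAt_const.congr_of_eventuallyEq (cylKernel_eventually_zero h)

lemma half_le_norm_exp_sub_one {τ : ℂ} (h : 1 ≤ |τ.re|) :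
    Real.exp τ.re / 2 ≤ ‖exp τ - 1‖ ∧ 1 / 2 ≤ ‖exp τ - 1‖ := by
  have h1 : (2 : ℝ) ≤ Real.exp 1 := by have := Real.add_one_le_exp 1; linarith
  rcases le_total 0 τ.re with h0 | h0
  · rw [abs_of_nonneg h0] at h
    have h2 : (2 : ℝ) ≤ Real.exp τ.re := h1.trans (Real.exp_le_exp.mpr h)
    have h3 := norm_sub_norm_le (exp τ) 1
    rw [norm_exp, norm_one] at h3
    constructor <;> linarith
  · rw [abs_of_nonpos h0] at h
    have h2 : Real.exp τ.re ≤ 1 / 2 := by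
      have : Real.exp τ.re * Real.exp (-τ.re) = 1 := by rw [← Real.exp_add]; simp
      have h4 : (2 : ℝ) ≤ Real.exp (-τ.re) := h1.trans (Real.exp_le_exp.mpr h)
      nlinarith [Real.exp_pos τ.re]
    have h3 := norm_sub_norm_le 1 (exp τ)
    rw [norm_exp, norm_one, norm_sub_rev] at h3
    constructor <;> linarith

/-- The kernel behaves like e^{-lτ} as Re τ → +∞ and like -e^{(1-l)τ} as Re τ → -∞. After weighting,
the decay rates at the two ends are l - ε and 1 - l + ε, which are both positive exactly when l - 1
< ε < l. -/
lemma norm_expKernel_le {l ε : ℝ} {τ : ℂ} (h : 1 ≤ |τ.re|) :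
    ‖expKernel l τ‖ * Real.exp (ε * τ.re) ≤
      2 * Real.exp (-(min (1 - l + ε) (l - ε)) * |τ.re|) := by
  obtain ⟨h1, h2⟩ := half_le_norm_exp_sub_one h
  have hn : ‖exp ((1 - l) * τ)‖ = Real.exp ((1 - l) * τ.re) := by
    rw [norm_exp]; congr 1
    have : ((1 : ℂ) - l) = ((1 - l : ℝ) : ℂ) := by push_cast; rfl
    rw [this, re_ofReal_mul]
  rw [expKernel, norm_div, hn]
  have hpos : 0 < ‖exp τ - 1‖ := by linarith
  rw [div_mul_eq_mul_div, div_le_iff₀ hpos, ← Real.exp_add]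
  rcases le_total 0 τ.re with h0 | h0
  · rw [abs_of_nonneg h0]
    calc Real.exp ((1 - l) * τ.re + ε * τ.re)
        ≤ Real.exp (-(min (1 - l + ε) (l - ε)) * τ.re + τ.re) := by
          apply Real.exp_le_exp.mpr
          nlinarith [min_le_right (1 - l + ε) (l - ε)]
      _ = 2 * Real.exp (-(min (1 - l + ε) (l - ε)) * τ.re) * (Real.exp τ.re / 2) := by
          rw [Real.exp_add]; ring
      _ ≤ _ := by gcongr
  · rw [abs_of_nonpos h0]
    calc Real.exp ((1 - l) * τ.re + ε * τ.re)
        ≤ Real.exp (-(min (1 - l + ε) (l - ε)) * -τ.re) := by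
          apply Real.exp_le_exp.mpr
          nlinarith [min_le_left (1 - l + ε) (l - ε)]
      _ = 2 * Real.exp (-(min (1 - l + ε) (l - ε)) * -τ.re) * (1 / 2) := by ring
      _ ≤ _ := by gcongr

lemma hasDerivAt_expKernel {l : ℝ} {τ : ℂ} (h : 1 ≤ |τ.re|) :
    HasDerivAt (expKernel l) (expKernel l τ * ((1 - l) - exp τ / (exp τ - 1))) τ := by
  have hne : exp τ - 1 ≠ 0 := by
    rw [← norm_pos_iff]; linarith [(half_le_norm_exp_sub_one h).2]
  have h1 : HasDerivAt (fun τ => exp ((1 - l) * τ)) (exp ((1 - l) * τ) * (1 - l)) τ := by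
    simpa using ((hasDerivAt_id τ).const_mul ((1 : ℂ) - l)).cexp
  have h2 : HasDerivAt (fun τ => exp τ - 1) (exp τ) τ := (Complex.hasDerivAt_exp τ).sub_const 1
  refine (h1.div h2 hne).congr_deriv ?_
  unfold expKernel; field_simp

lemma exists_bound_deriv_stripBump : ∃ M : ℝ, 0 ≤ M ∧ ∀ y, ‖deriv stripBump y‖ ≤ M := by
  have hc : HasCompactSupport stripBump := by
    refine HasCompactSupport.intro (isCompact_Icc (a := -6) (b := 3)) fun y hy => ?_
    simp only [mem_Icc, not_and_or, not_le] at hy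
    rcases hy with h | h
    · exact stripBump_of_le h.le
    · exact stripBump_of_ge h.le
  obtain ⟨M, hM⟩ := hc.deriv.exists_bound_of_continuous (contDiff_stripBump.continuous_deriv (by simp))
  exact ⟨M, (norm_nonneg _).trans (hM 0), hM⟩

lemma hasFDerivAt_stripBump_im (τ : ℂ) : HasFDerivAt (fun τ : ℂ => (stripBump τ.im : ℂ))
    ((deriv stripBump τ.im) • (ofRealCLM.comp imCLM)) τ := by
  have h1 : HasDerivAt stripBump (deriv stripBump τ.im) τ.im :=
    (contDiff_stripBump.differentiable (by simp) _).hasDerivAt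
  refine (h1.ofReal_comp.hasFDerivAt.comp τ imCLM.hasFDerivAt).congr_fderiv ?_
  ext v
  simp [mul_comm]

/-- Away from the imaginary axis the logarithmic derivative of `expKernel` is bounded, so a
derivative costs only a constant. The factor ‖τ‖ comes from `regKernel_eq`. -/
lemma exists_bound_far (l : ℝ) : ∃ M : ℝ, 0 ≤ M ∧ ∀ τ : ℂ, 1 ≤ |τ.re| →
    ‖cylKernel l τ‖ ≤ M * ‖τ‖ * ‖expKernel l τ‖ ∧
    ‖fderiv ℝ (cylKernel l) τ‖ ≤ M * ‖τ‖ * ‖expKernel l τ‖ := by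
  obtain ⟨M, hM0, hM⟩ := exists_bound_deriv_stripBump
  refine ⟨M + 2 * (1 + (|1 - l| + 2)), by positivity, fun τ hτ => ?_⟩
  have hτ1 : 1 ≤ ‖τ‖ := hτ.trans (abs_re_le_norm τ)
  have hτ0 : τ ≠ 0 := by rw [← norm_pos_iff]; linarith
  set k := expKernel l τ
  have hb : ‖(stripBump τ.im : ℂ)‖ ≤ 2 := by
    rw [norm_real]; exact abs_stripBump_le _
  have hfac : 0 ≤ ‖τ‖ * ‖k‖ := by positivity
  constructor
  · rw [cylKernel, norm_mul, regKernel_eq hτ0, norm_mul]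
    have : 0 ≤ |1 - l| := abs_nonneg _
    calc _ ≤ 2 * (‖τ‖ * ‖k‖) := by gcongr
      _ ≤ (M + 2 * (1 + (|1 - l| + 2))) * (‖τ‖ * ‖k‖) := by gcongr; linarith
      _ = _ := by ring
  · set k' := k * ((1 - l) - exp τ / (exp τ - 1)) with hk'
    have hk'n : ‖k'‖ ≤ ‖k‖ * (|1 - l| + 2) := by
      rw [hk', norm_mul]
      gcongr
      refine (norm_sub_le _ _).trans ?_
      have h1 : ‖((1 : ℂ) - l)‖ = |1 - l| := by
        rw [← ofReal_one, ← ofReal_sub, norm_real, Real.norm_eq_abs]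
      obtain ⟨h2, h3⟩ := half_le_norm_exp_sub_one hτ
      rw [h1, norm_div, norm_exp]
      gcongr
      rw [div_le_iff₀ (by linarith)]; linarith
    have hreg : HasDerivAt (regKernel l) (1 * k + τ * k') τ := by
      have h1 := (hasDerivAt_id τ).mul (hasDerivAt_expKernel (l := l) hτ)
      refine h1.congr_of_eventuallyEq ?_
      filter_upwards [isOpen_ne.mem_nhds hτ0] with x hx
      rw [regKernel_eq hx]; rfl
    have hD := (hasFDerivAt_stripBump_im τ).mul hreg.complexToReal_fderiv
    have : fderiv ℝ (cylKernel l) τ = _ := hD.fderiv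
    rw [this, regKernel_eq hτ0]
    refine (norm_add_le _ _).trans ?_
    rw [norm_smul, norm_smul, norm_smul, norm_smul, norm_mul]
    have n1 : ‖(1 : ℂ →L[ℝ] ℂ)‖ ≤ 1 := ContinuousLinearMap.norm_id_le
    have n2 : ‖ofRealCLM.comp imCLM‖ ≤ 1 := by
      refine (ContinuousLinearMap.opNorm_comp_le _ _).trans ?_
      simp
    have n3 : ‖1 * k + τ * k'‖ ≤ (1 + (|1 - l| + 2)) * (‖τ‖ * ‖k‖) := by
      refine (norm_add_le _ _).trans ?_
      rw [one_mul, norm_mul]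
      have : ‖k‖ ≤ ‖τ‖ * ‖k‖ := le_mul_of_one_le_left (norm_nonneg _) hτ1
      have := mul_le_mul_of_nonneg_left hk'n (norm_nonneg τ)
      nlinarith
    have n4 := hM τ.im
    calc _ ≤ 2 * ((1 + (|1 - l| + 2)) * (‖τ‖ * ‖k‖) * 1) + ‖τ‖ * ‖k‖ * (M * 1) := by
          gcongr
      _ = _ := by ring

lemma cylKernel_outside {l : ℝ} {τ : ℂ} (h : 6 < |τ.im|) :
    cylKernel l τ = 0 ∧ fderiv ℝ (cylKernel l) τ = 0 := by
  have : cylKernel l =ᶠ[𝓝 τ] 0 := by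
    apply cylKernel_eventually_zero
    rcases lt_abs.mp h with h | h
    · left; linarith
    · right; linarith
  refine ⟨this.eq_of_nhds, ?_⟩
  rw [this.fderiv_eq]; simp

/-- The linear factor of `exists_bound_far` is absorbed by giving up half of the decay rate. Decay
in Re τ amounts to decay in ‖τ‖ because the kernel is supported in |Im τ| ≤ 6. -/
theorem exists_bound_cylKernel {l ε : ℝ} (h1 : l - 1 < ε) (h2 : ε < l) :
    ∃ a C : ℝ, 0 < a ∧ 0 ≤ C ∧ ∀ τ : ℂ,
      ‖cylKernel l τ‖ * Real.exp (ε * τ.re) ≤ C * Real.exp (-a * ‖τ‖) ∧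
      ‖fderiv ℝ (cylKernel l) τ‖ * Real.exp (ε * τ.re) ≤ C * Real.exp (-a * ‖τ‖) := by
  obtain ⟨M, hM0, hM⟩ := exists_bound_far l
  set b := min (1 - l + ε) (l - ε) with hb
  have hb0 : 0 < b := lt_min (by linarith) (by linarith)
  -- The radius is 1 + 6: the ball contains the rectangle |Re τ| < 1, |Im τ| ≤ 6, to which
  -- `exists_bound_far` does not apply.
  have hK : IsCompact (Metric.closedBall (0 : ℂ) 7) := isCompact_closedBall _ _
  have hc0 : Continuous (fun τ => ‖cylKernel l τ‖ * Real.exp (ε * τ.re)) :=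
    (contDiff_cylKernel l).continuous.norm.mul (by fun_prop)
  have hc1 : Continuous (fun τ => ‖fderiv ℝ (cylKernel l) τ‖ * Real.exp (ε * τ.re)) :=
    ((contDiff_cylKernel l).continuous_fderiv (by simp)).norm.mul (by fun_prop)
  obtain ⟨B0, hB0⟩ := hK.exists_bound_of_continuousOn hc0.continuousOn
  obtain ⟨B1, hB1⟩ := hK.exists_bound_of_continuousOn hc1.continuousOn
  set B := max B0 B1
  have hBpos : 0 ≤ B := (norm_nonneg _).trans ((hB0 0 (by simp)).trans (le_max_left _ _))
  set C := B * Real.exp (b / 2 * 7) + M * (2 / b) * (2 * Real.exp (6 * b)) with hC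
  have hCpos : 0 ≤ C := by positivity
  refine ⟨b / 2, C, by positivity, hCpos, fun τ => ?_⟩
  suffices h : ∀ x : ℝ, 0 ≤ x → (‖τ‖ ≤ 7 → x * Real.exp (ε * τ.re) ≤ B) →
      (1 ≤ |τ.re| → x ≤ M * ‖τ‖ * ‖expKernel l τ‖) → (6 < |τ.im| → x = 0) →
      x * Real.exp (ε * τ.re) ≤ C * Real.exp (-(b / 2) * ‖τ‖) by
    refine ⟨h _ (norm_nonneg _) (fun h => ?_) (fun h => (hM τ h).1) (fun h => ?_),
      h _ (norm_nonneg _) (fun h => ?_) (fun h => (hM τ h).2) (fun h => ?_)⟩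
    · exact (le_abs_self _).trans ((hB0 τ (by simpa using h)).trans (le_max_left _ _))
    · rw [(cylKernel_outside h).1, norm_zero]
    · exact (le_abs_self _).trans ((hB1 τ (by simpa using h)).trans (le_max_right _ _))
    · rw [(cylKernel_outside h).2, norm_zero]
  intro x hx0 hx1 hx2 hx3
  by_cases him : 6 < |τ.im|
  · rw [hx3 him, zero_mul]; positivity
  push Not at him
  by_cases hre : 1 ≤ |τ.re|
  · have hk := norm_expKernel_le (l := l) (ε := ε) hre
    have hτ : ‖τ‖ - 6 ≤ |τ.re| := by
      have := Complex.norm_le_abs_re_add_abs_im τ; linarith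
    have e1 : Real.exp (-b * |τ.re|) ≤ Real.exp (6 * b) * Real.exp (-b * ‖τ‖) := by
      rw [← Real.exp_add]; apply Real.exp_le_exp.mpr; nlinarith
    have e2 : ‖τ‖ ≤ 2 / b * Real.exp (b / 2 * ‖τ‖) := by
      have := Real.add_one_le_exp (b / 2 * ‖τ‖)
      rw [div_mul_eq_mul_div, le_div_iff₀ hb0]
      linarith
    calc x * Real.exp (ε * τ.re) ≤ M * ‖τ‖ * ‖expKernel l τ‖ * Real.exp (ε * τ.re) := by
          gcongr; exact hx2 hre
      _ = M * ‖τ‖ * (‖expKernel l τ‖ * Real.exp (ε * τ.re)) := by ring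
      _ ≤ M * (2 / b * Real.exp (b / 2 * ‖τ‖)) * (2 * (Real.exp (6 * b) * Real.exp (-b * ‖τ‖))) := by
          have := hk.trans (mul_le_mul_of_nonneg_left e1 (by norm_num))
          gcongr
      _ = M * (2 / b) * (2 * Real.exp (6 * b)) * (Real.exp (b / 2 * ‖τ‖) * Real.exp (-b * ‖τ‖)) := by
          ring
      _ = M * (2 / b) * (2 * Real.exp (6 * b)) * Real.exp (-(b / 2) * ‖τ‖) := by
          rw [← Real.exp_add]; ring_nf
      _ ≤ _ := by
          gcongr
          have : 0 ≤ B * Real.exp (b / 2 * 7) := by positivity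
          linarith
  · push Not at hre
    have hτ : ‖τ‖ ≤ 7 := by
      have := Complex.norm_le_abs_re_add_abs_im τ; linarith
    calc x * Real.exp (ε * τ.re) ≤ B := hx1 hτ
      _ ≤ B * (Real.exp (b / 2 * 7) * Real.exp (-(b / 2) * ‖τ‖)) := by
          rw [← Real.exp_add]
          apply le_mul_of_one_le_right hBpos
          apply Real.one_le_exp; nlinarith
      _ = B * Real.exp (b / 2 * 7) * Real.exp (-(b / 2) * ‖τ‖) := by ring
      _ ≤ _ := by
          gcongr
          have : 0 ≤ M * (2 / b) * (2 * Real.exp (6 * b)) := by positivity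
          linarith

/-- `regKernel` is holomorphic on the support of the bump, so ∂̄ falls on the bump only, and ∂̄ of a
function f(Im τ) is (i/2) f'(Im τ). -/
lemma planeDbar_cylKernel {l : ℝ} (τ : ℂ) :
    τ⁻¹ * planeDbar (cylKernel l) τ = (I / 2) * (deriv stripBump τ.im * expKernel l τ) := by
  rcases strip_trichotomy τ with h | h
  · have hD := (hasFDerivAt_stripBump_im τ).mul
      (differentiableAt_regKernel (l := l) h).hasDerivAt.complexToReal_fderiv
    have h1 : fderiv ℝ (cylKernel l) τ = _ := hD.fderiv
    rw [planeDbar, h1]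
    by_cases h0 : τ = 0
    · simp [h0, expKernel]
    · simp [regKernel_eq h0]
      field_simp
      linear_combination (stripBump τ.im : ℂ) * deriv (regKernel l) τ * I_sq
  · have h1 := cylKernel_eventually_zero (l := l) h
    have h2 : stripBump =ᶠ[𝓝 τ.im] 0 := by
      rcases h with h | h
      · filter_upwards [Ioi_mem_nhds h] with x hx using stripBump_of_ge (le_of_lt hx)
      · filter_upwards [Iio_mem_nhds h] with x hx using stripBump_of_le (le_of_lt hx)
    rw [planeDbar, h1.fderiv_eq, h2.deriv_eq]
    simp

lemma deriv_stripBump_pos {y : ℝ} (h : 0 < y) : deriv stripBump y = -deriv cutStep y := by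
  have h1 : stripBump =ᶠ[𝓝 y] fun y => 1 - cutStep y := by
    filter_upwards [Ioi_mem_nhds h] with x hx
    have hx : 0 < x := hx
    rw [stripBump, cutStep_of_ge (y := x + _) (by linarith [Real.pi_gt_three])]
  rw [h1.deriv_eq, deriv_const_sub]

lemma deriv_stripBump_neg {y : ℝ} (h : y < 1) :
    deriv stripBump y = deriv cutStep (y + 2 * Real.pi) := by
  have h1 : stripBump =ᶠ[𝓝 y] fun y => cutStep (y + 2 * Real.pi) := by
    filter_upwards [Iio_mem_nhds h] with x hx
    have hx : x < 1 := hx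
    rw [stripBump, cutStep_of_le (y := x) hx.le, sub_zero]
  rw [h1.deriv_eq, deriv_comp_add_const]

/-- The multipliers of `expKernel` and g cancel, so their product is 2πi-periodic. The derivative of
the bump is the difference of `deriv cutStep` and its translate by 2π, so the two contributions to
the integral cancel. This is why the cylinder kernel leaves no remainder. -/
theorem integral_planeDbar_cylKernel {l : ℝ} {g : ℂ → ℂ}
    (hi : Integrable (fun τ => τ⁻¹ * planeDbar (cylKernel l) τ * g τ))
    (hg : ∀ τ, g (τ + 2 * Real.pi * I) = exp (2 * Real.pi * I * l) * g τ) :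
    ∫ τ, τ⁻¹ * planeDbar (cylKernel l) τ * g τ = 0 := by
  set G : ℂ → ℂ := fun τ => (I / 2) * (expKernel l τ * g τ)
  have hG : ∀ τ, G (τ + 2 * Real.pi * I) = G τ := by
    intro τ
    simp only [G, expKernel, hg, Complex.exp_periodic τ, mul_add, Complex.exp_add]
    have : exp ((1 - l) * (2 * Real.pi * I)) * exp (2 * Real.pi * I * l) = 1 := by
      rw [← Complex.exp_add, show (1 - (l : ℂ)) * (2 * Real.pi * I) + 2 * Real.pi * I * l =
        2 * Real.pi * I by ring, Complex.exp_two_pi_mul_I]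
    linear_combination (I / 2 * (exp ((1 - l) * τ) / (exp τ - 1)) * g τ) * this
  have hF : ∀ τ, τ⁻¹ * planeDbar (cylKernel l) τ * g τ = deriv stripBump τ.im * G τ := by
    intro τ; rw [planeDbar_cylKernel]; simp only [G]; ring
  simp only [hF] at hi ⊢
  have hS : MeasurableSet {τ : ℂ | 0 < τ.im} := measurableSet_lt measurable_const measurable_im
  -- The line Im τ = 0 separates the two transition zones of the bump, so integrability is needed
  -- for the total integrand only.
  rw [← integral_add_compl hS hi, ← integral_indicator hS, ← integral_indicator hS.compl]
  have hd0 : ∀ y : ℝ, y ≤ 0 → deriv cutStep y = 0 := by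
    intro y hy
    have : cutStep =ᶠ[𝓝 y] 0 := by
      filter_upwards [Iio_mem_nhds (show y < 1 by linarith)] with x hx
      exact cutStep_of_le (le_of_lt hx)
    rw [this.deriv_eq]; simp
  have hd1 : ∀ y : ℝ, 3 < y → deriv cutStep y = 0 := by
    intro y hy
    have : cutStep =ᶠ[𝓝 y] fun _ => 1 := by
      filter_upwards [Ioi_mem_nhds hy] with x hx
      exact cutStep_of_ge (le_of_lt hx)
    rw [this.deriv_eq]; simp
  have e1 : ({τ : ℂ | 0 < τ.im}.indicator fun τ => ((deriv stripBump τ.im : ℝ) : ℂ) * G τ) =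
      fun τ => -(((deriv cutStep τ.im : ℝ) : ℂ) * G τ) := by
    funext τ
    by_cases h : 0 < τ.im
    · rw [indicator_of_mem (by exact h), deriv_stripBump_pos h]; push_cast; ring
    · rw [indicator_of_notMem (by exact h), hd0 _ (not_lt.mp h)]; simp
  have e2 : ({τ : ℂ | 0 < τ.im}ᶜ.indicator fun τ => ((deriv stripBump τ.im : ℝ) : ℂ) * G τ) =
      fun τ => (fun τ => ((deriv cutStep τ.im : ℝ) : ℂ) * G τ) (τ + 2 * Real.pi * I) := by
    funext τ
    have him : (τ + 2 * Real.pi * I).im = τ.im + 2 * Real.pi := by simp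
    simp only [hG, him]
    by_cases h : 0 < τ.im
    · rw [indicator_of_notMem (by simpa using h), hd1 _ (by linarith [Real.pi_gt_three])]; simp
    · have h' : τ.im < 1 := by linarith
      rw [indicator_of_mem (by simpa using h), deriv_stripBump_neg h']
  rw [e1, e2, integral_add_right_eq_self (fun τ : ℂ => ((deriv cutStep τ.im : ℝ) : ℂ) * G τ), integral_neg]
  simp

end Kernel

/-! ### Convolution in one variable, with weights and domination. -/

section Convolution

open MeasureTheory Filter Topology

variable {d : ℕ}

/-- The derivative in the direction `c` in the `j`-th variable. -/
def pd (j : Fin d) (c : ℂ) (f : (Fin d → ℂ) → ℂ) (w : Fin d → ℂ) : ℂ :=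
  fderiv ℝ f w (Pi.single j c)

/-- Iterated derivatives. -/
def wordD : List (Fin d × ℂ) → ((Fin d → ℂ) → ℂ) → (Fin d → ℂ) → ℂ
  | [], f => f
  | x :: l, f => wordD l (pd x.1 x.2 f)

/-- The weight `∏ |e^{w_i}|^{ε_i}`. -/
def wt (ε : Fin d → ℝ) (w : Fin d → ℂ) : ℝ := Real.exp (∑ i, ε i * (w i).re)

/-- Convolution in the `i`-th variable. -/
def Cv (i : Fin d) (κ : ℂ → ℂ) (f : (Fin d → ℂ) → ℂ) (w : Fin d → ℂ) : ℂ :=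
  ∫ τ, κ τ * f (w + Pi.single i τ)

/-- The derivatives of all orders in the variables in `M` are `O(wt ε)`. -/
def WordBound (M : Finset (Fin d)) (ε : Fin d → ℝ) (f : (Fin d → ℂ) → ℂ) : Prop :=
  ∀ l : List (Fin d × ℂ), (∀ x ∈ l, x.1 ∈ M) → ∃ C, ∀ w, ‖wordD l f w‖ ≤ C * wt ε w

/-- The integral defining `Cv i κ f` is locally uniformly dominated. -/
def Dom (i : Fin d) (κ : ℂ → ℂ) (f : (Fin d → ℂ) → ℂ) : Prop :=
  ∀ w₀ : Fin d → ℂ, ∃ g : ℂ → ℝ, Integrable g ∧ ∀ w ∈ Metric.ball w₀ 1, ∀ τ : ℂ,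
    ‖κ τ‖ * ‖f (w + Pi.single i τ)‖ ≤ g τ

lemma contDiff_pd {f : (Fin d → ℂ) → ℂ} (hf : ContDiff ℝ ∞ f) (j : Fin d) (c : ℂ) :
    ContDiff ℝ ∞ (pd j c f) :=
  (hf.fderiv_right (m := ∞) (by simp)).clm_apply contDiff_const

lemma contDiff_wordD {f : (Fin d → ℂ) → ℂ} (hf : ContDiff ℝ ∞ f) (l : List (Fin d × ℂ)) :
    ContDiff ℝ ∞ (wordD l f) := by
  induction l generalizing f with
  | nil => exact hf
  | cons x l ih => exact ih (contDiff_pd hf x.1 x.2)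

lemma wt_pos (ε : Fin d → ℝ) (w : Fin d → ℂ) : 0 < wt ε w := Real.exp_pos _

lemma wt_add_single (ε : Fin d → ℝ) (w : Fin d → ℂ) (i : Fin d) (τ : ℂ) :
    wt ε (w + Pi.single i τ) = wt ε w * Real.exp (ε i * τ.re) := by
  rw [wt, wt, ← Real.exp_add]
  congr 1
  simp only [Pi.add_apply, Complex.add_re, mul_add, Finset.sum_add_distrib]
  congr 1
  rw [Finset.sum_eq_single i]
  · simp
  · intro j _ hj; simp [hj]
  · simp

lemma continuous_wt (ε : Fin d → ℝ) : Continuous (wt ε) := by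
  unfold wt; fun_prop

lemma sum_single_eq (y : Fin d → ℂ) : y = ∑ j, ((y j).re • (Pi.single j 1 : Fin d → ℂ) +
    (y j).im • (Pi.single j Complex.I : Fin d → ℂ)) := by
  funext k
  rw [Finset.sum_apply, Finset.sum_eq_single k]
  · simp [Complex.re_add_im]
  · intro j _ hj; simp [Ne.symm hj]
  · simp

lemma clm_apply_eq_sum (L : (Fin d → ℂ) →L[ℝ] ℂ) (y : Fin d → ℂ) :
    L y = ∑ j, ((y j).re * L (Pi.single j 1) + (y j).im * L (Pi.single j Complex.I)) := by
  conv_lhs => rw [sum_single_eq y]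
  simp [map_sum]

lemma norm_clm_le_sum (L : (Fin d → ℂ) →L[ℝ] ℂ) :
    ‖L‖ ≤ ∑ j, (‖L (Pi.single j 1)‖ + ‖L (Pi.single j Complex.I)‖) := by
  refine L.opNorm_le_bound (by positivity) fun y => ?_
  rw [clm_apply_eq_sum, Finset.sum_mul]
  refine norm_sum_le_of_le _ fun j _ => (norm_add_le _ _).trans ?_
  rw [norm_mul, norm_mul, Complex.norm_real, Complex.norm_real, add_mul, mul_comm ‖L _‖, mul_comm ‖L _‖]
  have h1 := (Complex.abs_re_le_norm (y j)).trans (norm_le_pi_norm y j)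
  have h2 := (Complex.abs_im_le_norm (y j)).trans (norm_le_pi_norm y j)
  rw [Real.norm_eq_abs, Real.norm_eq_abs]
  gcongr

lemma contDiff_of_pd {f : (Fin d → ℂ) → ℂ} {n : ℕ} (hf : Differentiable ℝ f)
    (h : ∀ j c, ContDiff ℝ n (pd j c f)) : ContDiff ℝ (n + 1) f := by
  rw [contDiff_succ_iff_fderiv_apply]
  refine ⟨hf, by simp, fun y => ?_⟩
  simp only [clm_apply_eq_sum (fderiv ℝ f _) y]
  exact ContDiff.sum fun j _ => (contDiff_const.mul (h j 1)).add (contDiff_const.mul (h j Complex.I))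

variable {i : Fin d} {κ : ℂ → ℂ}

lemma Dom.integrable {f : (Fin d → ℂ) → ℂ} (hκ : AEStronglyMeasurable κ) (hf : Continuous f)
    (h : Dom i κ f) (w : Fin d → ℂ) : Integrable (fun τ => κ τ * f (w + Pi.single i τ)) := by
  obtain ⟨g, hg, hb⟩ := h w
  have hc : Continuous (fun τ : ℂ => f (w + Pi.single i τ)) :=
    hf.comp (continuous_const.add (continuous_single (A := fun _ : Fin d => ℂ) i))
  refine hg.mono' (hκ.mul hc.aestronglyMeasurable) (Eventually.of_forall fun τ => ?_)
  rw [norm_mul]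
  exact hb w (Metric.mem_ball_self one_pos) τ

/-- Dominating the partial derivatives is enough: the operator norm of the Fréchet derivative is at
most the sum of the norms of its 2d real partials. -/
theorem hasFDerivAt_Cv {f : (Fin d → ℂ) → ℂ} (hκ : AEStronglyMeasurable κ) (hf : ContDiff ℝ ∞ f)
    (h0 : Dom i κ f) (h1 : ∀ j c, Dom i κ (pd j c f)) (w₀ : Fin d → ℂ) :
    HasFDerivAt (Cv i κ f) (∫ τ, κ τ • fderiv ℝ f (w₀ + Pi.single i τ)) w₀ := by
  choose g1 hg1 hb1 using fun j => h1 j 1 w₀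
  choose g2 hg2 hb2 using fun j => h1 j Complex.I w₀
  have hfd : Continuous (fderiv ℝ f) := hf.continuous_fderiv (by simp)
  have hsc : ∀ w : Fin d → ℂ, Continuous (fun τ : ℂ => w + (Pi.single i τ : Fin d → ℂ)) :=
    fun w => continuous_const.add (continuous_single (A := fun _ : Fin d => ℂ) i)
  have hm : ∀ᶠ w in 𝓝 w₀, AEStronglyMeasurable (fun τ => κ τ * f (w + Pi.single i τ)) volume :=
    Eventually.of_forall fun w => hκ.mul (hf.continuous.comp (hsc w)).aestronglyMeasurable
  have hm' : AEStronglyMeasurable (fun τ => κ τ • fderiv ℝ f (w₀ + Pi.single i τ)) volume :=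
    hκ.smul (hfd.comp (hsc w₀)).aestronglyMeasurable
  set F : (Fin d → ℂ) → ℂ → ℂ := fun w τ => κ τ * f (w + Pi.single i τ) with hF
  set F' : (Fin d → ℂ) → ℂ → ((Fin d → ℂ) →L[ℝ] ℂ) :=
    fun w τ => κ τ • fderiv ℝ f (w + Pi.single i τ) with hF'
  have hb : ∀ᵐ τ, ∀ w ∈ Metric.ball w₀ 1, ‖F' w τ‖ ≤ ∑ j, (g1 j τ + g2 j τ) := by
    refine Eventually.of_forall fun τ w hw => ?_
    rw [hF', norm_smul]
    refine (mul_le_mul_of_nonneg_left (norm_clm_le_sum _) (norm_nonneg _)).trans ?_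
    rw [Finset.mul_sum]
    refine Finset.sum_le_sum fun j _ => ?_
    rw [mul_add]
    exact add_le_add (hb1 j w hw τ) (hb2 j w hw τ)
  have hd : ∀ᵐ τ, ∀ w ∈ Metric.ball w₀ 1, HasFDerivAt (F · τ) (F' w τ) w := by
    refine Eventually.of_forall fun τ w _ => ?_
    have h2 := (hf.differentiable (by simp) (w + Pi.single i τ)).hasFDerivAt.comp w
      ((hasFDerivAt_id w).add_const (Pi.single i τ))
    rw [ContinuousLinearMap.comp_id] at h2
    exact HasFDerivAt.const_mul h2 (κ τ)
  have hg : Integrable (fun τ => ∑ j, (g1 j τ + g2 j τ)) :=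
    integrable_finsetSum _ fun j _ => (hg1 j).add (hg2 j)
  have key := hasFDerivAt_integral_of_dominated_of_fderiv_le (𝕜 := ℝ) (μ := volume)
    (Metric.ball_mem_nhds w₀ one_pos) hm (h0.integrable hκ hf.continuous w₀) hm' hb hg hd
  exact key

theorem pd_Cv {f : (Fin d → ℂ) → ℂ} (hκ : AEStronglyMeasurable κ) (hf : ContDiff ℝ ∞ f)
    (h0 : Dom i κ f) (h1 : ∀ j c, Dom i κ (pd j c f)) (j : Fin d) (c : ℂ) :
    pd j c (Cv i κ f) = Cv i κ (pd j c f) := by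
  funext w
  rw [pd, (hasFDerivAt_Cv hκ hf h0 h1 w).fderiv, Cv, ContinuousLinearMap.integral_apply]
  · simp [pd]
  · choose g1 hg1 hb1 using fun j => h1 j 1 w
    choose g2 hg2 hb2 using fun j => h1 j Complex.I w
    have hfd : Continuous (fderiv ℝ f) := hf.continuous_fderiv (by simp)
    refine (integrable_finsetSum Finset.univ fun j _ => (hg1 j).add (hg2 j)).mono'
      (hκ.smul (hfd.comp (continuous_const.add (continuous_single (A := fun _ : Fin d => ℂ) i))).aestronglyMeasurable)
      (Eventually.of_forall fun τ => ?_)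
    rw [norm_smul]
    refine (mul_le_mul_of_nonneg_left (norm_clm_le_sum _) (norm_nonneg _)).trans ?_
    rw [Finset.mul_sum]
    refine Finset.sum_le_sum fun j _ => ?_
    rw [mul_add]
    exact add_le_add (hb1 j w (Metric.mem_ball_self one_pos) τ) (hb2 j w (Metric.mem_ball_self one_pos) τ)

/-- All integrals defining `Cv i κ` of derivatives of `f` are locally uniformly dominated. -/
def DomAll (i : Fin d) (κ : ℂ → ℂ) (f : (Fin d → ℂ) → ℂ) : Prop :=
  ∀ l : List (Fin d × ℂ), Dom i κ (wordD l f)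

lemma DomAll.zero {f : (Fin d → ℂ) → ℂ} (h : DomAll i κ f) : Dom i κ f := h []

lemma DomAll.pd {f : (Fin d → ℂ) → ℂ} (h : DomAll i κ f) (j : Fin d) (c : ℂ) :
    DomAll i κ (pd j c f) := fun l => h ((j, c) :: l)

theorem contDiff_Cv {f : (Fin d → ℂ) → ℂ} (hκ : AEStronglyMeasurable κ) (hf : ContDiff ℝ ∞ f)
    (h : DomAll i κ f) : ContDiff ℝ ∞ (Cv i κ f) := by
  rw [contDiff_infty]
  intro n
  have hdiff : ∀ {f : (Fin d → ℂ) → ℂ}, ContDiff ℝ ∞ f → DomAll i κ f →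
      Differentiable ℝ (Cv i κ f) := fun hf h w =>
    (hasFDerivAt_Cv hκ hf h.zero (fun j c => (h.pd j c).zero) w).differentiableAt
  induction n generalizing f with
  | zero => exact contDiff_zero.mpr (hdiff hf h).continuous
  | succ n ih =>
    refine contDiff_of_pd (hdiff hf h) fun j c => ?_
    rw [pd_Cv hκ hf h.zero (fun j c => (h.pd j c).zero)]
    exact ih (contDiff_pd hf j c) (h.pd j c)

lemma wordD_Cv {f : (Fin d → ℂ) → ℂ} (hκ : AEStronglyMeasurable κ) (hf : ContDiff ℝ ∞ f)
    (h : DomAll i κ f) (l : List (Fin d × ℂ)) : wordD l (Cv i κ f) = Cv i κ (wordD l f) := by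
  induction l generalizing f with
  | nil => rfl
  | cons x l ih =>
    rw [wordD, pd_Cv hκ hf h.zero (fun j c => (h.pd j c).zero), ih (contDiff_pd hf _ _) (h.pd _ _)]
    rfl

lemma dom_of_compactSupport {f : (Fin d → ℂ) → ℂ} (hκ : Integrable κ) (hc : HasCompactSupport κ)
    (hf : Continuous f) : Dom i κ f := by
  intro w₀
  have hK : IsCompact ((fun x : (Fin d → ℂ) × ℂ => x.1 + (Pi.single i x.2 : Fin d → ℂ)) ''
      (Metric.closedBall w₀ 1 ×ˢ tsupport κ)) :=
    ((isCompact_closedBall w₀ 1).prod hc).image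
      (continuous_fst.add ((continuous_single i).comp continuous_snd))
  obtain ⟨M, hM⟩ := hK.exists_bound_of_continuousOn hf.continuousOn
  refine ⟨fun τ => ‖κ τ‖ * M, hκ.norm.mul_const M, fun w hw τ => ?_⟩
  by_cases hτ : τ ∈ tsupport κ
  · exact mul_le_mul_of_nonneg_left
      (hM _ ⟨(w, τ), ⟨Metric.ball_subset_closedBall hw, hτ⟩, rfl⟩) (norm_nonneg _)
  · simp [image_eq_zero_of_notMem_tsupport hτ]

/-- Translation by τ in the i-th variable multiplies the weight by e^{ε_i Re τ}; this factor is
charged to the kernel, and the remaining weight is bounded on a unit ball. -/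
lemma dom_of_bound {f : (Fin d → ℂ) → ℂ} {ε : Fin d → ℝ}
    (hκ : Integrable (fun τ => ‖κ τ‖ * Real.exp (ε i * τ.re)))
    {C : ℝ} (hf : ∀ w, ‖f w‖ ≤ C * wt ε w) : Dom i κ f := by
  intro w₀
  obtain ⟨M, hM⟩ := (isCompact_closedBall w₀ 1).exists_bound_of_continuousOn
    (continuous_wt ε).continuousOn
  have hC : 0 ≤ C := by
    have := (norm_nonneg _).trans (hf w₀)
    exact nonneg_of_mul_nonneg_left this (wt_pos ε w₀)
  refine ⟨fun τ => C * M * (‖κ τ‖ * Real.exp (ε i * τ.re)), hκ.const_mul _, fun w hw τ => ?_⟩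
  have h1 := (le_abs_self _).trans (hM w (Metric.ball_subset_closedBall hw))
  calc ‖κ τ‖ * ‖f (w + Pi.single i τ)‖ ≤ ‖κ τ‖ * (C * (wt ε w * Real.exp (ε i * τ.re))) := by
        rw [← wt_add_single]; gcongr; exact hf _
    _ ≤ ‖κ τ‖ * (C * (M * Real.exp (ε i * τ.re))) := by gcongr
    _ = _ := by ring

lemma norm_Cv_le {f : (Fin d → ℂ) → ℂ} {ε : Fin d → ℝ}
    (hκ : Integrable (fun τ => ‖κ τ‖ * Real.exp (ε i * τ.re)))
    {C : ℝ} (hf : ∀ w, ‖f w‖ ≤ C * wt ε w) (w : Fin d → ℂ) :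
    ‖Cv i κ f w‖ ≤ (C * ∫ τ, ‖κ τ‖ * Real.exp (ε i * τ.re)) * wt ε w := by
  rw [Cv, mul_assoc, mul_comm _ (wt ε w), ← mul_assoc, ← integral_const_mul]
  refine norm_integral_le_of_norm_le (hκ.const_mul _) (Eventually.of_forall fun τ => ?_)
  rw [norm_mul]
  calc ‖κ τ‖ * ‖f (w + Pi.single i τ)‖ ≤ ‖κ τ‖ * (C * (wt ε w * Real.exp (ε i * τ.re))) := by
        rw [← wt_add_single]; gcongr; exact hf _
    _ = _ := by ring

lemma integrable_exp_of_compactSupport (hκ : Integrable κ) (hc : HasCompactSupport κ) (a : ℝ) :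
    Integrable (fun τ => ‖κ τ‖ * Real.exp (a * τ.re)) := by
  obtain ⟨M, hM⟩ := hc.exists_bound_of_continuousOn
    (f := fun τ : ℂ => Real.exp (a * τ.re)) (by fun_prop)
  refine (hκ.norm.mul_const M).mono' (hκ.aestronglyMeasurable.norm.mul
    (Continuous.aestronglyMeasurable (by fun_prop))) (Eventually.of_forall fun τ => ?_)
  by_cases hτ : τ ∈ tsupport κ
  · rw [norm_mul, norm_norm]
    exact mul_le_mul_of_nonneg_left (hM τ hτ) (norm_nonneg _)
  · simp [image_eq_zero_of_notMem_tsupport hτ]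

lemma domAll_of_compactSupport {f : (Fin d → ℂ) → ℂ} (hκ : Integrable κ) (hc : HasCompactSupport κ)
    (hf : ContDiff ℝ ∞ f) : DomAll i κ f := fun l =>
  dom_of_compactSupport hκ hc (contDiff_wordD hf l).continuous

lemma domAll_of_wordBound {f : (Fin d → ℂ) → ℂ} {ε : Fin d → ℝ}
    (hκ : Integrable (fun τ => ‖κ τ‖ * Real.exp (ε i * τ.re))) (hf : WordBound Finset.univ ε f) :
    DomAll i κ f := fun l => by
  obtain ⟨C, hC⟩ := hf l (by simp)
  exact dom_of_bound hκ hC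

lemma wordBound_Cv {f : (Fin d → ℂ) → ℂ} {ε : Fin d → ℝ} (hm : AEStronglyMeasurable κ)
    (hκ : Integrable (fun τ => ‖κ τ‖ * Real.exp (ε i * τ.re))) (hs : ContDiff ℝ ∞ f)
    (hf : WordBound Finset.univ ε f) : WordBound Finset.univ ε (Cv i κ f) := by
  intro l _
  obtain ⟨C, hC⟩ := hf l (by simp)
  rw [wordD_Cv hm hs (domAll_of_wordBound hκ hf)]
  exact ⟨_, norm_Cv_le hκ hC⟩

/-! ### Smoothing -/

lemma hasFDerivAt_slice {f : (Fin d → ℂ) → ℂ} (hf : ContDiff ℝ ∞ f) (w : Fin d → ℂ) (τ : ℂ) :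
    HasFDerivAt (fun τ : ℂ => f (w + Pi.single i τ))
      ((fderiv ℝ f (w + Pi.single i τ)).comp (ContinuousLinearMap.single ℝ (fun _ : Fin d => ℂ) i)) τ :=
  (hf.differentiable (by simp) (w + Pi.single i τ)).hasFDerivAt.comp τ
    ((ContinuousLinearMap.single ℝ (fun _ : Fin d => ℂ) i).hasFDerivAt.const_add w)

lemma contDiff_slice {f : (Fin d → ℂ) → ℂ} (hf : ContDiff ℝ ∞ f) (w : Fin d → ℂ) :
    ContDiff ℝ ∞ (fun τ : ℂ => f (w + Pi.single i τ)) :=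
  hf.comp (contDiff_const.add (ContinuousLinearMap.single ℝ (fun _ : Fin d => ℂ) i).contDiff)

lemma fderiv_slice {f : (Fin d → ℂ) → ℂ} (hf : ContDiff ℝ ∞ f) (w : Fin d → ℂ) (τ c : ℂ) :
    fderiv ℝ (fun τ : ℂ => f (w + Pi.single i τ)) τ c = pd i c f (w + Pi.single i τ) := by
  rw [(hasFDerivAt_slice hf w τ).fderiv]; rfl

lemma planeDbar_slice {f : (Fin d → ℂ) → ℂ} (hf : ContDiff ℝ ∞ f) (w : Fin d → ℂ) (τ : ℂ) :
    planeDbar (fun τ : ℂ => f (w + Pi.single i τ)) τ = delZbar i f (w + Pi.single i τ) := by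
  rw [planeDbar, fderiv_slice hf, fderiv_slice hf]; rfl

/-- Integration by parts in τ. Since w and τ enter as w + τ, derivatives in w_i and τ agree on f,
hence the minus sign on the kernel. -/
lemma pd_Cv_smooth {f : (Fin d → ℂ) → ℂ} (hκ : ContDiff ℝ ∞ κ) (hc : HasCompactSupport κ)
    (hf : ContDiff ℝ ∞ f) (c : ℂ) :
    pd i c (Cv i κ f) = Cv i (fun τ => -fderiv ℝ κ τ c) f := by
  have hκi : Integrable κ := hκ.continuous.integrable_of_hasCompactSupport hc
  have hκ' : Continuous (fun τ => fderiv ℝ κ τ c) :=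
    (hκ.continuous_fderiv (by simp)).clm_apply continuous_const
  have hc' : HasCompactSupport (fun τ => fderiv ℝ κ τ c) := hc.fderiv_apply ℝ c
  have hD := domAll_of_compactSupport (i := i) hκi hc hf
  rw [pd_Cv hκi.aestronglyMeasurable hf hD.zero (fun j c => (hD.pd j c).zero)]
  funext w
  simp only [Cv, neg_mul, integral_neg]
  have hsl := contDiff_slice (i := i) hf w
  have := integral_mul_fderiv_eq_neg_fderiv_mul_of_integrable (𝕜 := ℂ) (μ := volume) (f := κ)
    (g := fun τ : ℂ => f (w + Pi.single i τ)) (v := c) ?_ ?_ ?_ ?_ ?_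
  · simp only [fderiv_slice hf] at this
    exact this
  · exact (hκ'.mul hsl.continuous).integrable_of_hasCompactSupport hc'.mul_right
  · simp only [fderiv_slice hf]
    exact (hD.pd i c).zero.integrable hκi.aestronglyMeasurable (contDiff_pd hf i c).continuous w
  · exact (hκ.continuous.mul hsl.continuous).integrable_of_hasCompactSupport hc.mul_right
  · exact fun τ _ => hκ.differentiable (by simp) τ
  · exact fun τ _ => hsl.differentiable (by simp) τ

/-- Derivatives in w_i are thrown on the kernel, which stays smooth with compact support; the other
derivatives pass to f, where `M` controls them. The induction on the word therefore varies both κ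
and f. -/
theorem wordBound_smoothing {f : (Fin d → ℂ) → ℂ} {ε : Fin d → ℝ} {M : Finset (Fin d)}
    (hκ : ContDiff ℝ ∞ κ) (hc : HasCompactSupport κ)
    (hs : ContDiff ℝ ∞ f) (hf : WordBound M ε f) : WordBound (insert i M) ε (Cv i κ f) := by
  intro l
  induction l generalizing κ f with
  | nil =>
    intro _
    obtain ⟨C, hC⟩ := hf [] (by simp)
    exact ⟨_, norm_Cv_le (integrable_exp_of_compactSupport
      (hκ.continuous.integrable_of_hasCompactSupport hc) hc _) hC⟩
  | cons x l ih =>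
    intro hl
    have hl' : ∀ y ∈ l, y.1 ∈ insert i M := fun y hy => hl y (List.mem_cons_of_mem _ hy)
    have hx : x.1 ∈ insert i M := hl x List.mem_cons_self
    have hκi : Integrable κ := hκ.continuous.integrable_of_hasCompactSupport hc
    rw [wordD]
    by_cases hxi : x.1 = i
    · rw [hxi, pd_Cv_smooth hκ hc hs]
      exact ih (((hκ.fderiv_right (m := ∞) (by simp)).clm_apply contDiff_const).neg)
        (hc.fderiv_apply ℝ x.2).neg hs hf hl'
    · have hD := domAll_of_compactSupport (i := i) hκi hc hs
      rw [pd_Cv hκi.aestronglyMeasurable hs hD.zero (fun j c => (hD.pd j c).zero)]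
      refine ih hκ hc (contDiff_pd hs _ _) (fun l hl => ?_) hl'
      exact hf (x :: l) (by
        simp only [List.mem_cons, forall_eq_or_imp]
        exact ⟨(Finset.mem_insert.mp hx).resolve_left hxi, hl⟩)

end Convolution

/-! ### Inverting ∂̄ in one variable: locally up to smoothing, on the cylinder exactly. -/

section Operators

open MeasureTheory Filter Topology

lemma integrable_inv_mul {u : ℂ → ℂ} {a C : ℝ} (ha : 0 < a) (hu : Continuous u)
    (hb : ∀ τ, ‖u τ‖ ≤ C * Real.exp (-a * ‖τ‖)) : Integrable (fun τ => τ⁻¹ * u τ) := by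
  refine ((integrable_inv_norm_mul_exp ha).const_mul C).mono'
    (measurable_id.inv.aestronglyMeasurable.mul hu.aestronglyMeasurable)
    (Eventually.of_forall fun τ => ?_)
  rw [norm_mul, norm_inv]
  calc ‖τ‖⁻¹ * ‖u τ‖ ≤ ‖τ‖⁻¹ * (C * Real.exp (-a * ‖τ‖)) := by gcongr; exact hb τ
    _ = _ := by ring

lemma exists_exp_bound {V : Type*} [NormedAddCommGroup V] {u : ℂ → V} (hu : Continuous u)
    (hc : HasCompactSupport u) : ∃ C : ℝ, ∀ τ, ‖u τ‖ ≤ C * Real.exp (-1 * ‖τ‖) := by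
  have h1 : Continuous (fun τ => Real.exp ‖τ‖ * ‖u τ‖) := by fun_prop
  have h2 : HasCompactSupport (fun τ => Real.exp ‖τ‖ * ‖u τ‖) := hc.norm.mul_left
  obtain ⟨C, hC⟩ := h2.exists_bound_of_continuous h1
  refine ⟨C, fun τ => ?_⟩
  have := (le_abs_self _).trans (hC τ)
  rw [neg_one_mul, Real.exp_neg, ← div_eq_mul_inv, le_div_iff₀ (Real.exp_pos _)]
  linarith

lemma planeDbar_mul {h g : ℂ → ℂ} (hh : ContDiff ℝ 1 h) (hg : ContDiff ℝ 1 g) (τ : ℂ) :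
    planeDbar (fun τ => h τ * g τ) τ = h τ * planeDbar g τ + planeDbar h τ * g τ := by
  have h1 := fderiv_fun_mul (hh.differentiable one_ne_zero τ) (hg.differentiable one_ne_zero τ)
  rw [planeDbar, h1, planeDbar, planeDbar]
  simp
  ring

lemma continuous_planeDbar {h : ℂ → ℂ} (hh : ContDiff ℝ 1 h) : Continuous (planeDbar h) := by
  have := hh.continuous_fderiv one_ne_zero
  unfold planeDbar
  fun_prop

/-- Cauchy–Pompeiu for the product h g, combined with the Leibniz rule. It serves both the compactly
supported cutoff and the cylinder kernel; they differ in the last integral, which is a smooth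
convolution for the former and 0 for the latter. -/
theorem integral_inv_mul_planeDbar {h g : ℂ → ℂ} {a C : ℝ} (ha : 0 < a)
    (hh : ContDiff ℝ 1 h) (hg : ContDiff ℝ 1 g) (h0 : h 0 = 1)
    (hb0 : ∀ τ, ‖h τ * g τ‖ ≤ C * Real.exp (-a * ‖τ‖))
    (hb1 : ∀ τ, ‖fderiv ℝ (fun τ => h τ * g τ) τ‖ ≤ C * Real.exp (-a * ‖τ‖))
    (hi1 : Integrable (fun τ => τ⁻¹ * h τ * planeDbar g τ))
    (hi2 : Integrable (fun τ => τ⁻¹ * planeDbar h τ * g τ)) :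
    ∫ τ, τ⁻¹ * h τ * planeDbar g τ =
      -(Real.pi : ℂ) * g 0 - ∫ τ, τ⁻¹ * planeDbar h τ * g τ := by
  have hφ : ContDiff ℝ 1 (fun τ => h τ * g τ) := hh.mul hg
  have hcp := cauchyPompeiu hφ ?_ ?_
  · rw [h0, one_mul] at hcp
    rw [← hcp, eq_sub_iff_add_eq, ← integral_add hi1 hi2]
    refine integral_congr_ae (Eventually.of_forall fun τ => ?_)
    simp only [planeDbar_mul hh hg]
    ring
  · refine ((integrable_inv_norm_mul_exp ha).const_mul C).mono'
      (measurable_norm.inv.aestronglyMeasurable.mul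
        (hφ.continuous_fderiv one_ne_zero).norm.aestronglyMeasurable)
      (Eventually.of_forall fun τ => ?_)
    rw [norm_mul, norm_inv, norm_norm, norm_norm]
    calc _ ≤ ‖τ‖⁻¹ * (C * Real.exp (-a * ‖τ‖)) := by gcongr; exact hb1 τ
      _ = _ := by ring
  · refine squeeze_zero_norm hb0 ?_
    have h1 : Tendsto (fun τ : ℂ => -a * ‖τ‖) (cocompact ℂ) atBot :=
      (tendsto_norm_cocompact_atTop).const_mul_atTop_of_neg (by linarith)
    simpa using (Real.tendsto_exp_atBot.comp h1).const_mul C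

variable {d : ℕ} {i : Fin d} {κ : ℂ → ℂ}

lemma delZbar_eq (j : Fin d) (f : (Fin d → ℂ) → ℂ) (w : Fin d → ℂ) :
    delZbar j f w = (1 / 2 : ℂ) * (pd j 1 f w + Complex.I * pd j Complex.I f w) := rfl

lemma delZ_eq (j : Fin d) (f : (Fin d → ℂ) → ℂ) (w : Fin d → ℂ) :
    delZ j f w = (1 / 2 : ℂ) * (pd j 1 f w - Complex.I * pd j Complex.I f w) := rfl

lemma contDiff_delZ {f : (Fin d → ℂ) → ℂ} (hf : ContDiff ℝ ∞ f) (j : Fin d) :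
    ContDiff ℝ ∞ (delZ j f) := by
  have h1 := contDiff_pd hf j 1
  have h2 := contDiff_pd hf j Complex.I
  have : delZ j f = fun w => (1 / 2 : ℂ) * (pd j 1 f w - Complex.I * pd j Complex.I f w) := rfl
  rw [this]; fun_prop

lemma Cv_linear {f g : (Fin d → ℂ) → ℂ} (a b : ℂ) (w : Fin d → ℂ)
    (hf : Integrable (fun τ => κ τ * f (w + Pi.single i τ)))
    (hg : Integrable (fun τ => κ τ * g (w + Pi.single i τ))) :
    Cv i κ (fun w => a * f w + b * g w) w = a * Cv i κ f w + b * Cv i κ g w := by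
  simp only [Cv]
  rw [← integral_const_mul, ← integral_const_mul, ← integral_add (hf.const_mul a) (hg.const_mul b)]
  refine integral_congr_ae (Eventually.of_forall fun τ => ?_)
  simp only; ring

theorem delZbar_Cv {f : (Fin d → ℂ) → ℂ} (hκ : AEStronglyMeasurable κ) (hf : ContDiff ℝ ∞ f)
    (h : DomAll i κ f) (j : Fin d) : delZbar j (Cv i κ f) = Cv i κ (delZbar j f) := by
  funext w
  rw [delZbar_eq, pd_Cv hκ hf h.zero (fun j c => (h.pd j c).zero),
    pd_Cv hκ hf h.zero (fun j c => (h.pd j c).zero)]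
  have := Cv_linear (κ := κ) (i := i) (1 / 2) (1 / 2 * Complex.I) w
    ((h.pd j 1).zero.integrable hκ (contDiff_pd hf _ _).continuous w)
    ((h.pd j Complex.I).zero.integrable hκ (contDiff_pd hf _ _).continuous w)
  rw [mul_add, ← mul_assoc, ← this]
  congr 1
  funext w
  rw [delZbar_eq]; ring

theorem delZ_Cv {f : (Fin d → ℂ) → ℂ} (hκ : AEStronglyMeasurable κ) (hf : ContDiff ℝ ∞ f)
    (h : DomAll i κ f) (j : Fin d) : delZ j (Cv i κ f) = Cv i κ (delZ j f) := by
  funext w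
  rw [delZ_eq, pd_Cv hκ hf h.zero (fun j c => (h.pd j c).zero),
    pd_Cv hκ hf h.zero (fun j c => (h.pd j c).zero)]
  have := Cv_linear (κ := κ) (i := i) (1 / 2) (-(1 / 2 * Complex.I)) w
    ((h.pd j 1).zero.integrable hκ (contDiff_pd hf _ _).continuous w)
    ((h.pd j Complex.I).zero.integrable hκ (contDiff_pd hf _ _).continuous w)
  rw [mul_sub, ← mul_assoc, sub_eq_add_neg, ← neg_mul, ← this]
  congr 1
  funext w
  rw [delZ_eq]; ring

/-- `f` has monodromy `e^{2πi l}` in the `j`-th variable. -/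
def QuasiPeriodic (j : Fin d) (l : ℝ) (f : (Fin d → ℂ) → ℂ) : Prop :=
  ∀ w, f (w + Pi.single j (2 * Real.pi * Complex.I)) =
    Complex.exp (2 * Real.pi * Complex.I * l) * f w

lemma QuasiPeriodic.Cv {f : (Fin d → ℂ) → ℂ} {j : Fin d} {l : ℝ} (h : QuasiPeriodic j l f) :
    QuasiPeriodic j l (Cv i κ f) := by
  intro w
  simp only [LogDolbeault.Cv]
  rw [← integral_const_mul]
  refine integral_congr_ae (Eventually.of_forall fun τ => ?_)
  simp only
  rw [add_right_comm, h]; ring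

lemma pd_const_mul {f : (Fin d → ℂ) → ℂ} (hf : ContDiff ℝ ∞ f) (a : ℂ) (w : Fin d → ℂ) (j : Fin d)
    (c : ℂ) : pd j c (fun w => a * f w) w = a * pd j c f w := by
  rw [pd, fderiv_const_mul (hf.differentiable (by simp) w)]; rfl

/-- The kernel of the local homotopy operator attached to a cutoff function `h`. -/
def cauchyKernel (h : ℂ → ℂ) (τ : ℂ) : ℂ := -(1 / Real.pi : ℂ) * (τ⁻¹ * h τ)

/-- The kernel of the smoothing operator attached to a cutoff function `h`. -/
def smoothKernel (h : ℂ → ℂ) (τ : ℂ) : ℂ := -(1 / Real.pi : ℂ) * (τ⁻¹ * planeDbar h τ)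

lemma integrable_cauchyKernel {h : ℂ → ℂ} (hh : Continuous h) (hc : HasCompactSupport h) :
    Integrable (cauchyKernel h) := by
  obtain ⟨C, hC⟩ := exists_exp_bound hh hc
  exact (integrable_inv_mul one_pos hh hC).const_mul _

lemma hasCompactSupport_cauchyKernel {h : ℂ → ℂ} (hc : HasCompactSupport h) :
    HasCompactSupport (cauchyKernel h) := by
  unfold cauchyKernel
  exact (hc.mul_left (f := fun τ : ℂ => τ⁻¹)).mul_left (f := fun _ : ℂ => -(1 / Real.pi : ℂ))

lemma hasCompactSupport_planeDbar {h : ℂ → ℂ} (hc : HasCompactSupport h) :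
    HasCompactSupport (planeDbar h) := by
  have h1 := hc.fderiv_apply ℝ (1 : ℂ)
  have h2 := hc.fderiv_apply ℝ Complex.I
  unfold planeDbar
  exact (h1.add (h2.mul_left (f := fun _ : ℂ => Complex.I))).mul_left (f := fun _ : ℂ => (1 / 2 : ℂ))

lemma hasCompactSupport_smoothKernel {h : ℂ → ℂ} (hc : HasCompactSupport h) :
    HasCompactSupport (smoothKernel h) := by
  unfold smoothKernel
  exact ((hasCompactSupport_planeDbar hc).mul_left (f := fun τ : ℂ => τ⁻¹)).mul_left
    (f := fun _ : ℂ => -(1 / Real.pi : ℂ))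

lemma planeDbar_eq_zero_of_eventually {h : ℂ → ℂ} {τ a : ℂ} (hh : h =ᶠ[𝓝 τ] fun _ => a) :
    planeDbar h τ = 0 := by
  rw [planeDbar, hh.fderiv_eq]; simp

/-- Since h is constant near 0, its ∂̄ vanishes there and the pole of τ⁻¹ disappears. -/
lemma contDiff_smoothKernel {h : ℂ → ℂ} (hh : ContDiff ℝ ∞ h) (h1 : h =ᶠ[𝓝 0] fun _ => 1) :
    ContDiff ℝ ∞ (smoothKernel h) := by
  have hp : ContDiff ℝ ∞ (planeDbar h) := by
    have hf := hh.fderiv_right (m := ∞) (by simp)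
    unfold planeDbar
    exact contDiff_const.mul ((hf.clm_apply contDiff_const).add
      (contDiff_const.mul (hf.clm_apply contDiff_const)))
  rw [contDiff_iff_contDiffAt]
  intro τ
  by_cases hτ : τ = 0
  · rw [hτ]
    refine (contDiffAt_const (c := (0 : ℂ))).congr_of_eventuallyEq ?_
    filter_upwards [h1.eventually_nhds] with x hx
    rw [smoothKernel, planeDbar_eq_zero_of_eventually hx]; simp
  · exact contDiffAt_const.mul ((contDiffAt_id.inv hτ).mul hp.contDiffAt)

theorem Cv_cauchyKernel {h : ℂ → ℂ} (hh : ContDiff ℝ ∞ h) (hc : HasCompactSupport h)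
    (h0 : h 0 = 1) {f : (Fin d → ℂ) → ℂ} (hf : ContDiff ℝ ∞ f) (w : Fin d → ℂ) :
    Cv i (cauchyKernel h) (delZbar i f) w = f w - Cv i (smoothKernel h) f w := by
  have hg := contDiff_slice (i := i) hf w
  set g : ℂ → ℂ := fun τ => f (w + Pi.single i τ) with hgdef
  have hh1 : ContDiff ℝ 1 h := hh.of_le (by simp)
  have hg1 : ContDiff ℝ 1 g := hg.of_le (by simp)
  have hφ : ContDiff ℝ 1 (fun τ => h τ * g τ) := hh1.mul hg1
  have hcφ : HasCompactSupport (fun τ => h τ * g τ) := hc.mul_right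
  have hc2 : HasCompactSupport (fun τ => h τ * planeDbar g τ) := hc.mul_right
  have hc3 : HasCompactSupport (fun τ => planeDbar h τ * g τ) :=
    (hasCompactSupport_planeDbar hc).mul_right
  have hcont2 : Continuous (fun τ => h τ * planeDbar g τ) :=
    hh1.continuous.mul (continuous_planeDbar hg1)
  have hcont3 : Continuous (fun τ => planeDbar h τ * g τ) :=
    (continuous_planeDbar hh1).mul hg1.continuous
  obtain ⟨C0, hC0⟩ := exists_exp_bound hφ.continuous hcφ
  obtain ⟨C1, hC1⟩ := exists_exp_bound (hφ.continuous_fderiv one_ne_zero) (hcφ.fderiv ℝ)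
  obtain ⟨C2, hC2⟩ := exists_exp_bound hcont2 hc2
  obtain ⟨C3, hC3⟩ := exists_exp_bound hcont3 hc3
  have hi1 : Integrable (fun τ => τ⁻¹ * h τ * planeDbar g τ) := by
    simpa only [mul_assoc] using integrable_inv_mul one_pos hcont2 hC2
  have hi2 : Integrable (fun τ => τ⁻¹ * planeDbar h τ * g τ) := by
    simpa only [mul_assoc] using integrable_inv_mul one_pos hcont3 hC3
  have key := integral_inv_mul_planeDbar (C := max C0 C1) one_pos hh1 hg1 h0
    (fun τ => (hC0 τ).trans (mul_le_mul_of_nonneg_right (le_max_left _ _) (Real.exp_pos _).le))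
    (fun τ => (hC1 τ).trans (mul_le_mul_of_nonneg_right (le_max_right _ _) (Real.exp_pos _).le))
    hi1 hi2
  simp only [hgdef, planeDbar_slice hf] at key
  have e1 : Cv i (cauchyKernel h) (delZbar i f) w =
      -(1 / Real.pi : ℂ) * ∫ τ, τ⁻¹ * h τ * delZbar i f (w + Pi.single i τ) := by
    rw [Cv, ← integral_const_mul]; simp only [cauchyKernel, mul_assoc]
  have e2 : Cv i (smoothKernel h) f w =
      -(1 / Real.pi : ℂ) * ∫ τ, τ⁻¹ * planeDbar h τ * f (w + Pi.single i τ) := by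
    rw [Cv, ← integral_const_mul]; simp only [smoothKernel, mul_assoc]
  rw [e1, e2, key, Pi.single_zero, add_zero]
  have : (Real.pi : ℂ) ≠ 0 := by exact_mod_cast Real.pi_ne_zero
  field_simp
  ring

lemma measurable_cylinder (l : ℝ) : AEStronglyMeasurable (cauchyKernel (cylKernel l)) := by
  unfold cauchyKernel
  exact aestronglyMeasurable_const.mul (measurable_id.inv.aestronglyMeasurable.mul
    (contDiff_cylKernel l).continuous.aestronglyMeasurable)

lemma integrable_cylinder {l ε : ℝ} (h1 : l - 1 < ε) (h2 : ε < l) :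
    Integrable (fun τ => ‖cauchyKernel (cylKernel l) τ‖ * Real.exp (ε * τ.re)) := by
  obtain ⟨a, C, ha, hC, hb⟩ := exists_bound_cylKernel h1 h2
  refine ((integrable_inv_norm_mul_exp ha).const_mul ((1 / Real.pi) * C)).mono'
    ((measurable_cylinder l).norm.mul (Continuous.aestronglyMeasurable (by fun_prop)))
    (Eventually.of_forall fun τ => ?_)
  have hn : ‖-(1 / Real.pi : ℂ)‖ = 1 / Real.pi := by
    rw [norm_neg, norm_div, norm_one, Complex.norm_real, Real.norm_of_nonneg Real.pi_pos.le]
  rw [cauchyKernel, norm_mul, norm_norm, norm_mul, norm_mul, norm_inv, hn, Real.norm_eq_abs,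
    Real.abs_exp]
  have := (hb τ).1
  calc _ = 1 / Real.pi * (‖τ‖⁻¹ * (‖cylKernel l τ‖ * Real.exp (ε * τ.re))) := by ring
    _ ≤ 1 / Real.pi * (‖τ‖⁻¹ * (C * Real.exp (-a * ‖τ‖))) := by
      have := Real.pi_pos
      gcongr
    _ = _ := by ring

/-- The weighted bounds on f and its first derivatives in w_i give exponential decay of `cylKernel`
times the slice of f, as Cauchy–Pompeiu requires; quasi-periodicity kills the remainder by
`integral_planeDbar_cylKernel`. -/
theorem Cv_cylinder {l : ℝ} {ε : Fin d → ℝ} (h1 : l - 1 < ε i) (h2 : ε i < l)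
    {f : (Fin d → ℂ) → ℂ} (hf : ContDiff ℝ ∞ f) {C : ℝ} (hb : ∀ w, ‖f w‖ ≤ C * wt ε w)
    (hb1 : ∀ w, ‖pd i 1 f w‖ ≤ C * wt ε w) (hb2 : ∀ w, ‖pd i Complex.I f w‖ ≤ C * wt ε w)
    (hq : QuasiPeriodic i l f) (w : Fin d → ℂ) :
    Cv i (cauchyKernel (cylKernel l)) (delZbar i f) w = f w := by
  obtain ⟨a, B, ha, hB, hbd⟩ := exists_bound_cylKernel h1 h2
  have hg := contDiff_slice (i := i) hf w
  set g : ℂ → ℂ := fun τ => f (w + Pi.single i τ) with hgdef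
  have hh1 : ContDiff ℝ 1 (cylKernel l) := (contDiff_cylKernel l).of_le (by simp)
  have hg1 : ContDiff ℝ 1 g := hg.of_le (by simp)
  have hC : 0 ≤ C := nonneg_of_mul_nonneg_left ((norm_nonneg _).trans (hb w)) (wt_pos ε w)
  set C' := C * wt ε w with hC'
  have hC'0 : 0 ≤ C' := mul_nonneg hC (wt_pos ε w).le
  have hgb : ∀ τ, ‖g τ‖ ≤ C' * Real.exp (ε i * τ.re) := fun τ => by
    rw [hC', mul_assoc, ← wt_add_single]; exact hb _
  have hp1 : ∀ τ, ‖fderiv ℝ g τ 1‖ ≤ C' * Real.exp (ε i * τ.re) := fun τ => by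
    rw [hC', mul_assoc, ← wt_add_single, hgdef, fderiv_slice hf]; exact hb1 _
  have hp2 : ∀ τ, ‖fderiv ℝ g τ Complex.I‖ ≤ C' * Real.exp (ε i * τ.re) := fun τ => by
    rw [hC', mul_assoc, ← wt_add_single, hgdef, fderiv_slice hf]; exact hb2 _
  have hDg : ∀ τ, ‖fderiv ℝ g τ‖ ≤ 2 * C' * Real.exp (ε i * τ.re) := fun τ => by
    refine ContinuousLinearMap.opNorm_le_bound _ (by positivity) fun y => ?_
    have hy : y = y.re • (1 : ℂ) + y.im • Complex.I := by simp [Complex.re_add_im]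
    conv_lhs => rw [hy]
    rw [map_add, map_smul, map_smul]
    refine (norm_add_le _ _).trans ?_
    rw [norm_smul, norm_smul, Real.norm_eq_abs, Real.norm_eq_abs]
    calc |y.re| * ‖fderiv ℝ g τ 1‖ + |y.im| * ‖fderiv ℝ g τ Complex.I‖
        ≤ ‖y‖ * (C' * Real.exp (ε i * τ.re)) + ‖y‖ * (C' * Real.exp (ε i * τ.re)) := by
          have h1 := hp1 τ
          have h2 := hp2 τ
          have h3 := Complex.abs_re_le_norm y
          have h4 := Complex.abs_im_le_norm y
          gcongr
      _ = _ := by ring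
  have hdb : ∀ τ, ‖planeDbar g τ‖ ≤ C' * Real.exp (ε i * τ.re) := fun τ => by
    rw [planeDbar, norm_mul]
    have h3 : ‖(1 / 2 : ℂ)‖ = 1 / 2 := by norm_num
    have h4 := norm_add_le (fderiv ℝ g τ 1) (Complex.I * fderiv ℝ g τ Complex.I)
    rw [norm_mul, Complex.norm_I, one_mul] at h4
    rw [h3]
    linarith [hp1 τ, hp2 τ]
  have mulb : ∀ (τ : ℂ) (x y K : ℝ), 0 ≤ x → 0 ≤ K → x * Real.exp (ε i * τ.re) ≤ B * Real.exp (-a * ‖τ‖) →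
      y ≤ K * Real.exp (ε i * τ.re) → x * y ≤ B * K * Real.exp (-a * ‖τ‖) := by
    intro τ x y K hx hK h3 h4
    calc x * y ≤ x * (K * Real.exp (ε i * τ.re)) := by gcongr
      _ = K * (x * Real.exp (ε i * τ.re)) := by ring
      _ ≤ K * (B * Real.exp (-a * ‖τ‖)) := by gcongr
      _ = _ := by ring
  have hdh : ∀ τ, ‖planeDbar (cylKernel l) τ‖ ≤ ‖fderiv ℝ (cylKernel l) τ‖ := fun τ => by
    rw [planeDbar, norm_mul]
    have h3 : ‖(1 / 2 : ℂ)‖ = 1 / 2 := by norm_num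
    have h4 := norm_add_le (fderiv ℝ (cylKernel l) τ 1) (Complex.I * fderiv ℝ (cylKernel l) τ Complex.I)
    rw [norm_mul, Complex.norm_I, one_mul] at h4
    have h5 := (fderiv ℝ (cylKernel l) τ).le_opNorm 1
    have h6 := (fderiv ℝ (cylKernel l) τ).le_opNorm Complex.I
    rw [norm_one, mul_one] at h5
    rw [Complex.norm_I, mul_one] at h6
    rw [h3]
    linarith
  have hi1 : Integrable (fun τ => τ⁻¹ * cylKernel l τ * planeDbar g τ) := by
    have := integrable_inv_mul (u := fun τ => cylKernel l τ * planeDbar g τ) (C := B * C') ha (hh1.continuous.mul (continuous_planeDbar hg1)) fun τ => by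
      rw [norm_mul]; exact mulb τ _ _ _ (norm_nonneg _) hC'0 (hbd τ).1 (hdb τ)
    simpa only [mul_assoc] using this
  have hi2 : Integrable (fun τ => τ⁻¹ * planeDbar (cylKernel l) τ * g τ) := by
    have := integrable_inv_mul (u := fun τ => planeDbar (cylKernel l) τ * g τ) (C := B * C') ha ((continuous_planeDbar hh1).mul hg1.continuous) fun τ => by
      rw [norm_mul]
      refine (mul_le_mul_of_nonneg_right (hdh τ) (norm_nonneg _)).trans ?_
      exact mulb τ _ _ _ (norm_nonneg _) hC'0 (hbd τ).2 (hgb τ)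
    simpa only [mul_assoc] using this
  have key := integral_inv_mul_planeDbar (C := B * C' + B * (2 * C')) ha hh1 hg1 (cylKernel_zero l)
    (fun τ => ?_) (fun τ => ?_) hi1 hi2
  · rw [integral_planeDbar_cylKernel hi2, sub_zero] at key
    · simp only [hgdef, planeDbar_slice hf] at key
      have e1 : Cv i (cauchyKernel (cylKernel l)) (delZbar i f) w =
          -(1 / Real.pi : ℂ) * ∫ τ, τ⁻¹ * cylKernel l τ * delZbar i f (w + Pi.single i τ) := by
        rw [Cv, ← integral_const_mul]; simp only [cauchyKernel, mul_assoc]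
      rw [e1, key, Pi.single_zero, add_zero]
      have : (Real.pi : ℂ) ≠ 0 := by exact_mod_cast Real.pi_ne_zero
      field_simp
    · intro τ
      simp only [hgdef]
      rw [Pi.single_add, ← add_assoc, hq]
  · rw [norm_mul]
    refine (mulb τ _ _ _ (norm_nonneg _) hC'0 (hbd τ).1 (hgb τ)).trans ?_
    gcongr
    have : 0 ≤ B * (2 * C') := by positivity
    linarith
  · rw [fderiv_fun_mul (hh1.differentiable one_ne_zero τ) (hg1.differentiable one_ne_zero τ)]
    refine (norm_add_le _ _).trans ?_
    rw [norm_smul, norm_smul, mul_comm ‖g τ‖, add_comm]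
    have h3 := mulb τ _ _ _ (norm_nonneg _) hC'0 (hbd τ).2 (hgb τ)
    have h4 := mulb τ _ _ _ (norm_nonneg _) (by positivity) (hbd τ).1 (hDg τ)
    rw [add_mul]
    exact add_le_add h3 h4

end Operators

/-! ### Contraction, convolution and cutoffs on forms. -/

section FormAlgebra

open MeasureTheory Filter Topology

variable {d : ℕ} {i : Fin d} {κ : ℂ → ℂ}

lemma pd_add {f g : (Fin d → ℂ) → ℂ} (hf : ContDiff ℝ ∞ f) (hg : ContDiff ℝ ∞ g) (j : Fin d) (c : ℂ) :
    pd j c (fun w => f w + g w) = fun w => pd j c f w + pd j c g w := by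
  funext w
  rw [pd, fderiv_fun_add (hf.differentiable (by simp) w) (hg.differentiable (by simp) w)]; rfl

lemma pd_mul {f g : (Fin d → ℂ) → ℂ} (hf : ContDiff ℝ ∞ f) (hg : ContDiff ℝ ∞ g) (j : Fin d) (c : ℂ) :
    pd j c (fun w => f w * g w) = fun w => pd j c f w * g w + f w * pd j c g w := by
  funext w
  rw [pd, fderiv_fun_mul (hf.differentiable (by simp) w) (hg.differentiable (by simp) w)]
  simp [pd]; ring

lemma pd_zero (j : Fin d) (c : ℂ) : pd j c 0 = 0 := by
  funext w; simp [pd]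

lemma delZbar_zero (j : Fin d) : delZbar j (0 : (Fin d → ℂ) → ℂ) = 0 := by
  funext w; simp [delZbar_eq, pd_zero]

lemma delZ_zero (j : Fin d) : delZ j (0 : (Fin d → ℂ) → ℂ) = 0 := by
  funext w; simp [delZ_eq, pd_zero]

lemma delZbar_const_mul {f : (Fin d → ℂ) → ℂ} (hf : ContDiff ℝ ∞ f) (a : ℂ) (j : Fin d)
    (w : Fin d → ℂ) : delZbar j (fun w => a * f w) w = a * delZbar j f w := by
  rw [delZbar_eq, delZbar_eq, pd_const_mul hf, pd_const_mul hf]; ring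

lemma delZ_const_mul {f : (Fin d → ℂ) → ℂ} (hf : ContDiff ℝ ∞ f) (a : ℂ) (j : Fin d)
    (w : Fin d → ℂ) : delZ j (fun w => a * f w) w = a * delZ j f w := by
  rw [delZ_eq, delZ_eq, pd_const_mul hf, pd_const_mul hf]; ring

lemma delZbar_add {f g : (Fin d → ℂ) → ℂ} (hf : ContDiff ℝ ∞ f) (hg : ContDiff ℝ ∞ g) (j : Fin d)
    (w : Fin d → ℂ) : delZbar j (fun w => f w + g w) w = delZbar j f w + delZbar j g w := by
  rw [delZbar_eq, delZbar_eq, delZbar_eq, pd_add hf hg, pd_add hf hg]; ring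

lemma delZ_add {f g : (Fin d → ℂ) → ℂ} (hf : ContDiff ℝ ∞ f) (hg : ContDiff ℝ ∞ g) (j : Fin d)
    (w : Fin d → ℂ) : delZ j (fun w => f w + g w) w = delZ j f w + delZ j g w := by
  rw [delZ_eq, delZ_eq, delZ_eq, pd_add hf hg, pd_add hf hg]; ring

lemma delZbar_mul {f g : (Fin d → ℂ) → ℂ} (hf : ContDiff ℝ ∞ f) (hg : ContDiff ℝ ∞ g) (j : Fin d)
    (w : Fin d → ℂ) :
    delZbar j (fun w => f w * g w) w = delZbar j f w * g w + f w * delZbar j g w := by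
  rw [delZbar_eq, delZbar_eq, delZbar_eq, pd_mul hf hg, pd_mul hf hg]; ring

/-- The sign of `dz̄_i` in front of `dz_I ∧ dz̄_K`. -/
def sgn (I K : Finset (Fin d)) (i : Fin d) : ℂ := (-1) ^ (I.card + (K.filter (· < i)).card)

lemma sgn_mul_self (I K : Finset (Fin d)) (i : Fin d) : sgn I K i * sgn I K i = 1 := by
  rw [sgn, ← mul_pow]; simp

lemma norm_sgn (I K : Finset (Fin d)) (i : Fin d) : ‖sgn I K i‖ = 1 := by
  rw [sgn, norm_pow]; simp

lemma sgn_insert_self (I K : Finset (Fin d)) (i : Fin d) : sgn I (insert i K) i = sgn I K i := by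
  rw [sgn, sgn, Finset.filter_insert, if_neg (lt_irrefl i)]

lemma sgn_erase_self (I K : Finset (Fin d)) (i : Fin d) : sgn I (K.erase i) i = sgn I K i := by
  rw [sgn, sgn, Finset.filter_erase, Finset.erase_eq_of_notMem (by simp)]

/-- This is the anticommutation of dz̄_j ∧ with contraction by ∂/∂z̄_i for i ≠ j: only the larger of
the two indices has the other one counted among its predecessors, which produces a single sign. -/
lemma sgn_swap {I K : Finset (Fin d)} {i j : Fin d} (hi : i ∉ K) (hj : j ∈ K) :
    sgn I K j * sgn I (K.erase j) i = -(sgn I K i * sgn I (insert i K) j) := by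
  have hij : i ≠ j := fun h => hi (h ▸ hj)
  simp only [sgn, Finset.filter_insert, Finset.filter_erase]
  rcases lt_or_gt_of_ne hij with h | h
  · rw [if_pos h, Finset.card_insert_of_notMem (by simp [hi]),
      Finset.erase_eq_of_notMem (by simp [h.le])]
    ring
  · rw [if_neg (not_lt_of_gt h), Finset.card_erase_of_mem (by simp [hj, h])]
    obtain ⟨m, hm⟩ := Nat.exists_eq_add_of_lt (Finset.card_pos.mpr
      ⟨j, (by simp [hj, h] : j ∈ K.filter (· < i))⟩)
    rw [hm]
    simp only [zero_add, Nat.add_sub_cancel]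
    ring

lemma dbar_eq (F : Form d ℂ) (I K : Finset (Fin d)) (w : Fin d → ℂ) :
    dbar F I K w = ∑ j ∈ K, sgn I K j * delZbar j (F I (K.erase j)) w := rfl

/-- The operator `d'` for forms with coefficients in a horizontal frame. -/
def del (F : Form d ℂ) : Form d ℂ := fun I K w =>
  ∑ j ∈ I, (-1 : ℂ) ^ (I.filter (· < j)).card * delZ j (F (I.erase j) K) w

/-- Contraction with `∂/∂z̄_i`. -/
def contr (i : Fin d) (F : Form d ℂ) : Form d ℂ := fun I K w =>
  if i ∈ K then 0 else sgn I K i * F I (insert i K) w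

/-- All coefficients are smooth. -/
def SmoothForm (F : Form d ℂ) : Prop := ∀ I K, ContDiff ℝ ∞ (F I K)

lemma contr_of_mem {F : Form d ℂ} {I K : Finset (Fin d)} (h : i ∈ K) : contr i F I K = 0 := by
  funext w; simp [contr, h]

lemma contr_of_notMem {F : Form d ℂ} {I K : Finset (Fin d)} (h : i ∉ K) :
    contr i F I K = fun w => sgn I K i * F I (insert i K) w := by
  funext w; simp [contr, h]

lemma SmoothForm.contr {F : Form d ℂ} (hF : SmoothForm F) (i : Fin d) : SmoothForm (contr i F) := by
  intro I K
  by_cases h : i ∈ K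
  · rw [contr_of_mem h]; exact contDiff_const
  · rw [contr_of_notMem h]; exact contDiff_const.mul (hF _ _)

/-- Cartan's formula d''ι + ιd'' = ∂/∂z̄_i, the Lie derivative along a constant field acting
coefficientwise. It turns an inverse of ∂/∂z̄_i into a homotopy operator for d''. -/
theorem dbar_contr {G : Form d ℂ} (hG : SmoothForm G) (i : Fin d) (I K : Finset (Fin d))
    (w : Fin d → ℂ) :
    dbar (contr i G) I K w = delZbar i (G I K) w - contr i (dbar G) I K w := by
  rw [dbar_eq]
  by_cases hi : i ∈ K
  · rw [contr_of_mem hi, Finset.sum_eq_single i]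
    · rw [contr_of_notMem (Finset.notMem_erase i K), delZbar_const_mul (hG _ _), ← mul_assoc,
        sgn_erase_self, sgn_mul_self, Finset.insert_erase hi]
      simp
    · intro j _ hj
      rw [contr_of_mem (Finset.mem_erase.mpr ⟨hj.symm, hi⟩), delZbar_zero]; simp
    · exact fun h => absurd hi h
  · rw [contr_of_notMem hi]
    simp only [dbar_eq]
    rw [Finset.sum_insert hi, Finset.erase_insert hi, mul_add, ← mul_assoc, sgn_insert_self,
      sgn_mul_self, one_mul, sub_add_cancel_left, Finset.mul_sum, ← Finset.sum_neg_distrib]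
    refine Finset.sum_congr rfl fun j hj => ?_
    have hij : i ≠ j := fun h => hi (h ▸ hj)
    rw [contr_of_notMem (fun h => hi (Finset.mem_of_mem_erase h)), delZbar_const_mul (hG _ _),
      ← mul_assoc, sgn_swap hi hj, Finset.erase_insert_of_ne hij]
    ring

/-- Contraction by an antiholomorphic field commutes with d' up to sign. Only norms matter for the
estimates, so the sign is left as a constant of modulus 1. -/
theorem del_contr {G : Form d ℂ} (hG : SmoothForm G) (i : Fin d) (I K : Finset (Fin d)) :
    (i ∈ K → del (contr i G) I K = 0) ∧
    (i ∉ K → ∃ s : ℂ, ‖s‖ = 1 ∧ ∀ w, del (contr i G) I K w = s * del G I (insert i K) w) := by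
  constructor
  · intro h
    funext w
    refine Finset.sum_eq_zero fun j _ => ?_
    rw [contr_of_mem h, delZ_zero]; simp
  · intro h
    refine ⟨(-1) ^ (I.card - 1 + (K.filter (· < i)).card), by rw [norm_pow]; simp, fun w => ?_⟩
    rw [del, del, Finset.mul_sum]
    refine Finset.sum_congr rfl fun j hj => ?_
    rw [contr_of_notMem h, delZ_const_mul (hG _ _), sgn, Finset.card_erase_of_mem hj]
    ring

lemma Cv_sum {ι : Type*} (s : Finset ι) (a : ι → ℂ) (f : ι → (Fin d → ℂ) → ℂ) (w : Fin d → ℂ)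
    (hf : ∀ j ∈ s, Integrable (fun τ => κ τ * f j (w + Pi.single i τ))) :
    Cv i κ (fun w => ∑ j ∈ s, a j * f j w) w = ∑ j ∈ s, a j * Cv i κ (f j) w := by
  simp only [Cv]
  simp_rw [← integral_const_mul]
  rw [← integral_finsetSum _ fun j hj => (hf j hj).const_mul (a j)]
  refine integral_congr_ae (Eventually.of_forall fun τ => ?_)
  simp only [Finset.mul_sum]
  exact Finset.sum_congr rfl fun j _ => by ring

lemma Cv_zero : Cv i κ 0 = 0 := by
  funext w; simp [Cv]

lemma Cv_eq_zero {f : (Fin d → ℂ) → ℂ} {w : Fin d → ℂ}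
    (h : ∀ τ, κ τ ≠ 0 → f (w + Pi.single i τ) = 0) : Cv i κ f w = 0 := by
  rw [Cv]
  refine integral_eq_zero_of_ae (Eventually.of_forall fun τ => ?_)
  by_cases hτ : κ τ = 0
  · simp [hτ]
  · simp [h τ hτ]

/-- Convolution of all coefficients. -/
def CvForm (i : Fin d) (κ : ℂ → ℂ) (F : Form d ℂ) : Form d ℂ := fun I K => Cv i κ (F I K)

lemma integrable_delZbar {f : (Fin d → ℂ) → ℂ} (hκ : AEStronglyMeasurable κ) (hf : ContDiff ℝ ∞ f)
    (h : DomAll i κ f) (j : Fin d) (w : Fin d → ℂ) :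
    Integrable (fun τ => κ τ * delZbar j f (w + Pi.single i τ)) := by
  have h1 := (h.pd j 1).zero.integrable hκ (contDiff_pd hf _ _).continuous w
  have h2 := (h.pd j Complex.I).zero.integrable hκ (contDiff_pd hf _ _).continuous w
  refine ((h1.const_mul (1 / 2)).add (h2.const_mul (1 / 2 * Complex.I))).congr
    (Eventually.of_forall fun τ => ?_)
  simp only [Pi.add_apply, delZbar_eq]; ring

lemma integrable_delZ {f : (Fin d → ℂ) → ℂ} (hκ : AEStronglyMeasurable κ) (hf : ContDiff ℝ ∞ f)
    (h : DomAll i κ f) (j : Fin d) (w : Fin d → ℂ) :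
    Integrable (fun τ => κ τ * delZ j f (w + Pi.single i τ)) := by
  have h1 := (h.pd j 1).zero.integrable hκ (contDiff_pd hf _ _).continuous w
  have h2 := (h.pd j Complex.I).zero.integrable hκ (contDiff_pd hf _ _).continuous w
  refine ((h1.const_mul (1 / 2)).sub (h2.const_mul (1 / 2 * Complex.I))).congr
    (Eventually.of_forall fun τ => ?_)
  simp only [Pi.sub_apply, delZ_eq]; ring

theorem dbar_CvForm {F : Form d ℂ} (hκ : AEStronglyMeasurable κ) (hF : SmoothForm F)
    (h : ∀ I K, DomAll i κ (F I K)) (I K : Finset (Fin d)) :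
    dbar (CvForm i κ F) I K = Cv i κ (dbar F I K) := by
  funext w
  have : dbar F I K = fun w => ∑ j ∈ K, sgn I K j * delZbar j (F I (K.erase j)) w := rfl
  rw [this, Cv_sum _ _ (fun j => delZbar j (F I (K.erase j))) _
    fun j _ => integrable_delZbar hκ (hF _ _) (h _ _) j w, dbar_eq]
  refine Finset.sum_congr rfl fun j _ => ?_
  rw [CvForm, delZbar_Cv hκ (hF _ _) (h _ _)]

theorem del_CvForm {F : Form d ℂ} (hκ : AEStronglyMeasurable κ) (hF : SmoothForm F)
    (h : ∀ I K, DomAll i κ (F I K)) (I K : Finset (Fin d)) :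
    del (CvForm i κ F) I K = Cv i κ (del F I K) := by
  funext w
  have : del F I K = fun w => ∑ j ∈ I, (-1 : ℂ) ^ (I.filter (· < j)).card *
    delZ j (F (I.erase j) K) w := rfl
  rw [this, Cv_sum _ _ (fun j => delZ j (F (I.erase j) K)) _
    fun j _ => integrable_delZ hκ (hF _ _) (h _ _) j w, del]
  refine Finset.sum_congr rfl fun j _ => ?_
  rw [CvForm, delZ_Cv hκ (hF _ _) (h _ _)]

lemma wordD_add {f g : (Fin d → ℂ) → ℂ} (hf : ContDiff ℝ ∞ f) (hg : ContDiff ℝ ∞ g)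
    (l : List (Fin d × ℂ)) : wordD l (fun w => f w + g w) = fun w => wordD l f w + wordD l g w := by
  induction l generalizing f g with
  | nil => rfl
  | cons x l ih => rw [wordD, pd_add hf hg, ih (contDiff_pd hf _ _) (contDiff_pd hg _ _)]; rfl

lemma wordD_zero (l : List (Fin d × ℂ)) : wordD l (0 : (Fin d → ℂ) → ℂ) = 0 := by
  induction l with
  | nil => rfl
  | cons x l ih => rw [wordD, pd_zero, ih]

variable {ε : Fin d → ℝ} {M : Finset (Fin d)}

lemma wordBound_zero : WordBound M ε (0 : (Fin d → ℂ) → ℂ) := fun l _ =>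
  ⟨0, fun w => by rw [wordD_zero]; simp⟩

/-- The function `c(e^{w_i})`. -/
def cutFun (i : Fin d) (c : ℂ → ℂ) (w : Fin d → ℂ) : ℂ := c (Complex.exp (w i))

lemma contDiff_exp_coord (i : Fin d) : ContDiff ℝ ∞ (fun w : Fin d → ℂ => Complex.exp (w i)) :=
  Complex.contDiff_exp.comp (contDiff_apply ℝ ℂ i)

lemma contDiff_cutFun {c : ℂ → ℂ} (hc : ContDiff ℝ ∞ c) (i : Fin d) :
    ContDiff ℝ ∞ (cutFun i c) := hc.comp (contDiff_exp_coord i)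

/-- The derivative of `c(e^{t})` in the direction `v`, as a function of `e^t`. -/
def logDeriv (v : ℂ) (c : ℂ → ℂ) (z : ℂ) : ℂ := fderiv ℝ c z (z * v)

lemma contDiff_logDeriv {c : ℂ → ℂ} (hc : ContDiff ℝ ∞ c) (v : ℂ) :
    ContDiff ℝ ∞ (logDeriv v c) :=
  (hc.fderiv_right (m := ∞) (by simp)).clm_apply (contDiff_id.mul contDiff_const)

lemma hasCompactSupport_logDeriv {c : ℂ → ℂ} (hc : HasCompactSupport c) (v : ℂ) :
    HasCompactSupport (logDeriv v c) := by
  refine (hc.fderiv ℝ).mono fun z hz => ?_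
  rw [Function.mem_support] at hz ⊢
  intro h
  rw [logDeriv, h] at hz
  simp at hz

lemma hasFDerivAt_exp_coord (i : Fin d) (w : Fin d → ℂ) :
    HasFDerivAt (fun w : Fin d → ℂ => Complex.exp (w i))
      (Complex.exp (w i) • (ContinuousLinearMap.proj (R := ℝ) (φ := fun _ : Fin d => ℂ) i)) w := by
  have h1 := (Complex.hasDerivAt_exp (w i)).complexToReal_fderiv
  refine (h1.comp w (ContinuousLinearMap.proj (R := ℝ) (φ := fun _ : Fin d => ℂ) i).hasFDerivAt).congr_fderiv ?_
  ext v; simp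

lemma pd_cutFun {c : ℂ → ℂ} (hc : ContDiff ℝ ∞ c) (j : Fin d) (v : ℂ) :
    pd j v (cutFun i c) = if j = i then cutFun i (logDeriv v c) else 0 := by
  funext w
  have h := (hc.differentiable (by simp) (Complex.exp (w i))).hasFDerivAt.comp w
    (hasFDerivAt_exp_coord i w)
  rw [pd, show fderiv ℝ (cutFun i c) w = _ from h.fderiv]
  split_ifs with hj
  · subst hj; simp [cutFun, logDeriv]
  · simp [Pi.single_eq_of_ne (Ne.symm hj)]

/-- The `∂̄`-derivative of `c(e^t)` as a function of `e^t`. -/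
def logDbar (c : ℂ → ℂ) (z : ℂ) : ℂ := (1 / 2) * (logDeriv 1 c z + Complex.I * logDeriv Complex.I c z)

lemma contDiff_logDbar {c : ℂ → ℂ} (hc : ContDiff ℝ ∞ c) : ContDiff ℝ ∞ (logDbar c) :=
  contDiff_const.mul ((contDiff_logDeriv hc _).add (contDiff_const.mul (contDiff_logDeriv hc _)))

lemma hasCompactSupport_logDbar {c : ℂ → ℂ} (hc : HasCompactSupport c) :
    HasCompactSupport (logDbar c) := by
  unfold logDbar
  exact ((hasCompactSupport_logDeriv hc 1).add ((hasCompactSupport_logDeriv hc Complex.I).mul_left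
    (f := fun _ : ℂ => Complex.I))).mul_left (f := fun _ : ℂ => (1 / 2 : ℂ))

lemma logDbar_eq_zero {c : ℂ → ℂ} {z a : ℂ} (h : c =ᶠ[𝓝 z] fun _ => a) : logDbar c z = 0 := by
  simp [logDbar, logDeriv, h.fderiv_eq]

lemma delZbar_cutFun {c : ℂ → ℂ} (hc : ContDiff ℝ ∞ c) (j : Fin d) :
    delZbar j (cutFun i c) = if j = i then cutFun i (logDbar c) else 0 := by
  funext w
  rw [delZbar_eq, pd_cutFun hc, pd_cutFun hc]
  split_ifs with h
  · rfl
  · simp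

/-- Derivatives of c(e^{w_i}) are again smooth compactly supported functions of e^{w_i}, by
`pd_cutFun`. They are thus bounded on all of ℂ^d, including as Re w_i → -∞; the induction has to
vary c as well as f. -/
lemma wordBound_cutFun_mul {c : ℂ → ℂ} (hc : ContDiff ℝ ∞ c) (hs : HasCompactSupport c)
    {f : (Fin d → ℂ) → ℂ} (hf : ContDiff ℝ ∞ f) (h : WordBound M ε f) :
    WordBound M ε (fun w => cutFun i c w * f w) := by
  intro l
  induction l generalizing c f with
  | nil =>
    intro _
    obtain ⟨C, hC⟩ := h [] (by simp)
    obtain ⟨B, hB⟩ := hs.exists_bound_of_continuous hc.continuous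
    refine ⟨B * C, fun w => ?_⟩
    rw [wordD, norm_mul, mul_assoc]
    have : 0 ≤ B := (norm_nonneg _).trans (hB 0)
    exact mul_le_mul (hB _) (hC w) (norm_nonneg _) this
  | cons x l ih =>
    intro hl
    have hl' : ∀ y ∈ l, y.1 ∈ M := fun y hy => hl y (List.mem_cons_of_mem _ hy)
    have hx : x.1 ∈ M := hl x List.mem_cons_self
    have hp : WordBound M ε (pd x.1 x.2 f) := fun l' hl' => h (x :: l') (by
      simp only [List.mem_cons, forall_eq_or_imp]; exact ⟨hx, hl'⟩)
    obtain ⟨C1, h1⟩ := ih hc hs (contDiff_pd hf x.1 x.2) hp hl'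
    have hcont : ContDiff ℝ ∞ (fun w => pd x.1 x.2 (cutFun i c) w * f w) :=
      (contDiff_pd (contDiff_cutFun hc i) _ _).mul hf
    obtain ⟨C2, h2⟩ : ∃ C, ∀ w, ‖wordD l (fun w => pd x.1 x.2 (cutFun i c) w * f w) w‖ ≤ C * wt ε w := by
      rw [pd_cutFun hc]
      split_ifs with hxi
      · exact ih (contDiff_logDeriv hc _) (hasCompactSupport_logDeriv hs _) hf h hl'
      · have : (fun w => (0 : (Fin d → ℂ) → ℂ) w * f w) = 0 := by funext w; simp
        rw [this, wordD_zero]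
        exact ⟨0, by simp⟩
    refine ⟨C2 + C1, fun w => ?_⟩
    rw [wordD, pd_mul (contDiff_cutFun hc i) hf,
      wordD_add hcont ((contDiff_cutFun hc i).mul (contDiff_pd hf _ _)), add_mul]
    exact (norm_add_le _ _).trans (add_le_add (h2 w) (h1 w))

lemma cutFun_add_period (c : ℂ → ℂ) (w : Fin d → ℂ) (j : Fin d) :
    cutFun i c (w + Pi.single j (2 * Real.pi * Complex.I)) = cutFun i c w := by
  rw [cutFun, cutFun, Pi.add_apply]
  by_cases h : i = j
  · subst h; rw [Pi.single_eq_same, Complex.exp_periodic]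
  · rw [Pi.single_eq_of_ne h, add_zero]

lemma QuasiPeriodic.cutFun_mul {f : (Fin d → ℂ) → ℂ} {j : Fin d} {l : ℝ} (h : QuasiPeriodic j l f)
    (c : ℂ → ℂ) : QuasiPeriodic j l (fun w => cutFun i c w * f w) := by
  intro w
  simp only
  rw [cutFun_add_period, h]; ring

end FormAlgebra

/-! ### The Dolbeault–Grothendieck induction in logarithmic coordinates. -/

section Homotopy

open MeasureTheory Filter Topology

variable {d : ℕ} {i : Fin d} {κ : ℂ → ℂ} {p q : ℕ} {ε lam : Fin d → ℝ}

/-- A form of type `(p, q)` on `ℂ^d` in logarithmic coordinates, with monodromy `e^{2πi lam}`,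
satisfying the growth conditions for the weight `ε`. -/
structure LogForm (p q : ℕ) (lam ε : Fin d → ℝ) (F : Form d ℂ) : Prop where
  smooth : SmoothForm F
  type_eq : ∀ I K, ¬(I.card = p ∧ K.card = q) → F I K = 0
  bound : ∀ I K, ∃ C, ∀ w, ‖F I K w‖ ≤ C * wt ε w
  bound_del : ∀ I K, ∃ C, ∀ w, ‖del F I K w‖ ≤ C * wt ε w
  quasi : ∀ j I K, QuasiPeriodic j (lam j) (F I K)

lemma SmoothForm.add {F G : Form d ℂ} (hF : SmoothForm F) (hG : SmoothForm G) :
    SmoothForm (fun I K w => F I K w + G I K w) := fun I K => (hF I K).add (hG I K)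

lemma dbar_add {F G : Form d ℂ} (hF : SmoothForm F) (hG : SmoothForm G) (I K : Finset (Fin d))
    (w : Fin d → ℂ) :
    dbar (fun I K w => F I K w + G I K w) I K w = dbar F I K w + dbar G I K w := by
  simp only [dbar_eq]
  rw [← Finset.sum_add_distrib]
  refine Finset.sum_congr rfl fun j _ => ?_
  rw [delZbar_add (hF _ _) (hG _ _)]; ring

lemma del_add {F G : Form d ℂ} (hF : SmoothForm F) (hG : SmoothForm G) (I K : Finset (Fin d))
    (w : Fin d → ℂ) :
    del (fun I K w => F I K w + G I K w) I K w = del F I K w + del G I K w := by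
  simp only [del]
  rw [← Finset.sum_add_distrib]
  refine Finset.sum_congr rfl fun j _ => ?_
  rw [delZ_add (hF _ _) (hG _ _)]; ring

lemma LogForm.add {F G : Form d ℂ} (hF : LogForm p q lam ε F) (hG : LogForm p q lam ε G) :
    LogForm p q lam ε (fun I K w => F I K w + G I K w) where
  smooth := hF.smooth.add hG.smooth
  type_eq I K h := by funext w; simp [hF.type_eq I K h, hG.type_eq I K h]
  bound I K := by
    obtain ⟨C, hC⟩ := hF.bound I K
    obtain ⟨B, hB⟩ := hG.bound I K
    exact ⟨C + B, fun w => by rw [add_mul]; exact (norm_add_le _ _).trans (add_le_add (hC w) (hB w))⟩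
  bound_del I K := by
    obtain ⟨C, hC⟩ := hF.bound_del I K
    obtain ⟨B, hB⟩ := hG.bound_del I K
    exact ⟨C + B, fun w => by
      rw [add_mul, del_add hF.smooth hG.smooth]
      exact (norm_add_le _ _).trans (add_le_add (hC w) (hB w))⟩
  quasi j I K w := by simp only; rw [hF.quasi j I K, hG.quasi j I K]; ring

lemma logForm_zero : LogForm p q lam ε (fun _ _ _ => 0 : Form d ℂ) where
  smooth _ _ := contDiff_const
  type_eq _ _ _ := rfl
  bound _ _ := ⟨0, fun w => by simp⟩
  bound_del _ _ := ⟨0, fun w => by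
    have : del (fun _ _ _ => 0 : Form d ℂ) = fun _ _ _ => 0 := by
      funext I K w
      refine Finset.sum_eq_zero fun j _ => ?_
      have : delZ j (fun _ : Fin d → ℂ => (0 : ℂ)) = 0 := delZ_zero j
      rw [this]; simp
    simp [this]⟩
  quasi _ _ _ w := by simp

/-- Contraction lowers the antiholomorphic degree. -/
lemma LogForm.contr {G : Form d ℂ} (hG : LogForm p q lam ε G) (i : Fin d) :
    LogForm p (q - 1) lam ε (contr i G) where
  smooth := hG.smooth.contr i
  type_eq I K h := by
    by_cases hi : i ∈ K
    · exact contr_of_mem hi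
    · rw [contr_of_notMem hi, hG.type_eq]
      · funext w; simp
      · rw [Finset.card_insert_of_notMem hi]; omega
  bound I K := by
    by_cases hi : i ∈ K
    · exact ⟨0, fun w => by rw [contr_of_mem hi]; simp⟩
    · obtain ⟨C, hC⟩ := hG.bound I (insert i K)
      exact ⟨C, fun w => by rw [contr_of_notMem hi, norm_mul, norm_sgn, one_mul]; exact hC w⟩
  bound_del I K := by
    by_cases hi : i ∈ K
    · exact ⟨0, fun w => by rw [(del_contr hG.smooth i I K).1 hi]; simp⟩
    · obtain ⟨s, hs, h⟩ := (del_contr hG.smooth i I K).2 hi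
      obtain ⟨C, hC⟩ := hG.bound_del I (insert i K)
      exact ⟨C, fun w => by rw [h, norm_mul, hs, one_mul]; exact hC w⟩
  quasi j I K w := by
    by_cases hi : i ∈ K
    · rw [contr_of_mem hi]; simp
    · rw [contr_of_notMem hi]; simp only; rw [hG.quasi j]; ring

lemma LogForm.cvForm {F : Form d ℂ} (hF : LogForm p q lam ε F) (hm : AEStronglyMeasurable κ)
    (hκ : Integrable (fun τ => ‖κ τ‖ * Real.exp (ε i * τ.re))) (h : ∀ I K, DomAll i κ (F I K)) :
    LogForm p q lam ε (CvForm i κ F) where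
  smooth I K := contDiff_Cv hm (hF.smooth I K) (h I K)
  type_eq I K h := by rw [CvForm, hF.type_eq I K h, Cv_zero]
  bound I K := by
    obtain ⟨C, hC⟩ := hF.bound I K
    exact ⟨_, norm_Cv_le hκ hC⟩
  bound_del I K := by
    obtain ⟨C, hC⟩ := hF.bound_del I K
    rw [del_CvForm hm hF.smooth h]
    exact ⟨_, norm_Cv_le hκ hC⟩
  quasi j I K := (hF.quasi j I K).Cv

lemma bound_del_of_wordBound {F : Form d ℂ} (h : ∀ I K, WordBound Finset.univ ε (F I K))
    (I K : Finset (Fin d)) : ∃ C, ∀ w, ‖del F I K w‖ ≤ C * wt ε w := by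
  have h1 : ∀ j, ∃ C, ∀ w, ‖delZ j (F (I.erase j) K) w‖ ≤ C * wt ε w := fun j => by
    obtain ⟨C, hC⟩ := h (I.erase j) K [(j, 1)] (by simp)
    obtain ⟨B, hB⟩ := h (I.erase j) K [(j, Complex.I)] (by simp)
    refine ⟨C + B, fun w => ?_⟩
    have h3 : ‖(1 / 2 : ℂ)‖ = 1 / 2 := by norm_num
    have h4 := norm_sub_le (pd j 1 (F (I.erase j) K) w) (Complex.I * pd j Complex.I (F (I.erase j) K) w)
    rw [norm_mul Complex.I, Complex.norm_I, one_mul] at h4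
    have h5 : ‖pd j 1 (F (I.erase j) K) w‖ ≤ C * wt ε w := hC w
    have h6 : ‖pd j Complex.I (F (I.erase j) K) w‖ ≤ B * wt ε w := hB w
    rw [delZ_eq, norm_mul, h3]
    nlinarith [norm_nonneg (pd j 1 (F (I.erase j) K) w), norm_nonneg (pd j Complex.I (F (I.erase j) K) w)]
  choose C hC using h1
  refine ⟨∑ j ∈ I, C j, fun w => ?_⟩
  rw [del, Finset.sum_mul]
  refine norm_sum_le_of_le _ fun j _ => ?_
  rw [norm_mul, norm_pow, norm_neg, norm_one, one_pow, one_mul]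
  exact hC j w

/-- The points of `ℂ^d` whose exponential lies in a polydisc. -/
def logRegion (a : Fin d → ℂ) (ρ : Fin d → ℝ) : Set (Fin d → ℂ) :=
  {w | ∀ i, ‖Complex.exp (w i) - a i‖ < ρ i}

/-- The variable t is unbounded to the left, but e^t is bounded on the disc, so e^{t+τ} - e^t = e^t
(e^τ - 1) is small uniformly in t. -/
lemma exists_shift_radius {a : ℂ} {r r' : ℝ} (h : r' < r) : ∃ δ > 0, ∀ t τ : ℂ,
    ‖Complex.exp t - a‖ < r' → ‖τ‖ < δ → ‖Complex.exp (t + τ) - a‖ < r := by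
  set B := ‖a‖ + |r'| + 1
  have hB : 0 < B := by positivity
  have hc : ContinuousAt Complex.exp 0 := Complex.continuous_exp.continuousAt
  obtain ⟨δ, hδ, hd⟩ := Metric.continuousAt_iff.mp hc ((r - r') / B) (div_pos (by linarith) hB)
  refine ⟨δ, hδ, fun t τ ht hτ => ?_⟩
  have h1 := hd (x := τ) (by simpa using hτ)
  rw [Complex.exp_zero, dist_eq_norm] at h1
  have h2 : ‖Complex.exp t‖ ≤ B := by
    have h3 := norm_add_le (Complex.exp t - a) a
    rw [sub_add_cancel] at h3
    have := le_abs_self r'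
    simp only [B]; linarith
  have h4 : Complex.exp (t + τ) - a = (Complex.exp t - a) + Complex.exp t * (Complex.exp τ - 1) := by
    rw [Complex.exp_add]; ring
  rw [h4]
  refine (norm_add_le _ _).trans_lt ?_
  rw [norm_mul]
  have h5 : ‖Complex.exp t‖ * ‖Complex.exp τ - 1‖ ≤ B * ((r - r') / B) := by gcongr
  rw [mul_div_cancel₀ _ hB.ne'] at h5
  linarith

lemma exists_cutoff {r : ℝ} (hr : 0 < r) : ∃ h : ℂ → ℂ, ContDiff ℝ ∞ h ∧ HasCompactSupport h ∧
    (h =ᶠ[𝓝 0] fun _ => 1) ∧ ∀ τ, r ≤ ‖τ‖ → h τ = 0 := by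
  let f : ContDiffBump (0 : ℂ) := ⟨r / 3, r / 2, by positivity, by linarith⟩
  refine ⟨fun τ => (f τ : ℂ), Complex.ofRealCLM.contDiff.comp f.contDiff,
    f.hasCompactSupport.comp_left (g := fun x : ℝ => (x : ℂ)) (by simp), ?_, fun τ hτ => ?_⟩
  · filter_upwards [f.eventuallyEq_one] with x hx
    rw [hx]; simp
  · have : f.rOut ≤ dist τ 0 := by rw [dist_zero_right]; show r / 2 ≤ ‖τ‖; linarith
    simp only [f.zero_of_le_dist this, Complex.ofReal_zero]

/-- By `dbar_contr` and `Cv_cauchyKernel`, F - d''(ιTF) = SF + ι(T d''F), with T the convolution by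
the truncated Cauchy kernel and S the one by the smooth kernel. The last term vanishes on the
smaller region because the kernel reaches only points where d''F = 0. What remains is SF, which has
gained bounds on the derivatives in w_i. -/
theorem smoothing_step {F : Form d ℂ} (hF : LogForm p q lam ε F) {M : Finset (Fin d)}
    (hM : ∀ I K, WordBound M ε (F I K)) {a : Fin d → ℂ} {ρ : Fin d → ℝ} {r : ℝ} (hr : r < ρ i)
    (hcl : ∀ I K, ∀ w ∈ logRegion a ρ, dbar F I K w = 0) :
    ∃ A F' : Form d ℂ, LogForm p (q - 1) lam ε A ∧ LogForm p q lam ε F' ∧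
      (∀ I K, WordBound (insert i M) ε (F' I K)) ∧
      (∀ I K, ∀ w ∈ logRegion a (Function.update ρ i r), dbar F' I K w = 0) ∧
      ∀ I K, ∀ w ∈ logRegion a (Function.update ρ i r), F I K w = dbar A I K w + F' I K w := by
  obtain ⟨δ, hδ, hshift⟩ := exists_shift_radius (a := a i) hr
  obtain ⟨h, hh, hc, h1, h0⟩ := exists_cutoff hδ
  have hreg : ∀ w ∈ logRegion a (Function.update ρ i r), ∀ τ : ℂ, ‖τ‖ < δ →
      w + Pi.single i τ ∈ logRegion a ρ := by
    intro w hw τ hτ j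
    have := hw j
    by_cases hj : j = i
    · subst hj
      rw [Function.update_self] at this
      rw [Pi.add_apply, Pi.single_eq_same]
      exact hshift _ _ this hτ
    · rw [Function.update_of_ne hj] at this
      rwa [Pi.add_apply, Pi.single_eq_of_ne hj, add_zero]
  have hk := integrable_cauchyKernel hh.continuous hc
  have hkc := hasCompactSupport_cauchyKernel hc
  have hs := contDiff_smoothKernel hh h1
  have hsc := hasCompactSupport_smoothKernel hc
  have hsi : Integrable (smoothKernel h) := hs.continuous.integrable_of_hasCompactSupport hsc
  have hD1 : ∀ I K, DomAll i (cauchyKernel h) (F I K) := fun I K =>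
    domAll_of_compactSupport hk hkc (hF.smooth I K)
  have hD2 : ∀ I K, DomAll i (smoothKernel h) (F I K) := fun I K =>
    domAll_of_compactSupport hsi hsc (hF.smooth I K)
  have hG := hF.cvForm hk.aestronglyMeasurable (integrable_exp_of_compactSupport hk hkc (ε i)) hD1
  have hS := hF.cvForm hsi.aestronglyMeasurable (integrable_exp_of_compactSupport hsi hsc (ε i)) hD2
  refine ⟨contr i (CvForm i (cauchyKernel h) F), CvForm i (smoothKernel h) F, hG.contr i, hS,
    fun I K => wordBound_smoothing hs hsc (hF.smooth I K) (hM I K), fun I K w hw => ?_,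
    fun I K w hw => ?_⟩
  · rw [dbar_CvForm hsi.aestronglyMeasurable hF.smooth hD2]
    refine Cv_eq_zero fun τ hτ => hcl I K _ (hreg w hw τ ?_)
    by_contra hcon
    push Not at hcon
    refine hτ ?_
    -- The cutoff is known to vanish for ‖τ‖ ≥ δ, so its derivative vanishes on the open exterior;
    -- the sphere ‖τ‖ = δ is reached by continuity of the kernel.
    by_cases hlt : δ < ‖τ‖
    · rw [smoothKernel, planeDbar_eq_zero_of_eventually (a := 0)]
      · simp
      · filter_upwards [(isOpen_lt continuous_const continuous_norm).mem_nhds hlt] with x hx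
        exact h0 x (le_of_lt hx)
    · have hz : smoothKernel h τ = 0 := by
        have hcl : IsClosed {x | smoothKernel h x = 0} := isClosed_eq hs.continuous continuous_const
        have hsub : closure {x : ℂ | δ < ‖x‖} ⊆ {x | smoothKernel h x = 0} := by
          refine hcl.closure_subset_iff.mpr fun x hx => ?_
          show smoothKernel h x = 0
          rw [smoothKernel, planeDbar_eq_zero_of_eventually (a := 0)]
          · simp
          · filter_upwards [(isOpen_lt continuous_const continuous_norm).mem_nhds hx] with y hy
            exact h0 y (le_of_lt hy)
        refine hsub ?_
        have hmem : τ ∈ (Metric.ball (0 : ℂ) δ)ᶜ := by simpa using hcon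
        have : {x : ℂ | δ < ‖x‖} = (Metric.closedBall (0 : ℂ) δ)ᶜ := by ext x; simp
        rw [this, closure_compl, interior_closedBall _ hδ.ne']
        exact hmem
      exact hz
  · have hz : contr i (dbar (CvForm i (cauchyKernel h) F)) I K w = 0 := by
      rw [contr]
      split_ifs with hi
      · rfl
      · rw [dbar_CvForm hk.aestronglyMeasurable hF.smooth hD1, Cv_eq_zero, mul_zero]
        intro τ hτ
        refine hcl I _ _ (hreg w hw τ ?_)
        by_contra hcon
        push Not at hcon
        exact hτ (by rw [cauchyKernel, h0 τ hcon]; simp)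
    rw [dbar_contr hG.smooth, hz, sub_zero, CvForm, delZbar_Cv hk.aestronglyMeasurable (hF.smooth I K)
      (hD1 I K), Cv_cauchyKernel hh hc h1.eq_of_nhds (hF.smooth I K), CvForm]
    ring

/-- Let c be a cutoff in e^{w_i}, equal to 1 on the smaller disc, let T be the cylinder convolution
and A = ιT(cF). Then d''A = cF - ιT(c d''F + c' dw̄_i ∧ F), where c' is `logDbar c`. Since c d''F =
0 along the slices used, F - d''A reduces on the smaller region to the part of T(c'F) without dw̄_i.
The cutoff makes F global in w_i without spoiling periodicity. -/
theorem elimination_step (hl1 : lam i - 1 < ε i) (hl2 : ε i < lam i) {F : Form d ℂ}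
    (hF : LogForm p q lam ε F) (hM : ∀ I K, WordBound Finset.univ ε (F I K))
    {a : Fin d → ℂ} {ρ : Fin d → ℝ} {r : ℝ} (hr0 : 0 < r) (hr : r < ρ i)
    (hcl : ∀ I K, ∀ w ∈ logRegion a ρ, dbar F I K w = 0) :
    ∃ A F' : Form d ℂ, LogForm p (q - 1) lam ε A ∧ LogForm p q lam ε F' ∧
      (∀ I K, WordBound Finset.univ ε (F' I K)) ∧
      (∀ I K, i ∈ K → F' I K = 0) ∧ (∀ K, (∀ I, F I K = 0) → ∀ I, F' I K = 0) ∧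
      (∀ I K, ∀ w ∈ logRegion a (Function.update ρ i r), dbar F' I K w = 0) ∧
      ∀ I K, ∀ w ∈ logRegion a (Function.update ρ i r), F I K w = dbar A I K w + F' I K w := by
  let f : ContDiffBump (a i) := ⟨r, (r + ρ i) / 2, hr0, by linarith⟩
  set c : ℂ → ℂ := fun z => (f z : ℂ) with hcdef
  have hc : ContDiff ℝ ∞ c := Complex.ofRealCLM.contDiff.comp f.contDiff
  have hcs : HasCompactSupport c :=
    f.hasCompactSupport.comp_left (g := fun x : ℝ => (x : ℂ)) (by simp)
  have hc1 : ∀ z, ‖z - a i‖ < r → c =ᶠ[𝓝 z] fun _ => 1 := fun z hz => by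
    have : z ∈ Metric.ball (a i) r := by rwa [mem_ball_iff_norm]
    filter_upwards [Metric.isOpen_ball.mem_nhds this] with x hx
    simp only [hcdef]
    rw [f.one_of_mem_closedBall (Metric.ball_subset_closedBall hx)]; simp
  have hc0 : ∀ z, ρ i ≤ ‖z - a i‖ → c =ᶠ[𝓝 z] fun _ => 0 := fun z hz => by
    have : (r + ρ i) / 2 < ‖z - a i‖ := by linarith
    filter_upwards [(isOpen_lt continuous_const (continuous_id.sub continuous_const).norm).mem_nhds
      this] with x hx
    simp only [hcdef]
    rw [f.zero_of_le_dist (by rw [dist_eq_norm]; exact le_of_lt hx)]; simp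
  set c' := logDbar c with hc'def
  have hc' : ContDiff ℝ ∞ c' := contDiff_logDbar hc
  have hcs' : HasCompactSupport c' := hasCompactSupport_logDbar hcs
  have hreg : ∀ w ∈ logRegion a (Function.update ρ i r), ∀ τ : ℂ,
      ‖Complex.exp ((w + Pi.single i τ : Fin d → ℂ) i) - a i‖ < ρ i → w + Pi.single i τ ∈ logRegion a ρ := by
    intro w hw τ hτ j
    by_cases hj : j = i
    · subst hj; exact hτ
    · have := hw j
      rw [Function.update_of_ne hj] at this
      rwa [Pi.add_apply, Pi.single_eq_of_ne hj, add_zero]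
  have hwi : ∀ w ∈ logRegion a (Function.update ρ i r), ‖Complex.exp (w i) - a i‖ < r := fun w hw => by
    have := hw i
    rwa [Function.update_self] at this
  set κ := cauchyKernel (cylKernel (lam i)) with hκdef
  have hm : AEStronglyMeasurable κ := measurable_cylinder _
  have hκ : Integrable (fun τ => ‖κ τ‖ * Real.exp (ε i * τ.re)) := integrable_cylinder hl1 hl2
  have hcut : ∀ b : ℂ → ℂ, ContDiff ℝ ∞ b → HasCompactSupport b →
      LogForm p q lam ε (fun I K w => cutFun i b w * F I K w) ∧
      ∀ I K, WordBound Finset.univ ε (fun w => cutFun i b w * F I K w) := by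
    intro b hb hbs
    have hw : ∀ I K, WordBound Finset.univ ε (fun w => cutFun i b w * F I K w) := fun I K =>
      wordBound_cutFun_mul hb hbs (hF.smooth I K) (hM I K)
    refine ⟨⟨fun I K => (contDiff_cutFun hb i).mul (hF.smooth I K), fun I K h => ?_, fun I K => ?_,
      bound_del_of_wordBound hw, fun j I K => (hF.quasi j I K).cutFun_mul b⟩, hw⟩
    · funext w; simp [hF.type_eq I K h]
    · exact hw I K [] (by simp)
  obtain ⟨hX, hXw⟩ := hcut c hc hcs
  obtain ⟨hY, hYw⟩ := hcut c' hc' hcs'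
  set X : Form d ℂ := fun I K w => cutFun i c w * F I K w with hXdef
  set Y : Form d ℂ := fun I K w => cutFun i c' w * F I K w with hYdef
  have hDX : ∀ I K, DomAll i κ (X I K) := fun I K => domAll_of_wordBound hκ (hXw I K)
  have hDY : ∀ I K, DomAll i κ (Y I K) := fun I K => domAll_of_wordBound hκ (hYw I K)
  have hG := hX.cvForm hm hκ hDX
  have hH := hY.cvForm hm hκ hDY
  have hinv : ∀ b : ℂ → ℂ, ContDiff ℝ ∞ b → HasCompactSupport b → ∀ I K w,
      delZbar i (Cv i κ (fun w => cutFun i b w * F I K w)) w = cutFun i b w * F I K w := by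
    intro b hb hbs I K w
    obtain ⟨h1, h2⟩ := hcut b hb hbs
    obtain ⟨C0, hC0⟩ := h2 I K [] (by simp)
    obtain ⟨C1, hC1⟩ := h2 I K [(i, 1)] (by simp)
    obtain ⟨C2, hC2⟩ := h2 I K [(i, Complex.I)] (by simp)
    have hle : ∀ x B w, x ≤ B * wt ε w → B ≤ max C0 (max C1 C2) → x ≤ max C0 (max C1 C2) * wt ε w :=
      fun x B w h h' => h.trans (mul_le_mul_of_nonneg_right h' (wt_pos ε w).le)
    rw [delZbar_Cv hm (h1.smooth I K) (domAll_of_wordBound hκ (h2 I K))]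
    exact Cv_cylinder hl1 hl2 (h1.smooth I K) (C := max C0 (max C1 C2))
      (fun w => hle _ C0 w (hC0 w) (le_max_left _ _))
      (fun w => hle _ C1 w (hC1 w) ((le_max_left _ _).trans (le_max_right _ _)))
      (fun w => hle _ C2 w (hC2 w) ((le_max_right _ _).trans (le_max_right _ _)))
      (h1.quasi i I K) w
  have hbzero : ∀ b : ℂ → ℂ, (∀ z, ρ i ≤ ‖z - a i‖ → b z = 0) → ∀ I K,
      ∀ w ∈ logRegion a (Function.update ρ i r),
      Cv i κ (fun w => cutFun i b w * dbar F I K w) w = 0 := by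
    intro b hb I K w hw
    refine Cv_eq_zero fun τ _ => ?_
    by_cases h : ‖Complex.exp ((w + Pi.single i τ : Fin d → ℂ) i) - a i‖ < ρ i
    · rw [hcl I K _ (hreg w hw τ h), mul_zero]
    · rw [cutFun, hb _ (not_lt.mp h), zero_mul]
  -- Contraction produces no component containing dw̄_i, so those of T(c'F) are discarded; this
  -- removes the variable i.
  set F' : Form d ℂ := fun I K => if i ∈ K then 0 else CvForm i κ Y I K with hF'def
  have hF'mem : ∀ I K, i ∈ K → F' I K = 0 := fun I K h => by simp [hF'def, h]
  have hF'not : ∀ I K, i ∉ K → F' I K = CvForm i κ Y I K := fun I K h => by simp [hF'def, h]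
  have hF'w : ∀ I K, WordBound Finset.univ ε (F' I K) := fun I K => by
    by_cases h : i ∈ K
    · rw [hF'mem I K h]; exact wordBound_zero
    · rw [hF'not I K h]; exact wordBound_Cv hm hκ (hY.smooth I K) (hYw I K)
  have hF's : SmoothForm F' := fun I K => by
    by_cases h : i ∈ K
    · rw [hF'mem I K h]; exact contDiff_const
    · rw [hF'not I K h]; exact hH.smooth I K
  have hF'L : LogForm p q lam ε F' := by
    refine ⟨hF's, fun I K h => ?_, fun I K => hF'w I K [] (by simp), bound_del_of_wordBound hF'w,
      fun j I K => ?_⟩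
    · by_cases hi : i ∈ K
      · exact hF'mem I K hi
      · rw [hF'not I K hi]; exact hH.type_eq I K h
    · by_cases hi : i ∈ K
      · rw [hF'mem I K hi]; intro w; simp
      · rw [hF'not I K hi]; exact hH.quasi j I K
  refine ⟨contr i (CvForm i κ X), F', hG.contr i, hF'L, hF'w, hF'mem, fun K hK I => ?_,
    fun I K w hw => ?_, fun I K w hw => ?_⟩
  · by_cases hi : i ∈ K
    · exact hF'mem I K hi
    · rw [hF'not I K hi, CvForm]
      have : Y I K = 0 := by funext w; simp [hYdef, hK I]
      rw [this, Cv_zero]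
  -- For i ∈ K only the ∂/∂w̄_i term survives; it gives c'F, which is 0 where c is locally 1. For i
  -- ∉ K one gets T(c' d''F), whose integrand vanishes throughout: d''F = 0 inside the larger disc
  -- and c' = 0 outside it.
  · by_cases hi : i ∈ K
    · rw [dbar_eq, Finset.sum_eq_single i]
      · rw [hF'not _ _ (Finset.notMem_erase i K), CvForm, hinv c' hc' hcs', cutFun, hc'def,
          logDbar_eq_zero (hc1 _ (hwi w hw))]
        simp
      · intro j _ hj
        rw [hF'mem I _ (Finset.mem_erase.mpr ⟨hj.symm, hi⟩), delZbar_zero]; simp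
      · exact fun h => absurd hi h
    · have h1 : dbar F' I K w = dbar (CvForm i κ Y) I K w := by
        rw [dbar_eq, dbar_eq]
        exact Finset.sum_congr rfl fun j _ => by
          rw [hF'not _ _ (fun h => hi (Finset.mem_of_mem_erase h))]
      rw [h1, dbar_CvForm hm hY.smooth hDY]
      have h2 : dbar Y I K = fun w => cutFun i c' w * dbar F I K w := by
        funext v
        rw [dbar_eq, dbar_eq, Finset.mul_sum]
        refine Finset.sum_congr rfl fun j hj => ?_
        have hji : j ≠ i := fun h => hi (h ▸ hj)
        rw [hYdef, delZbar_mul (contDiff_cutFun hc' i) (hF.smooth _ _), delZbar_cutFun hc', if_neg hji]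
        simp; ring
      rw [h2]
      exact hbzero c' (fun z hz => logDbar_eq_zero (hc0 z hz)) I K w hw
  · rw [dbar_contr hG.smooth]
    have h1 : delZbar i (CvForm i κ X I K) w = F I K w := by
      rw [CvForm, hinv c hc hcs, cutFun, (hc1 _ (hwi w hw)).eq_of_nhds, one_mul]
    rw [h1]
    have h2 : contr i (dbar (CvForm i κ X)) I K w = F' I K w := by
      by_cases hi : i ∈ K
      · rw [contr_of_mem hi, hF'mem I K hi]
      · rw [contr_of_notMem hi, hF'not I K hi, dbar_CvForm hm hX.smooth hDX]
        -- The Leibniz rule for d''(cF): as c depends on e^{w_i} only, it adds just the term c'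
        -- dw̄_i ∧ F.
        have h3 : dbar X I (insert i K) = fun w => 1 * (cutFun i c w * dbar F I (insert i K) w) +
            sgn I K i * Y I K w := by
          funext v
          rw [dbar_eq, dbar_eq, Finset.sum_insert hi, Finset.sum_insert hi, Finset.erase_insert hi,
            sgn_insert_self, hXdef, delZbar_mul (contDiff_cutFun hc i) (hF.smooth _ _),
            delZbar_cutFun hc, if_pos rfl]
          have h4 : ∀ j ∈ K, sgn I (insert i K) j *
              delZbar j (fun w => cutFun i c w * F I ((insert i K).erase j) w) v =
              cutFun i c v * (sgn I (insert i K) j * delZbar j (F I ((insert i K).erase j)) v) := by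
            intro j hj
            have hji : j ≠ i := fun h => hi (h ▸ hj)
            rw [delZbar_mul (contDiff_cutFun hc i) (hF.smooth _ _), delZbar_cutFun hc, if_neg hji]
            simp; ring
          rw [Finset.sum_congr rfl h4, ← Finset.mul_sum]
          simp only [hYdef]
          ring
        have hiY := (hDY I K).zero.integrable hm (hY.smooth I K).continuous w
        have hiX : Integrable (fun τ => κ τ * (cutFun i c (w + Pi.single i τ) *
            dbar F I (insert i K) (w + Pi.single i τ))) := by
          have e1 : ∀ v, cutFun i c v * dbar F I (insert i K) v =
              dbar X I (insert i K) v - sgn I K i * Y I K v := fun v => by rw [h3]; ring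
          simp only [e1]
          have e2 : Integrable (fun τ => κ τ * dbar X I (insert i K) (w + Pi.single i τ)) := by
            simp only [dbar_eq, Finset.mul_sum]
            refine integrable_finsetSum _ fun j _ => ?_
            refine ((integrable_delZbar hm (hX.smooth _ _) (hDX I ((insert i K).erase j)) j w).const_mul
              (sgn I (insert i K) j)).congr (Eventually.of_forall fun τ => ?_)
            simp only; ring
          refine (e2.sub (hiY.const_mul (sgn I K i))).congr (Eventually.of_forall fun τ => ?_)
          simp only [Pi.sub_apply]; ring
        have h5 := Cv_linear (f := fun v => cutFun i c v * dbar F I (insert i K) v) (g := Y I K)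
          1 (sgn I K i) w hiX hiY
        beta_reduce at h5 ⊢
        rw [h3, h5, hbzero c (fun z hz => (hc0 z hz).eq_of_nhds) I _ w hw, mul_zero, zero_add, ← mul_assoc,
          sgn_mul_self, one_mul]
        rfl
    rw [h2]; ring

/-- All variables are smoothed before any is eliminated, because the cylinder convolutions require
bounds on derivatives in every variable. Each step shrinks one radius: from ρ₂ to ρ₁ while
smoothing, from ρ₁ to ρ₀ while eliminating. Finally only components with K = ∅ could survive, and
these are excluded by q > 0. -/
theorem exists_primitive (hl1 : ∀ i, lam i - 1 < ε i) (hl2 : ∀ i, ε i < lam i) (hq : 0 < q)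
    {F : Form d ℂ} (hF : LogForm p q lam ε F) {a : Fin d → ℂ} {ρ₀ ρ₁ ρ₂ : Fin d → ℝ}
    (h0 : ∀ i, 0 < ρ₀ i) (h01 : ∀ i, ρ₀ i < ρ₁ i) (h12 : ∀ i, ρ₁ i < ρ₂ i)
    (hcl : ∀ I K, ∀ w ∈ logRegion a ρ₂, dbar F I K w = 0) :
    ∃ A : Form d ℂ, LogForm p (q - 1) lam ε A ∧
      ∀ I K, ∀ w ∈ logRegion a ρ₀, dbar A I K w = F I K w := by
  have hsub : ∀ {ρ ρ' : Fin d → ℝ}, (∀ i, ρ i ≤ ρ' i) → logRegion a ρ ⊆ logRegion a ρ' :=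
    fun h w hw i => (hw i).trans_le (h i)
  have hpw : ∀ (s : Finset (Fin d)) (i : Fin d) (ρ ρ' : Fin d → ℝ),
      Function.update (s.piecewise ρ ρ') i (ρ i) = (insert i s).piecewise ρ ρ' := fun s i ρ ρ' => by
    rw [Finset.piecewise_insert]
  have stage1 : ∀ s : Finset (Fin d), ∃ A F' : Form d ℂ, LogForm p (q - 1) lam ε A ∧
      LogForm p q lam ε F' ∧ (∀ I K, WordBound s ε (F' I K)) ∧
      (∀ I K, ∀ w ∈ logRegion a (s.piecewise ρ₁ ρ₂), dbar F' I K w = 0) ∧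
      ∀ I K, ∀ w ∈ logRegion a (s.piecewise ρ₁ ρ₂), F I K w = dbar A I K w + F' I K w := by
    intro s
    induction s using Finset.induction_on with
    | empty =>
      refine ⟨fun _ _ _ => 0, F, logForm_zero, hF, fun I K l hl => ?_, by simpa using hcl, ?_⟩
      · have : l = [] := List.eq_nil_iff_forall_not_mem.mpr fun x hx => by simpa using hl x hx
        rw [this]
        exact hF.bound I K
      · intro I K w _
        have : ∀ j, delZbar j (fun _ : Fin d → ℂ => (0 : ℂ)) = 0 := fun j => delZbar_zero j
        rw [dbar_eq, Finset.sum_eq_zero, zero_add]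
        intro j _
        rw [this]; simp
    | insert i s hi ih =>
      obtain ⟨A, F', hA, hF', hW, hc, he⟩ := ih
      have hlt : ρ₁ i < (s.piecewise ρ₁ ρ₂) i := by rw [Finset.piecewise_eq_of_notMem _ _ _ hi]; exact h12 i
      obtain ⟨B, F'', hB, hF'', hW', hc', he'⟩ := smoothing_step (i := i) hF' hW hlt hc
      rw [hpw] at hc' he'
      refine ⟨_, F'', hA.add hB, hF'', hW', hc', fun I K w hw => ?_⟩
      rw [dbar_add hA.smooth hB.smooth, he I K w (hsub ?_ hw), he' I K w hw]
      · ring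
      · intro j
        by_cases hj : j ∈ s
        · simp [hj]
        · by_cases hji : j = i
          · subst hji; simp [hj, (h12 j).le]
          · simp [hj, hji]
  obtain ⟨A, F', hA, hF', hW, hc, he⟩ := stage1 Finset.univ
  rw [Finset.piecewise_univ] at hc he
  have stage2 : ∀ s : Finset (Fin d), ∃ B F'' : Form d ℂ, LogForm p (q - 1) lam ε B ∧
      LogForm p q lam ε F'' ∧ (∀ I K, WordBound Finset.univ ε (F'' I K)) ∧
      (∀ i ∈ s, ∀ K, i ∈ K → ∀ I, F'' I K = 0) ∧
      (∀ I K, ∀ w ∈ logRegion a (s.piecewise ρ₀ ρ₁), dbar F'' I K w = 0) ∧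
      ∀ I K, ∀ w ∈ logRegion a (s.piecewise ρ₀ ρ₁), F I K w = dbar B I K w + F'' I K w := by
    intro s
    induction s using Finset.induction_on with
    | empty => exact ⟨A, F', hA, hF', hW, by simp, by simpa using hc, by simpa using he⟩
    | insert i s hi ih =>
      obtain ⟨B, F1, hB, hF1, hW1, hv1, hc1, he1⟩ := ih
      have hlt : ρ₀ i < (s.piecewise ρ₀ ρ₁) i := by rw [Finset.piecewise_eq_of_notMem _ _ _ hi]; exact h01 i
      obtain ⟨B', F2, hB', hF2, hW2, hv2, hp2, hc2, he2⟩ :=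
        elimination_step (hl1 i) (hl2 i) hF1 hW1 (h0 i) hlt hc1
      rw [hpw] at hc2 he2
      refine ⟨_, F2, hB.add hB', hF2, hW2, fun j hj K hjK I => ?_, hc2, fun I K w hw => ?_⟩
      · rcases Finset.mem_insert.mp hj with rfl | hj
        · exact hv2 I K hjK
        · exact hp2 K (hv1 j hj K hjK) I
      · rw [dbar_add hB.smooth hB'.smooth, he1 I K w (hsub ?_ hw), he2 I K w hw]
        · ring
        · intro j
          by_cases hj : j ∈ s
          · simp [hj]
          · by_cases hji : j = i
            · subst hji; simp [hj, (h01 j).le]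
            · simp [hj, hji]
  obtain ⟨B, F'', hB, hF'', -, hv, -, he'⟩ := stage2 Finset.univ
  rw [Finset.piecewise_univ] at he'
  refine ⟨B, hB, fun I K w hw => ?_⟩
  have hz : F'' I K = 0 := by
    rcases K.eq_empty_or_nonempty with hK | ⟨i, hi⟩
    · exact hF''.type_eq I K fun h => by rw [hK, Finset.card_empty] at h; omega
    · exact hv i (Finset.mem_univ i) K hi I
  rw [he' I K w hw, hz]; simp

end Homotopy

/-! ### Passing between a polydisc and logarithmic coordinates. -/

section Coordinates

open MeasureTheory Filter Topology ComplexConjugate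

variable {d : ℕ} {p q : ℕ} {θ : Fin d → ℝ}

lemma fderiv_single_eq (g : (Fin d → ℂ) → ℂ) (z : Fin d → ℂ) (j : Fin d) (u : ℂ) :
    fderiv ℝ g z (Pi.single j u) = u * delZ j g z + conj u * delZbar j g z := by
  have h : (Pi.single j u : Fin d → ℂ) = u.re • (Pi.single j 1 : Fin d → ℂ) +
      u.im • (Pi.single j Complex.I : Fin d → ℂ) := by
    rw [← Pi.single_smul, ← Pi.single_smul, ← Pi.single_add]
    congr 1
    simp [Complex.re_add_im]
  have hu : u = u.re + u.im * Complex.I := (Complex.re_add_im u).symm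
  have hu' : conj u = u.re - u.im * Complex.I := by
    apply Complex.ext <;> simp
  rw [h, map_add, map_smul, map_smul, hu', delZ_eq, delZbar_eq, pd, pd]
  conv_rhs => rw [hu]
  simp only [Complex.real_smul]
  simp only [Complex.add_re, Complex.ofReal_re, Complex.mul_re, Complex.I_re, Complex.ofReal_im,
    Complex.I_im, Complex.add_im, Complex.mul_im, mul_zero, mul_one, sub_zero, add_zero, zero_add]
  linear_combination ((u.im : ℂ) * fderiv ℝ g z (Pi.single j Complex.I)) * Complex.I_sq

lemma delZ_of_pd {h : (Fin d → ℂ) → ℂ} {w : Fin d → ℂ} {j : Fin d} {A B : ℂ}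
    (hpd : ∀ v, pd j v h w = v * A + conj v * B) : delZ j h w = A ∧ delZbar j h w = B := by
  constructor
  · rw [delZ_eq, hpd, hpd]
    simp only [map_one, Complex.conj_I]
    linear_combination (-(1 / 2 : ℂ) * A + 1 / 2 * B) * Complex.I_sq
  · rw [delZbar_eq, hpd, hpd]
    simp only [map_one, Complex.conj_I]
    linear_combination ((1 / 2 : ℂ) * A - 1 / 2 * B) * Complex.I_sq

/-- The coordinates `z_i = e^{w_i} - c_i`. -/
def expShift (c : Fin d → ℂ) (w : Fin d → ℂ) : Fin d → ℂ := fun i => Complex.exp (w i) - c i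

lemma contDiff_expShift (c : Fin d → ℂ) : ContDiff ℝ ∞ (expShift c) :=
  contDiff_pi.mpr fun i => (contDiff_exp_coord i).sub contDiff_const

lemma fderiv_expShift_single (c w : Fin d → ℂ) (j : Fin d) (v : ℂ) :
    fderiv ℝ (expShift c) w (Pi.single j v) = Pi.single j (Complex.exp (w j) * v) := by
  have h : HasFDerivAt (expShift c) (ContinuousLinearMap.pi fun i => (Complex.exp (w i) •
      (ContinuousLinearMap.proj (R := ℝ) (φ := fun _ : Fin d => ℂ) i))) w :=
    hasFDerivAt_pi.mpr fun i => (hasFDerivAt_exp_coord i w).sub_const (c i)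
  rw [h.fderiv]
  funext i
  by_cases hi : i = j
  · subst hi; simp
  · simp [hi]

lemma pd_comp_expShift {g : (Fin d → ℂ) → ℂ} {c w : Fin d → ℂ}
    (hg : DifferentiableAt ℝ g (expShift c w)) (j : Fin d) (v : ℂ) :
    pd j v (fun w => g (expShift c w)) w = v * (Complex.exp (w j) * delZ j g (expShift c w)) +
      conj v * (conj (Complex.exp (w j)) * delZbar j g (expShift c w)) := by
  have h := fderiv_comp w hg ((contDiff_expShift c).differentiable (by simp) w)
  rw [pd, show (fun w => g (expShift c w)) = g ∘ expShift c from rfl, h,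
    ContinuousLinearMap.comp_apply, fderiv_expShift_single, fderiv_single_eq, map_mul]
  ring

/-- The factor relating the coefficients of a form `F ⊗ μ` in the frame `dz_I ∧ dz̄_K ⊗ μ` to its
coefficients in the frame `dw_I ∧ dw̄_K ⊗ s`, with `s` multivalued horizontal. -/
def pre (θ : Fin d → ℝ) (I K : Finset (Fin d)) (w : Fin d → ℂ) : ℂ :=
  Complex.exp (∑ i, (((θ i / (2 * Real.pi) : ℝ) : ℂ) * w i + (if i ∈ I then w i else 0) +
    (if i ∈ K then conj (w i) else 0)))

lemma pre_ne_zero (I K : Finset (Fin d)) (w : Fin d → ℂ) : pre θ I K w ≠ 0 := Complex.exp_ne_zero _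

lemma contDiff_pre (I K : Finset (Fin d)) : ContDiff ℝ ∞ (pre θ I K) := by
  unfold pre
  refine Complex.contDiff_exp.comp (ContDiff.sum fun i _ => ?_)
  have hi : ContDiff ℝ ∞ (fun w : Fin d → ℂ => w i) := contDiff_apply ℝ ℂ i
  have hc : ContDiff ℝ ∞ (fun w : Fin d → ℂ => conj (w i)) := Complex.conjCLE.contDiff.comp hi
  refine ((contDiff_const.mul hi).add ?_).add ?_
  · split_ifs
    · exact hi
    · exact contDiff_const
  · split_ifs
    · exact hc
    · exact contDiff_const

lemma norm_pre (I K : Finset (Fin d)) (w : Fin d → ℂ) :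
    ‖pre θ I K w‖ = Real.exp (∑ i, (θ i / (2 * Real.pi) + (if i ∈ I then 1 else 0) +
      (if i ∈ K then 1 else 0)) * (w i).re) := by
  rw [pre, Complex.norm_exp, Complex.re_sum]
  congr 1
  refine Finset.sum_congr rfl fun i _ => ?_
  rw [Complex.add_re, Complex.add_re, Complex.re_ofReal_mul]
  split_ifs <;> simp <;> ring

lemma pre_insert_right {I K : Finset (Fin d)} {j : Fin d} (hj : j ∈ K) (w : Fin d → ℂ) :
    pre θ I K w = pre θ I (K.erase j) w * conj (Complex.exp (w j)) := by
  rw [pre, pre, ← Complex.exp_conj, ← Complex.exp_add]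
  congr 1
  have : conj (w j) = ∑ i, (if i = j then conj (w i) else 0) := by simp
  rw [this, ← Finset.sum_add_distrib]
  refine Finset.sum_congr rfl fun i _ => ?_
  by_cases h : i = j
  · subst h; simp [hj]
  · simp [h]

lemma pre_insert_left {I K : Finset (Fin d)} {j : Fin d} (hj : j ∈ I) (w : Fin d → ℂ) :
    pre θ I K w = pre θ (I.erase j) K w * Complex.exp (w j) := by
  rw [pre, pre, ← Complex.exp_add]
  congr 1
  have : w j = ∑ i, (if i = j then w i else 0) := by simp
  conv_rhs => rw [this]
  rw [← Finset.sum_add_distrib]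
  refine Finset.sum_congr rfl fun i _ => ?_
  by_cases h : i = j
  · subst h; simp [hj]; ring
  · simp [h]

lemma pd_pre (I K : Finset (Fin d)) (w : Fin d → ℂ) (j : Fin d) (v : ℂ) :
    pd j v (pre θ I K) w = v * ((((θ j / (2 * Real.pi) : ℝ) : ℂ) + if j ∈ I then 1 else 0) * pre θ I K w) +
      conj v * ((if j ∈ K then 1 else 0) * pre θ I K w) := by
  set L : (Fin d → ℂ) → ℂ := fun w => ∑ i, (((θ i / (2 * Real.pi) : ℝ) : ℂ) * w i +
    (if i ∈ I then w i else 0) + (if i ∈ K then conj (w i) else 0)) with hL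
  have hadd : ∀ x y, L (x + y) = L x + L y := fun x y => by
    simp only [hL, ← Finset.sum_add_distrib]
    refine Finset.sum_congr rfl fun i _ => ?_
    split_ifs <;> simp <;> ring
  have hsm : ∀ (r : ℝ) x, L (r • x) = r • L x := fun r x => by
    simp only [hL, Finset.smul_sum]
    refine Finset.sum_congr rfl fun i _ => ?_
    split_ifs <;> simp <;> ring
  let L' : (Fin d → ℂ) →ₗ[ℝ] ℂ := ⟨⟨L, hadd⟩, hsm⟩
  have hD : HasFDerivAt L (LinearMap.toContinuousLinearMap L') w :=
    (LinearMap.toContinuousLinearMap L').hasFDerivAt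
  have h := (Complex.hasDerivAt_exp (L w)).complexToReal_fderiv.comp w hD
  rw [pd, show fderiv ℝ (pre θ I K) w = _ from h.fderiv]
  have h1 : L (Pi.single j v) = ((θ j / (2 * Real.pi) : ℝ) : ℂ) * v +
    (if j ∈ I then v else 0) + (if j ∈ K then conj v else 0) := by
    simp only [hL]
    rw [Finset.sum_eq_single j]
    · simp
    · intro i _ hi; simp [hi]
    · simp
  have h2 : (LinearMap.toContinuousLinearMap L') (Pi.single j v) = L (Pi.single j v) := rfl
  have h3 : Complex.exp (L w) = pre θ I K w := rfl
  simp only [ContinuousLinearMap.comp_apply, smul_apply, one_apply_eq_self, h2, h1, h3, smul_eq_mul]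
  split_ifs <;> ring

/-- Derivatives of coefficients in logarithmic coordinates. -/
lemma delZ_pre_mul {g : (Fin d → ℂ) → ℂ} {c w : Fin d → ℂ}
    (hg : DifferentiableAt ℝ g (expShift c w)) (I K : Finset (Fin d)) (j : Fin d) :
    delZ j (fun w => pre θ I K w * g (expShift c w)) w =
      pre θ I K w * (Complex.exp (w j) * delZ j g (expShift c w) +
        (((θ j / (2 * Real.pi) : ℝ) : ℂ) + if j ∈ I then 1 else 0) * g (expShift c w)) ∧
    delZbar j (fun w => pre θ I K w * g (expShift c w)) w =
      pre θ I K w * (conj (Complex.exp (w j)) * delZbar j g (expShift c w) +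
        (if j ∈ K then 1 else 0) * g (expShift c w)) := by
  refine delZ_of_pd fun v => ?_
  have h1 : DifferentiableAt ℝ (pre θ I K) w := (contDiff_pre I K).differentiable (by simp) w
  have h2 : DifferentiableAt ℝ (fun w => g (expShift c w)) w :=
    hg.comp w ((contDiff_expShift c).differentiable (by simp) w)
  have : pd j v (fun w => pre θ I K w * g (expShift c w)) w =
      pre θ I K w * pd j v (fun w => g (expShift c w)) w +
        g (expShift c w) * pd j v (pre θ I K) w := by
    rw [pd, fderiv_fun_mul h1 h2]; rfl
  rw [this, pd_comp_expShift hg, pd_pre]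
  ring

/-- The factor e^{conj w_j} gained from dz̄_j = e^{conj w_j} dw̄_j matches the chain rule. No
derivative of `pre` enters, since the coefficient being differentiated has j removed from K. -/
theorem dbar_pre_mul {F : Form d ℂ} {c w : Fin d → ℂ}
    (hF : ∀ I K, DifferentiableAt ℝ (F I K) (expShift c w)) (I K : Finset (Fin d)) :
    dbar (fun I K w => pre θ I K w * F I K (expShift c w)) I K w =
      pre θ I K w * dbar F I K (expShift c w) := by
  rw [dbar_eq, dbar_eq, Finset.mul_sum]
  refine Finset.sum_congr rfl fun j hj => ?_
  rw [(delZ_pre_mul (hF I (K.erase j)) I (K.erase j) j).2, pre_insert_right hj]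
  simp
  ring

/-- Differentiating e^{θ_j w_j/2π} supplies the connection term θ_j/2π · dz_j/z_j, so d' becomes
untwisted. This needs z_j = e^{w_j} where θ_j ≠ 0; where θ_j = 0 there is no connection term and the
shift is free. -/
theorem del_pre_mul {F : Form d ℂ} {c w : Fin d → ℂ} (hc : ∀ i, θ i ≠ 0 → c i = 0)
    (hF : ∀ I K, DifferentiableAt ℝ (F I K) (expShift c w)) (I K : Finset (Fin d)) :
    del (fun I K w => pre θ I K w * F I K (expShift c w)) I K w =
      pre θ I K w * twistedDel θ F I K (expShift c w) := by
  rw [del, twistedDel, Finset.mul_sum]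
  refine Finset.sum_congr rfl fun j hj => ?_
  rw [(delZ_pre_mul (hF (I.erase j) K) (I.erase j) K j).1, pre_insert_left hj]
  by_cases h : θ j = 0
  · simp [h]; ring
  · have h1 : expShift c w j = Complex.exp (w j) := by rw [expShift, hc j h, sub_zero]
    have h2 := Complex.exp_ne_zero (w j)
    rw [h1]
    simp
    field_simp

/-! ### Cutting off -/

/-- The points where all coordinates with non-trivial monodromy are non-zero. -/
def regularSet (θ : Fin d → ℝ) : Set (Fin d → ℂ) := {z | ∀ i, θ i ≠ 0 → z i ≠ 0}

lemma isOpen_regularSet (θ : Fin d → ℝ) : IsOpen (regularSet θ) := by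
  have : regularSet θ = ⋂ i, {z : Fin d → ℂ | θ i ≠ 0 → z i ≠ 0} := by
    ext z; simp [regularSet]
  rw [this]
  refine isOpen_iInter_of_finite fun i => ?_
  by_cases h : θ i = 0
  · simp [h]
  · simp only [ne_eq, h, not_false_eq_true, forall_const]
    exact isOpen_ne.preimage (continuous_apply i)

lemma isOpen_openPolydisc (c : Fin d → ℂ) (R : Fin d → ℝ) : IsOpen (openPolydisc c R) := by
  have : openPolydisc c R = ⋂ i, {z : Fin d → ℂ | ‖z i - c i‖ < R i} := by
    ext z; simp [openPolydisc]
  rw [this]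
  exact isOpen_iInter_of_finite fun i => isOpen_lt (by fun_prop) continuous_const

lemma closedPolydisc_eq_pi (c : Fin d → ℂ) (R : Fin d → ℝ) :
    closedPolydisc c R = univ.pi fun i => Metric.closedBall (c i) (R i) := by
  ext z; simp [closedPolydisc, dist_eq_norm]

lemma isCompact_closedPolydisc (c : Fin d → ℂ) (R : Fin d → ℝ) : IsCompact (closedPolydisc c R) := by
  rw [closedPolydisc_eq_pi]
  exact isCompact_univ_pi fun i => isCompact_closedBall _ _

lemma exists_polydisc_cutoff (c : Fin d → ℂ) {r r' : Fin d → ℝ} (h0 : ∀ i, 0 < r i)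
    (h : ∀ i, r i < r' i) : ∃ χ : (Fin d → ℂ) → ℂ, ContDiff ℝ ∞ χ ∧ HasCompactSupport χ ∧
      (∀ z ∈ openPolydisc c r, χ =ᶠ[𝓝 z] fun _ => 1) ∧ ∀ z ∉ closedPolydisc c r', χ =ᶠ[𝓝 z] fun _ => 0 := by
  let f : ∀ i, ContDiffBump (c i) := fun i => ⟨r i, r' i, h0 i, h i⟩
  set χ : (Fin d → ℂ) → ℂ := fun z => ∏ i, (f i (z i) : ℂ) with hχ
  have h1 : ∀ z ∈ openPolydisc c r, χ z = 1 := fun z hz => by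
    refine Finset.prod_eq_one fun i _ => ?_
    rw [(f i).one_of_mem_closedBall]
    · simp
    · rw [mem_closedBall_iff_norm]; exact (hz i).le
  have h2 : ∀ z ∉ closedPolydisc c r', χ z = 0 := fun z hz => by
    simp only [closedPolydisc, mem_ofPred_eq, not_forall, not_le] at hz
    obtain ⟨i, hi⟩ := hz
    refine Finset.prod_eq_zero (Finset.mem_univ i) ?_
    rw [(f i).zero_of_le_dist]
    · simp
    · rw [dist_eq_norm]; exact hi.le
  refine ⟨χ, ?_, HasCompactSupport.intro (isCompact_closedPolydisc c r') h2, fun z hz => ?_,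
    fun z hz => ?_⟩
  · exact contDiff_prod fun i _ => Complex.ofRealCLM.contDiff.comp
      ((f i).contDiff.comp (contDiff_apply ℝ ℂ i))
  · filter_upwards [(isOpen_openPolydisc c r).mem_nhds hz] with y hy using h1 y hy
  · filter_upwards [(isCompact_closedPolydisc c r').isClosed.isOpen_compl.mem_nhds hz] with y hy
      using h2 y hy

end Coordinates

/-! ### Condition C in terms of the weight, and descent along the exponential. -/

section RankOne

open MeasureTheory Filter Topology ComplexConjugate

variable {d : ℕ} {p q : ℕ} {θ : Fin d → ℝ}

lemma exists_small_exponent (hθ : ∀ i, θ i ∈ Ico 0 (2 * Real.pi)) {m : ℝ} (hm : 0 < m) :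
    ∃ e > 0, e ≤ m ∧ ∀ i, θ i ≠ 0 → e < θ i / (2 * Real.pi) := by
  have h1 : ∀ᶠ e : ℝ in 𝓝[>] 0, ∀ i, θ i ≠ 0 → e < θ i / (2 * Real.pi) := by
    rw [eventually_all]
    intro i
    by_cases h : θ i = 0
    · simp [h]
    · have : 0 < θ i / (2 * Real.pi) :=
        div_pos (lt_of_le_of_ne (hθ i).1 (Ne.symm h)) Real.two_pi_pos
      filter_upwards [Ioo_mem_nhdsGT this] with e he _ using he.2
  obtain ⟨e, he, he1⟩ := (h1.and (Ioo_mem_nhdsGT hm)).exists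
  exact ⟨e, he1.1, he1.2.le, he⟩

/-- The shift of coordinates moving the polydisc off `z_i = 0` where the monodromy is trivial. -/
def shift (θ : Fin d → ℝ) (z₀ : Fin d → ℂ) (r : Fin d → ℝ) (i : Fin d) : ℂ :=
  if θ i = 0 then -z₀ i + r i else 0

lemma shift_of_ne (z₀ : Fin d → ℂ) (r : Fin d → ℝ) (i : Fin d) (h : θ i ≠ 0) :
    shift θ z₀ r i = 0 := if_neg h

lemma expShift_mem_regularSet {c : Fin d → ℂ} (hc : ∀ i, θ i ≠ 0 → c i = 0) (w : Fin d → ℂ) :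
    expShift c w ∈ regularSet θ := by
  intro i hi
  rw [expShift, hc i hi, sub_zero]
  exact Complex.exp_ne_zero _

lemma mem_logRegion_iff (z₀ c : Fin d → ℂ) (ρ : Fin d → ℝ) (w : Fin d → ℂ) :
    w ∈ logRegion (fun i => z₀ i + c i) ρ ↔ expShift c w ∈ openPolydisc z₀ ρ := by
  have : ∀ i, Complex.exp (w i) - (z₀ i + c i) = Complex.exp (w i) - c i - z₀ i := fun i => by ring
  simp only [logRegion, openPolydisc, mem_ofPred_eq, expShift, this]

/-- The exponents of the weight in logarithmic coordinates. -/
def logExponent (θ : Fin d → ℝ) (e : ℝ) (i : Fin d) : ℝ := if θ i = 0 then -(1 / 2) else e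

lemma norm_expShift {c : Fin d → ℂ} (hc : ∀ i, θ i ≠ 0 → c i = 0) (w : Fin d → ℂ) {i : Fin d}
    (hi : θ i ≠ 0) : ‖expShift c w i‖ = Real.exp (w i).re := by
  rw [expShift, hc i hi, sub_zero, Complex.norm_exp]

lemma prod_norm_rpow {c : Fin d → ℂ} (hc : ∀ i, θ i ≠ 0 → c i = 0) (w : Fin d → ℂ) :
    ∏ i, ‖expShift c w i‖ ^ (θ i / (2 * Real.pi)) =
      Real.exp (∑ i, θ i / (2 * Real.pi) * (w i).re) := by
  rw [Real.exp_sum]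
  refine Finset.prod_congr rfl fun i _ => ?_
  by_cases h : θ i = 0
  · simp [h]
  · rw [norm_expShift hc w h, ← Real.exp_mul, mul_comm]

lemma prod_filter_norm_rpow {c : Fin d → ℂ} (hc : ∀ i, θ i ≠ 0 → c i = 0) (w : Fin d → ℂ)
    (s : Fin d → ℝ) : ∏ i with θ i ≠ 0, ‖expShift c w i‖ ^ s i =
      Real.exp (∑ i, (if θ i = 0 then 0 else s i) * (w i).re) := by
  rw [Real.exp_sum, Finset.prod_filter]
  refine Finset.prod_congr rfl fun i _ => ?_
  by_cases h : θ i = 0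
  · simp [h]
  · rw [if_pos h, if_neg h, norm_expShift hc w h, ← Real.exp_mul, mul_comm]

lemma ite_one_zero_mem (P : Prop) [Decidable P] : (0 : ℝ) ≤ (if P then 1 else 0) ∧
    (if P then 1 else 0) ≤ (1 : ℝ) := by split_ifs <;> norm_num

/-- If θ_i ≠ 0, the modulus of `pre` contributes |z_i|^{θ_i/2π} and cancels the exponents -δ_i -
σ_i, leaving e^{ε Re w_i}; lowering ε to e costs a constant because Re w_i ≤ B. If θ_i = 0, that
same upper bound lets the weight e^{-Re w_i/2} be inserted. -/
lemma norm_pre_mul_le {c : Fin d → ℂ} (hc : ∀ i, θ i ≠ 0 → c i = 0) {w : Fin d → ℂ} {x : ℂ}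
    {I K : Finset (Fin d)} {ε e C B : ℝ} (he : 0 < e) (heε : e ≤ ε) (hB : 0 ≤ B)
    (hw : ∀ i, (w i).re ≤ B)
    (hx : (∏ i, ‖expShift c w i‖ ^ (θ i / (2 * Real.pi))) * ‖x‖ ≤
      C * ∏ i with θ i ≠ 0, ‖expShift c w i‖ ^ (ε - (if i ∈ I then 1 else 0) - (if i ∈ K then 1 else 0))) :
    ‖pre θ I K w * x‖ ≤ (|C| * Real.exp (∑ _i : Fin d, (ε + 3) * B)) * wt (logExponent θ e) w := by
  rw [prod_norm_rpow hc, prod_filter_norm_rpow hc] at hx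
  set S1 := ∑ i, θ i / (2 * Real.pi) * (w i).re with hS1
  set S2 := ∑ i, (if θ i = 0 then 0 else
    ε - (if i ∈ I then 1 else 0) - (if i ∈ K then 1 else 0)) * (w i).re with hS2
  set S3 := ∑ i, ((if i ∈ I then 1 else 0) + (if i ∈ K then 1 else 0)) * (w i).re with hS3
  have hpre : ‖pre θ I K w‖ = Real.exp S1 * Real.exp S3 := by
    have h : S1 + S3 = ∑ i, (θ i / (2 * Real.pi) + (if i ∈ I then 1 else 0) +
        (if i ∈ K then 1 else 0)) * (w i).re := by
      rw [hS1, hS3, ← Finset.sum_add_distrib]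
      exact Finset.sum_congr rfl fun i _ => by ring
    rw [norm_pre, ← Real.exp_add, h]
  rw [norm_mul, hpre, wt, mul_assoc |C|]
  calc Real.exp S1 * Real.exp S3 * ‖x‖ = Real.exp S3 * (Real.exp S1 * ‖x‖) := by ring
    _ ≤ Real.exp S3 * (C * Real.exp S2) := by gcongr
    _ ≤ Real.exp S3 * (|C| * Real.exp S2) := by gcongr; exact le_abs_self C
    _ = |C| * Real.exp (S3 + S2) := by rw [Real.exp_add]; ring
    _ ≤ _ := by
      rw [← Real.exp_add]
      refine mul_le_mul_of_nonneg_left (Real.exp_le_exp.mpr ?_) (abs_nonneg C)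
      rw [hS2, hS3, ← Finset.sum_add_distrib, ← Finset.sum_add_distrib]
      refine Finset.sum_le_sum fun i _ => ?_
      obtain ⟨h1, h2⟩ := ite_one_zero_mem (i ∈ I)
      obtain ⟨h3, h4⟩ := ite_one_zero_mem (i ∈ K)
      have h5 := hw i
      set u : ℝ := if i ∈ I then 1 else 0
      set v : ℝ := if i ∈ K then 1 else 0
      rw [logExponent]
      split_ifs with h
      · nlinarith [mul_nonneg (add_nonneg h1 h3) (sub_nonneg.mpr h5)]
      · nlinarith [mul_nonneg (sub_nonneg.mpr heε) (sub_nonneg.mpr h5)]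

/-- The converse passage. The target product does not see the directions with θ_i = 0, so there
e^{-Re w_i/2} and the factors from dz_i, dz̄_i must be bounded, which takes a lower bound on Re w_i.
-/
lemma norm_le_of_pre_mul_le {c : Fin d → ℂ} (hc : ∀ i, θ i ≠ 0 → c i = 0) {w : Fin d → ℂ} {x : ℂ}
    {I K : Finset (Fin d)} {e C B : ℝ} (hB : 0 ≤ B) (hw : ∀ i, θ i = 0 → -B ≤ (w i).re)
    (hC : 0 ≤ C) (hx : ‖pre θ I K w * x‖ ≤ C * wt (logExponent θ e) w) :
    (∏ i, ‖expShift c w i‖ ^ (θ i / (2 * Real.pi))) * ‖x‖ ≤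
      (C * Real.exp (∑ _i : Fin d, 3 * B)) * ∏ i with θ i ≠ 0,
        ‖expShift c w i‖ ^ (e - (if i ∈ I then 1 else 0) - (if i ∈ K then 1 else 0)) := by
  rw [prod_norm_rpow hc, prod_filter_norm_rpow hc]
  set S1 := ∑ i, θ i / (2 * Real.pi) * (w i).re with hS1
  set S2 := ∑ i, (if θ i = 0 then 0 else
    e - (if i ∈ I then 1 else 0) - (if i ∈ K then 1 else 0)) * (w i).re with hS2
  set S3 := ∑ i, ((if i ∈ I then 1 else 0) + (if i ∈ K then 1 else 0)) * (w i).re with hS3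
  have hpre : ‖pre θ I K w‖ = Real.exp S1 * Real.exp S3 := by
    have h : S1 + S3 = ∑ i, (θ i / (2 * Real.pi) + (if i ∈ I then 1 else 0) +
        (if i ∈ K then 1 else 0)) * (w i).re := by
      rw [hS1, hS3, ← Finset.sum_add_distrib]
      exact Finset.sum_congr rfl fun i _ => by ring
    rw [norm_pre, ← Real.exp_add, h]
  rw [norm_mul, hpre, wt] at hx
  set S4 := ∑ i, logExponent θ e i * (w i).re with hS4
  calc Real.exp S1 * ‖x‖ = Real.exp (-S3) * (Real.exp S1 * Real.exp S3 * ‖x‖) := by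
        rw [Real.exp_neg]; field_simp
    _ ≤ Real.exp (-S3) * (C * Real.exp S4) := by gcongr
    _ = C * Real.exp (-S3 + S4) := by rw [Real.exp_add]; ring
    _ ≤ C * Real.exp ((∑ _i : Fin d, 3 * B) + S2) := by
      refine mul_le_mul_of_nonneg_left (Real.exp_le_exp.mpr ?_) hC
      rw [hS2, hS3, hS4, ← Finset.sum_neg_distrib, ← Finset.sum_add_distrib, ← Finset.sum_add_distrib]
      refine Finset.sum_le_sum fun i _ => ?_
      obtain ⟨h1, h2⟩ := ite_one_zero_mem (i ∈ I)
      obtain ⟨h3, h4⟩ := ite_one_zero_mem (i ∈ K)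
      set u : ℝ := if i ∈ I then 1 else 0
      set v : ℝ := if i ∈ K then 1 else 0
      rw [logExponent]
      split_ifs with h
      · have h5 := hw i h
        nlinarith [mul_nonneg (add_nonneg h1 h3) (by linarith : 0 ≤ (w i).re + B)]
      · nlinarith
    _ = _ := by rw [Real.exp_add]; ring

lemma eq_of_periodic {g : (Fin d → ℂ) → ℂ}
    (hg : ∀ j w, g (w + Pi.single j (2 * Real.pi * Complex.I)) = g w) {w w' : Fin d → ℂ}
    (h : ∀ i, Complex.exp (w i) = Complex.exp (w' i)) : g w = g w' := by
  choose n hn using fun i => Complex.exp_eq_exp_iff_exists_int.mp (h i)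
  have hper : ∀ s : Finset (Fin d), Function.Periodic g
      (∑ i ∈ s, n i • (Pi.single i (2 * Real.pi * Complex.I) : Fin d → ℂ)) := by
    intro s
    induction s using Finset.induction_on with
    | empty => intro w; simp
    | insert i s hi ih =>
      rw [Finset.sum_insert hi]
      have h1 : Function.Periodic g (Pi.single i (2 * Real.pi * Complex.I) : Fin d → ℂ) := hg i
      exact (h1.zsmul (n i)).add_period ih
  have : w = w' + ∑ i, n i • (Pi.single i (2 * Real.pi * Complex.I) : Fin d → ℂ) := by
    funext j
    rw [Pi.add_apply, Finset.sum_apply, Finset.sum_eq_single j]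
    · rw [hn j]; simp
    · intro i _ hi; simp [Ne.symm hi]
    · simp
  rw [this]
  exact hper Finset.univ w'

/-- A logarithm in each coordinate. -/
def logShift (c : Fin d → ℂ) (z : Fin d → ℂ) : Fin d → ℂ := fun i => Complex.log (z i + c i)

lemma exp_logShift {c z : Fin d → ℂ} {i : Fin d} (h : z i + c i ≠ 0) :
    Complex.exp (logShift c z i) = z i + c i := Complex.exp_log h

lemma expShift_logShift {c z : Fin d → ℂ} (h : ∀ i, z i + c i ≠ 0) : expShift c (logShift c z) = z := by
  funext i
  rw [expShift, exp_logShift (h i)]; ring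

lemma contDiffAt_comp_logShift {g : (Fin d → ℂ) → ℂ} (hs : ContDiff ℝ ∞ g)
    (hg : ∀ j w, g (w + Pi.single j (2 * Real.pi * Complex.I)) = g w) {c z : Fin d → ℂ}
    (hz : ∀ i, z i + c i ≠ 0) : ContDiffAt ℝ ∞ (fun z => g (logShift c z)) z := by
  -- The principal logarithm may jump at z. By periodicity it can be replaced near z by this smooth
  -- branch, as the quotient is close to 1.
  set L : (Fin d → ℂ) → (Fin d → ℂ) := fun y i =>
    Complex.log ((y i + c i) / (z i + c i)) + Complex.log (z i + c i) with hL
  have h1 : (fun y => g (logShift c y)) =ᶠ[𝓝 z] fun y => g (L y) := by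
    have : ∀ᶠ y in 𝓝 z, ∀ i, y i + c i ≠ 0 := by
      rw [eventually_all]
      intro i
      exact ((continuous_apply i).add continuous_const).continuousAt.eventually_ne (hz i)
    filter_upwards [this] with y hy
    refine eq_of_periodic hg fun i => ?_
    rw [exp_logShift (hy i), hL]
    simp only
    rw [Complex.exp_add, Complex.exp_log (div_ne_zero (hy i) (hz i)), Complex.exp_log (hz i)]
    field_simp [hz i]
  refine ContDiffAt.congr_of_eventuallyEq ?_ h1
  refine hs.contDiffAt.comp z (contDiffAt_pi.mpr fun i => ?_)
  have h2 : ContDiffAt ℝ ∞ (fun y : Fin d → ℂ => (y i + c i) / (z i + c i)) z :=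
    (((contDiff_apply ℝ ℂ i).add contDiff_const).div_const _).contDiffAt
  have h3 : ContDiffAt ℝ ∞ Complex.log ((z i + c i) / (z i + c i)) := by
    rw [div_self (hz i)]
    exact (Complex.contDiffAt_log (n := ∞) (by simp)).restrict_scalars ℝ
  exact (h3.comp z h2).add contDiffAt_const

lemma delZ_congr {V : Type*} [NormedAddCommGroup V] [NormedSpace ℂ V] {f g : (Fin d → ℂ) → V}
    {z : Fin d → ℂ} (h : f =ᶠ[𝓝 z] g) (j : Fin d) : delZ j f z = delZ j g z := by
  rw [delZ, delZ, h.fderiv_eq]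

lemma delZbar_congr {V : Type*} [NormedAddCommGroup V] [NormedSpace ℂ V] {f g : (Fin d → ℂ) → V}
    {z : Fin d → ℂ} (h : f =ᶠ[𝓝 z] g) (j : Fin d) : delZbar j f z = delZbar j g z := by
  rw [delZbar, delZbar, h.fderiv_eq]

lemma dbar_congr {V : Type*} [NormedAddCommGroup V] [NormedSpace ℂ V] {F G : Form d V}
    {z : Fin d → ℂ} (h : ∀ I K, F I K =ᶠ[𝓝 z] G I K) (I K : Finset (Fin d)) :
    dbar F I K z = dbar G I K z :=
  Finset.sum_congr rfl fun j _ => by rw [delZbar_congr (h _ _)]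

lemma twistedDel_congr {F G : Form d ℂ} {z : Fin d → ℂ} (h : ∀ I K, F I K =ᶠ[𝓝 z] G I K)
    (I K : Finset (Fin d)) : twistedDel θ F I K z = twistedDel θ G I K z :=
  Finset.sum_congr rfl fun j _ => by rw [delZ_congr (h _ _), (h _ _).eq_of_nhds]

lemma delZ_mul_at {f g : (Fin d → ℂ) → ℂ} {z : Fin d → ℂ} (hf : DifferentiableAt ℝ f z)
    (hg : DifferentiableAt ℝ g z) (j : Fin d) :
    delZ j (fun z => f z * g z) z = delZ j f z * g z + f z * delZ j g z := by
  rw [delZ, delZ, delZ, fderiv_fun_mul hf hg]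
  simp; ring

lemma twistedDel_mul {χ : (Fin d → ℂ) → ℂ} {F : Form d ℂ} {z : Fin d → ℂ}
    (hχ : DifferentiableAt ℝ χ z) (hF : ∀ I K, DifferentiableAt ℝ (F I K) z) (I K : Finset (Fin d)) :
    twistedDel θ (fun I K z => χ z * F I K z) I K z = χ z * twistedDel θ F I K z +
      ∑ j ∈ I, (-1 : ℂ) ^ (I.filter (· < j)).card * (delZ j χ z * F (I.erase j) K z) := by
  rw [twistedDel, twistedDel, Finset.mul_sum, ← Finset.sum_add_distrib]
  refine Finset.sum_congr rfl fun j _ => ?_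
  rw [delZ_mul_at hχ (hF _ _)]
  ring

lemma ConditionC.mono {P P' : Set (Fin d → ℂ)} (hP : P' ⊆ P) {F : Form d ℂ}
    (h : ConditionC p q θ P F) : ConditionC p q θ P' F :=
  ⟨fun I K => (h.1 I K).mono (inter_subset_inter_left _ hP), fun A hA => h.2 A (hA.trans hP)⟩

lemma ConditionC.congr {P : Set (Fin d → ℂ)} {F G : Form d ℂ} (h : ConditionC p q θ P F)
    (hFG : ∀ I K, ∀ z ∈ P, z ∈ regularSet θ → G I K z = F I K z) : ConditionC p q θ P G := by
  refine ⟨fun I K => (h.1 I K).congr fun z hz => hFG I K z hz.1 hz.2, fun A hA hc => ?_⟩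
  obtain ⟨ε, hε, C, hC⟩ := h.2 A hA hc
  exact ⟨ε, hε, C, fun I K z hz hr => by rw [hFG I K z (hA hz) hr]; exact hC I K z hz hr⟩

lemma expShift_add_period (c w : Fin d → ℂ) (j : Fin d) :
    expShift c (w + Pi.single j (2 * Real.pi * Complex.I)) = expShift c w := by
  funext k
  have := cutFun_add_period (i := k) (fun z => z - c k) w j
  simp only [cutFun] at this
  exact this

lemma pre_add_period (I K : Finset (Fin d)) (w : Fin d → ℂ) (j : Fin d) :
    pre θ I K (w + Pi.single j (2 * Real.pi * Complex.I)) =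
      Complex.exp (2 * Real.pi * Complex.I * (θ j / (2 * Real.pi) : ℝ)) * pre θ I K w := by
  rw [pre, pre, ← Complex.exp_add, Complex.exp_eq_exp_iff_exists_int]
  -- The factors e^{w_j} of dz_j and e^{conj w_j} of dz̄_j each make one full turn, in opposite
  -- directions.
  refine ⟨(if j ∈ I then 1 else 0) - (if j ∈ K then 1 else 0), ?_⟩
  have h : ∀ i, (((θ i / (2 * Real.pi) : ℝ) : ℂ) * (w + Pi.single j (2 * Real.pi * Complex.I) : Fin d → ℂ) i +
      (if i ∈ I then (w + Pi.single j (2 * Real.pi * Complex.I) : Fin d → ℂ) i else 0) +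
      (if i ∈ K then conj ((w + Pi.single j (2 * Real.pi * Complex.I) : Fin d → ℂ) i) else 0)) =
      (((θ i / (2 * Real.pi) : ℝ) : ℂ) * w i + (if i ∈ I then w i else 0) +
      (if i ∈ K then conj (w i) else 0)) + if i = j then 2 * Real.pi * Complex.I *
        ((θ j / (2 * Real.pi) : ℝ) + (if j ∈ I then 1 else 0) - (if j ∈ K then 1 else 0)) else 0 := by
    intro i
    by_cases hi : i = j
    · subst hi
      simp only [Pi.add_apply, Pi.single_eq_same, map_add, map_mul, Complex.conj_I, Complex.conj_ofReal,
        map_ofNat, if_true]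
      split_ifs <;> ring
    · simp [hi]
  rw [Finset.sum_congr rfl fun i _ => h i, Finset.sum_add_distrib, Finset.sum_ite_eq' Finset.univ j]
  simp only [Finset.mem_univ, if_true]
  split_ifs <;> push_cast <;> ring

/-- A section of rank one, cut off and expressed in logarithmic coordinates. -/
lemma logForm_of_section {P A : Set (Fin d → ℂ)} (hP : IsOpen P) (hAP : A ⊆ P)
    {c : Fin d → ℂ} (hc : ∀ i, θ i ≠ 0 → c i = 0) {F : Form d ℂ} (hF : IsRankOneSection p q θ P F)
    {χ : (Fin d → ℂ) → ℂ} (hχ : ContDiff ℝ ∞ χ) (hχs : HasCompactSupport χ)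
    (hχA : ∀ z ∉ A, χ =ᶠ[𝓝 z] fun _ => 0) {ε₁ ε₂ e C₁ C₂ B : ℝ} (he : 0 < e) (heε₁ : e ≤ ε₁) (heε₂ : e ≤ ε₂)
    (hB : 0 ≤ B) (hw : ∀ w, expShift c w ∈ A → ∀ i, (w i).re ≤ B)
    (hF0 : ∀ I K, ∀ z ∈ A, z ∈ regularSet θ → (∏ i, ‖z i‖ ^ (θ i / (2 * Real.pi))) * ‖F I K z‖ ≤
      C₁ * ∏ i with θ i ≠ 0, ‖z i‖ ^ (ε₁ - (if i ∈ I then 1 else 0) - (if i ∈ K then 1 else 0)))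
    (hF1 : ∀ I K, ∀ z ∈ A, z ∈ regularSet θ →
      (∏ i, ‖z i‖ ^ (θ i / (2 * Real.pi))) * ‖twistedDel θ F I K z‖ ≤
      C₂ * ∏ i with θ i ≠ 0, ‖z i‖ ^ (ε₂ - (if i ∈ I then 1 else 0) - (if i ∈ K then 1 else 0))) :
    LogForm p q (fun i => θ i / (2 * Real.pi)) (logExponent θ e)
      (fun I K w => pre θ I K w * (χ (expShift c w) * F I K (expShift c w))) ∧
    ∀ I K z, z ∈ regularSet θ → DifferentiableAt ℝ (fun z => χ z * F I K z) z := by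
  have hreg : ∀ z ∈ P, z ∈ regularSet θ → ∀ I K, ContDiffAt ℝ ∞ (F I K) z := fun z hz hr I K =>
    (hF.2.1.1 I K).contDiffAt ((hP.inter (isOpen_regularSet θ)).mem_nhds ⟨hz, hr⟩)
  have hcut : ∀ I K z, z ∉ A → (fun z => χ z * F I K z) =ᶠ[𝓝 z] fun _ => 0 := fun I K z hz => by
    filter_upwards [hχA z hz] with y hy
    simp [hy]
  have hsm : ∀ I K z, z ∈ regularSet θ → ContDiffAt ℝ ∞ (fun z => χ z * F I K z) z := by
    intro I K z hz
    by_cases hzA : z ∈ A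
    · exact hχ.contDiffAt.mul (hreg z (hAP hzA) hz I K)
    · exact contDiffAt_const.congr_of_eventuallyEq (hcut I K z hzA)
  have hdiff : ∀ I K z, z ∈ regularSet θ → DifferentiableAt ℝ (fun z => χ z * F I K z) z :=
    fun I K z hz => (hsm I K z hz).differentiableAt (by simp)
  refine ⟨?_, hdiff⟩
  set D := max (|C₁| * Real.exp (∑ _i : Fin d, (ε₁ + 3) * B))
    (|C₂| * Real.exp (∑ _i : Fin d, (ε₂ + 3) * B)) with hD
  have hb0 : ∀ I K w, expShift c w ∈ A →
      ‖pre θ I K w * F I K (expShift c w)‖ ≤ D * wt (logExponent θ e) w := fun I K w hwA =>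
    (norm_pre_mul_le hc he heε₁ hB (hw w hwA) (hF0 I K _ hwA (expShift_mem_regularSet hc w))).trans
      (mul_le_mul_of_nonneg_right (le_max_left _ _) (wt_pos _ w).le)
  have hb1 : ∀ I K w, expShift c w ∈ A →
      ‖pre θ I K w * twistedDel θ F I K (expShift c w)‖ ≤ D * wt (logExponent θ e) w := fun I K w hwA =>
    (norm_pre_mul_le hc he heε₂ hB (hw w hwA) (hF1 I K _ hwA (expShift_mem_regularSet hc w))).trans
      (mul_le_mul_of_nonneg_right (le_max_right _ _) (wt_pos _ w).le)
  have hD0 : 0 ≤ D := le_max_of_le_left (by positivity)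
  obtain ⟨M, hM⟩ := hχs.exists_bound_of_continuous hχ.continuous
  have hM0 : 0 ≤ M := (norm_nonneg _).trans (hM 0)
  have hwt := fun w : Fin d → ℂ => (wt_pos (logExponent θ e) w).le
  constructor
  · intro I K
    rw [contDiff_iff_contDiffAt]
    intro w
    exact (contDiff_pre I K).contDiffAt.mul
      ((hsm I K _ (expShift_mem_regularSet hc w)).comp w (contDiff_expShift c).contDiffAt)
  · intro I K h
    funext w
    simp [hF.1 I K h]
  · intro I K
    refine ⟨M * D, fun w => ?_⟩
    by_cases hwA : expShift c w ∈ A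
    · calc _ = ‖χ (expShift c w)‖ * ‖pre θ I K w * F I K (expShift c w)‖ := by
            rw [← norm_mul]; congr 1; ring
        _ ≤ M * (D * wt (logExponent θ e) w) := by
            gcongr
            · exact hM _
            · exact hb0 I K w hwA
        _ = _ := by ring
    · have : χ (expShift c w) = 0 := (hχA _ hwA).eq_of_nhds
      rw [this]
      simpa using mul_nonneg (mul_nonneg hM0 hD0) (hwt w)
  · intro I K
    have hdχ : ∀ j, ∃ N, ∀ z, ‖delZ j χ z‖ ≤ N := fun j => by
      have h1 : HasCompactSupport (delZ j χ) := by
        refine (hχs.fderiv ℝ).mono fun z hz => ?_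
        rw [Function.mem_support] at hz ⊢
        intro h
        rw [delZ, h] at hz
        simp at hz
      exact h1.exists_bound_of_continuous (contDiff_delZ hχ j).continuous
    choose N hN using hdχ
    have hN0 : ∀ j, 0 ≤ N j := fun j => (norm_nonneg _).trans (hN j 0)
    -- The sum bounds the terms where d' falls on the cutoff: `N j` for the derivative of χ, `D` for
    -- the coefficient of F, and e^B for the extra factor e^{w_j} in `pre` that goes with dz_j.
    refine ⟨M * D + ∑ j ∈ I, N j * (D * Real.exp B), fun w => ?_⟩
    rw [del_pre_mul (F := fun I K z => χ z * F I K z) hc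
      (fun I K => hdiff I K _ (expShift_mem_regularSet hc w))]
    by_cases hwA : expShift c w ∈ A
    · rw [twistedDel_mul (hχ.differentiable (by simp) _)
        (fun I K => (hreg _ (hAP hwA) (expShift_mem_regularSet hc w) I K).differentiableAt (by simp)),
        mul_add, add_mul, Finset.mul_sum, Finset.sum_mul]
      refine (norm_add_le _ _).trans (add_le_add ?_ (norm_sum_le_of_le _ fun j hj => ?_))
      · calc _ = ‖χ (expShift c w)‖ * ‖pre θ I K w * twistedDel θ F I K (expShift c w)‖ := by
              rw [← norm_mul]; congr 1; ring
          _ ≤ M * (D * wt (logExponent θ e) w) := by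
              gcongr
              · exact hM _
              · exact hb1 I K w hwA
          _ = _ := by ring
      · calc _ = ‖(-1 : ℂ) ^ (I.filter (· < j)).card‖ * (‖delZ j χ (expShift c w)‖ *
                (‖pre θ (I.erase j) K w * F (I.erase j) K (expShift c w)‖ * ‖Complex.exp (w j)‖)) := by
              rw [← norm_mul, ← norm_mul, ← norm_mul, pre_insert_left hj]; congr 1; ring
          _ ≤ 1 * (N j * ((D * wt (logExponent θ e) w) * Real.exp B)) := by
              have h1 : ‖Complex.exp (w j)‖ ≤ Real.exp B := by
                rw [Complex.norm_exp]; exact Real.exp_le_exp.mpr (hw w hwA j)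
              have h2 := hN0 j
              have h3 := hwt w
              gcongr
              · rw [norm_pow]; simp
              · exact hN j _
              · exact hb0 _ K w hwA
          _ = _ := by ring
    · rw [twistedDel_congr (G := fun _ _ _ => 0) (fun I K => hcut I K _ hwA)]
      have : twistedDel θ (fun _ _ _ => 0 : Form d ℂ) I K (expShift c w) = 0 := by
        refine Finset.sum_eq_zero fun j _ => ?_
        have : delZ j (fun _ : Fin d → ℂ => (0 : ℂ)) = 0 := delZ_zero j
        rw [this]; simp
      rw [this]
      have h4 : 0 ≤ ∑ j ∈ I, N j * (D * Real.exp B) :=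
        Finset.sum_nonneg fun j _ => mul_nonneg (hN0 j) (by positivity)
      simpa using mul_nonneg (add_nonneg (mul_nonneg hM0 hD0) h4) (hwt w)
  · intro j I K w
    simp only
    rw [expShift_add_period, pre_add_period]; ring

end RankOne

/-! ### Solving the equation in rank one. -/

section RankOnePrimitive

open MeasureTheory Filter Topology ComplexConjugate

variable {d : ℕ} {p q : ℕ} {θ : Fin d → ℝ}

lemma contDiffAt_delZ {f : (Fin d → ℂ) → ℂ} {z : Fin d → ℂ} (hf : ContDiffAt ℝ ∞ f z) (j : Fin d) :
    ContDiffAt ℝ ∞ (delZ j f) z := by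
  have h : ContDiffAt ℝ ∞ (fderiv ℝ f) z := hf.fderiv_right (by simp)
  have h1 : ∀ v, ContDiffAt ℝ ∞ (fun z => fderiv ℝ f z v) z := fun v => h.clm_apply contDiffAt_const
  have h2 : ContDiffAt ℝ ∞ (fun z => (1 / 2 : ℂ) * (fderiv ℝ f z (Pi.single j 1) -
      Complex.I * fderiv ℝ f z (Pi.single j Complex.I))) z :=
    contDiffAt_const.mul ((h1 _).sub (contDiffAt_const.mul (h1 _)))
  exact h2

lemma contDiffAt_twistedDel {F : Form d ℂ} {z : Fin d → ℂ} (hF : ∀ I K, ContDiffAt ℝ ∞ (F I K) z)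
    (hz : z ∈ regularSet θ) (I K : Finset (Fin d)) : ContDiffAt ℝ ∞ (twistedDel θ F I K) z := by
  refine ContDiffAt.sum fun j _ => contDiffAt_const.mul
    ((contDiffAt_delZ (hF _ _) j).add (ContDiffAt.mul ?_ (hF _ _)))
  by_cases h : θ j = 0
  · simpa [h] using contDiffAt_const
  · exact contDiffAt_const.mul ((contDiff_apply ℝ ℂ j).contDiffAt.inv (hz j h))

/-- In degree 0 condition C asks only for local boundedness, which follows since ∏ |z_i|^e is
bounded on compact sets; in other degrees the hypothesis is the growth condition itself. -/
lemma conditionC_of_bound {P : Set (Fin d → ℂ)} {F : Form d ℂ}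
    (hs : ∀ I K, ∀ z ∈ P, z ∈ regularSet θ → ContDiffAt ℝ ∞ (F I K) z)
    (htype : p + q = 0 → ∀ I K, ¬(I = ∅ ∧ K = ∅) → F I K = 0) {e C : ℝ} (he : 0 < e) (hC : 0 ≤ C)
    (hb : ∀ I K, ∀ z ∈ P, z ∈ regularSet θ → (∏ i, ‖z i‖ ^ (θ i / (2 * Real.pi))) * ‖F I K z‖ ≤
      C * ∏ i with θ i ≠ 0, ‖z i‖ ^ (e - (if i ∈ I then 1 else 0) - (if i ∈ K then 1 else 0))) :
    ConditionC p q θ P F := by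
  refine ⟨fun I K z hz => (hs I K z hz.1 hz.2).contDiffWithinAt, fun A hA hc => ?_⟩
  have hcont : Continuous fun z : Fin d → ℂ => ∏ i with θ i ≠ 0, ‖z i‖ ^ e :=
    continuous_finsetProd _ fun i _ =>
      (continuous_norm.comp (continuous_apply i)).rpow_const fun _ => Or.inr he.le
  obtain ⟨M, hM⟩ := hc.exists_bound_of_continuousOn hcont.continuousOn
  by_cases hpq : p + q = 0
  · refine ⟨e, he, |C * M|, fun I K z hz hr => ?_⟩
    rw [if_pos hpq]
    by_cases h : I = ∅ ∧ K = ∅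
    · obtain ⟨rfl, rfl⟩ := h
      refine (hb ∅ ∅ z (hA hz) hr).trans (le_trans ?_ (le_abs_self _))
      have := (le_abs_self _).trans (hM z hz)
      simpa using mul_le_mul_of_nonneg_left this hC
    · rw [htype hpq I K h]; simp; positivity
  · refine ⟨e, he, C, fun I K z hz hr => ?_⟩
    rw [if_neg hpq]
    exact hb I K z (hA hz) hr

/-- The form `F` with `pre · F ∘ expShift = A`. -/
def descend (θ : Fin d → ℝ) (c : Fin d → ℂ) (A : Form d ℂ) : Form d ℂ := fun I K z =>
  (pre θ I K (logShift c z))⁻¹ * A I K (logShift c z)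

lemma descend_periodic {e : Fin d → ℝ} {A : Form d ℂ}
    (hA : LogForm p q (fun i => θ i / (2 * Real.pi)) e A) (I K : Finset (Fin d)) (j : Fin d)
    (w : Fin d → ℂ) :
    (fun w => (pre θ I K w)⁻¹ * A I K w) (w + Pi.single j (2 * Real.pi * Complex.I)) =
      (fun w => (pre θ I K w)⁻¹ * A I K w) w := by
  have h1 := hA.quasi j I K w
  have h2 := Complex.exp_ne_zero (2 * Real.pi * Complex.I * (θ j / (2 * Real.pi) : ℝ))
  have h3 := pre_ne_zero (θ := θ) I K w
  simp only
  rw [h1, pre_add_period]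
  field_simp

lemma eq_pre_mul_descend {e : Fin d → ℝ} {A : Form d ℂ}
    (hA : LogForm p q (fun i => θ i / (2 * Real.pi)) e A) (c : Fin d → ℂ) :
    A = fun I K w => pre θ I K w * descend θ c A I K (expShift c w) := by
  funext I K w
  have h := eq_of_periodic (g := fun w => (pre θ I K w)⁻¹ * A I K w) (descend_periodic hA I K) (w := logShift c (expShift c w)) (w' := w)
    fun i => by
      have : expShift c w i + c i = Complex.exp (w i) := by rw [expShift]; ring
      rw [exp_logShift (by rw [this]; exact Complex.exp_ne_zero _), this]
  rw [descend, h, mul_inv_cancel_left₀ (pre_ne_zero I K w)]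

lemma contDiffAt_descend {e : Fin d → ℝ} {A : Form d ℂ}
    (hA : LogForm p q (fun i => θ i / (2 * Real.pi)) e A) {c z : Fin d → ℂ}
    (hz : ∀ i, z i + c i ≠ 0) (I K : Finset (Fin d)) : ContDiffAt ℝ ∞ (descend θ c A I K) z :=
  contDiffAt_comp_logShift (((contDiff_pre I K).inv (pre_ne_zero I K)).mul (hA.smooth I K))
    (descend_periodic hA I K) hz

lemma exists_uniform_bound {g : Form d ℂ} {v : (Fin d → ℂ) → ℝ} (hv : ∀ w, 0 ≤ v w)
    (h : ∀ I K, ∃ C, ∀ w, ‖g I K w‖ ≤ C * v w) : ∃ C, 0 ≤ C ∧ ∀ I K w, ‖g I K w‖ ≤ C * v w := by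
  choose C hC using h
  refine ⟨∑ I, ∑ K, |C I K|, Finset.sum_nonneg fun _ _ => Finset.sum_nonneg fun _ _ => abs_nonneg _,
    fun I K w => (hC I K w).trans (mul_le_mul_of_nonneg_right ?_ (hv w))⟩
  calc C I K ≤ |C I K| := le_abs_self _
    _ ≤ ∑ K, |C I K| := Finset.single_le_sum (f := fun K => |C I K|) (fun _ _ => abs_nonneg _)
        (Finset.mem_univ K)
    _ ≤ _ := Finset.single_le_sum (f := fun I => ∑ K, |C I K|)
        (fun _ _ => Finset.sum_nonneg fun _ _ => abs_nonneg _) (Finset.mem_univ I)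

/-- Two of the four growth conditions concern d'' of the primitive, which is F, and are inherited
from it. Only the primitive and its d' need estimates, and these are the two bounds contained in
`LogForm`. -/
lemma isRankOneSection_descend {P : Set (Fin d → ℂ)} (hP : IsOpen P) {c : Fin d → ℂ}
    (hc : ∀ i, θ i ≠ 0 → c i = 0) (hPc : ∀ z ∈ P, z ∈ regularSet θ → ∀ i, z i + c i ≠ 0)
    {B : ℝ} (hB : 0 ≤ B) (hw : ∀ w, expShift c w ∈ P → ∀ i, θ i = 0 → -B ≤ (w i).re)
    {e : ℝ} (he : 0 < e) {A F : Form d ℂ}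
    (hA : LogForm p q (fun i => θ i / (2 * Real.pi)) (logExponent θ e) A)
    (hF : ConditionC p (q + 1) θ P F) (hF' : ConditionC (p + 1) (q + 1) θ P (twistedDel θ F))
    (hAF : ∀ I K, ∀ z ∈ P, z ∈ regularSet θ → dbar (descend θ c A) I K z = F I K z) :
    IsRankOneSection p q θ P (descend θ c A) := by
  have hs : ∀ I K, ∀ z ∈ P, z ∈ regularSet θ → ContDiffAt ℝ ∞ (descend θ c A I K) z :=
    fun I K z hz hr => contDiffAt_descend hA (hPc z hz hr) I K
  have hwt := fun w : Fin d → ℂ => (wt_pos (logExponent θ e) w).le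
  have htype : ∀ I K, ¬(I.card = p ∧ K.card = q) → descend θ c A I K = 0 := fun I K h => by
    funext z
    simp [descend, hA.type_eq I K h]
  obtain ⟨C₀, hC₀, hb₀⟩ := exists_uniform_bound hwt hA.bound
  obtain ⟨C₁, hC₁, hb₁⟩ := exists_uniform_bound hwt hA.bound_del
  have hel := eq_pre_mul_descend hA c
  have hexp : ∀ z ∈ P, z ∈ regularSet θ → expShift c (logShift c z) = z := fun z hz hr =>
    expShift_logShift (hPc z hz hr)
  refine ⟨htype, ?_, ?_, hF.congr hAF, hF'.congr fun I K z hz hr => ?_⟩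
  · refine conditionC_of_bound hs (fun h I K hIK => htype I K fun h' => hIK ?_) he
      (C := C₀ * Real.exp (∑ _i : Fin d, 3 * B)) (by positivity) fun I K z hz hr => ?_
    · rw [← Finset.card_eq_zero, ← Finset.card_eq_zero]; omega
    · have h1 := hb₀ I K (logShift c z)
      rw [hel] at h1
      simp only at h1
      have h2 := norm_le_of_pre_mul_le hc hB (hw (logShift c z) (by rw [hexp z hz hr]; exact hz)) hC₀ h1
      rw [hexp z hz hr] at h2
      exact h2
  · refine conditionC_of_bound (fun I K z hz hr => contDiffAt_twistedDel (fun I K => hs I K z hz hr) hr I K)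
      (fun h => by omega) he
      (C := C₁ * Real.exp (∑ _i : Fin d, 3 * B)) (by positivity) fun I K z hz hr => ?_
    have h1 := hb₁ I K (logShift c z)
    have h3 : del A I K (logShift c z) =
        pre θ I K (logShift c z) * twistedDel θ (descend θ c A) I K (expShift c (logShift c z)) := by
      conv_lhs => rw [hel]
      refine del_pre_mul hc (fun I K => ?_) I K
      rw [hexp z hz hr]
      exact (hs I K z hz hr).differentiableAt (by simp)
    rw [h3] at h1
    have h2 := norm_le_of_pre_mul_le hc hB (hw (logShift c z) (by rw [hexp z hz hr]; exact hz)) hC₁ h1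
    rw [hexp z hz hr] at h2
    exact h2
  · refine twistedDel_congr (fun I K => ?_) I K
    filter_upwards [(hP.inter (isOpen_regularSet θ)).mem_nhds ⟨hz, hr⟩] with y hy
    exact hAF I K y hy.1 hy.2

/-- The margin 5δ is spent in unit steps: the cutoff is supported in radius R + 4δ and equals 1 in
radius R + 3δ, smoothing shrinks to R + 2δ, and elimination to R + δ. -/
theorem rankOne_primitive {z₀ : Fin d → ℂ} {R : Fin d → ℝ} {δ : ℝ} (hR : ∀ i, 0 < R i) (hδ : 0 < δ)
    (hθ : ∀ i, θ i ∈ Ico 0 (2 * Real.pi)) (hq : 0 < q) {F : Form d ℂ}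
    (hF : IsRankOneSection p q θ (openPolydisc z₀ fun i => R i + 5 * δ) F)
    (hcl : ∀ I K, ∀ z ∈ openPolydisc z₀ (fun i => R i + 5 * δ), z ∈ regularSet θ →
      dbar F I K z = 0) :
    ∃ F' : Form d ℂ, IsRankOneSection p (q - 1) θ (openPolydisc z₀ fun i => R i + δ) F' ∧
      ∀ I K, ∀ z ∈ openPolydisc z₀ (fun i => R i + δ), z ∈ regularSet θ →
        dbar F' I K z = F I K z := by
  set P := openPolydisc z₀ fun i => R i + 5 * δ with hPdef
  set P' := openPolydisc z₀ fun i => R i + δ with hP'def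
  set P₃ := openPolydisc z₀ fun i => R i + 3 * δ with hP₃def
  set A := closedPolydisc z₀ fun i => R i + 4 * δ with hAdef
  have hP : IsOpen P := isOpen_openPolydisc _ _
  have hP' : IsOpen P' := isOpen_openPolydisc _ _
  have hAP : A ⊆ P := fun z hz i => lt_of_le_of_lt (hz i) (by linarith)
  have hP'3 : P' ⊆ P₃ := fun z hz i => lt_trans (hz i) (by linarith)
  have hP3P : P₃ ⊆ P := fun z hz i => lt_trans (hz i) (by linarith)
  have hAc : IsCompact A := isCompact_closedPolydisc _ _
  obtain ⟨χ, hχ, hχs, hχ1, hχA⟩ := exists_polydisc_cutoff z₀ (r := fun i => R i + 3 * δ)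
    (r' := fun i => R i + 4 * δ) (fun i => by have := hR i; positivity) (fun i => by linarith)
  obtain ⟨ε₁, hε₁, C₁, h₁⟩ := hF.2.1.2 A hAP hAc
  obtain ⟨ε₂, hε₂, C₂, h₂⟩ := hF.2.2.1.2 A hAP hAc
  -- As q > 0, both F and d'F fall under the growth alternative of condition C, so a positive
  -- exponent is available.
  simp only [if_neg (show ¬(p + q = 0) by omega)] at h₁
  simp only [if_neg (show ¬(p + 1 + q = 0) by omega)] at h₂
  -- The exponent must not exceed those given by condition C, and must stay below every non-zero
  -- θ_i/2π for the cylinder kernel to apply.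
  obtain ⟨e, he, hem, heθ⟩ := exists_small_exponent hθ (lt_min hε₁ hε₂)
  -- Where θ_i = 0 the disc is recentred at R_i + 6δ, so that even radius R_i + 5δ keeps it away
  -- from 0.
  set c := shift θ z₀ (fun i => R i + 6 * δ) with hcdef
  have hc : ∀ i, θ i ≠ 0 → c i = 0 := fun i hi => shift_of_ne _ _ i hi
  -- On the support of the cutoff |e^{w_i}| ≤ `M i`. The constant `B` below bounds Re w_i above
  -- there, and also bounds it below on `P'` where θ_i = 0.
  set M : Fin d → ℝ := fun i => ‖z₀ i + c i‖ + (R i + 4 * δ) with hM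
  set B := |Real.log δ| + ∑ i, |Real.log (M i)| with hBdef
  have hB : 0 ≤ B := add_nonneg (abs_nonneg _) (Finset.sum_nonneg fun _ _ => abs_nonneg _)
  have hexp : ∀ (w : Fin d → ℂ) i, Complex.exp (w i) = expShift c w i + c i := fun w i => by
    rw [expShift]; ring
  have hwA : ∀ w, expShift c w ∈ A → ∀ i, (w i).re ≤ B := by
    intro w hw i
    have h1 : Real.exp (w i).re ≤ M i := by
      rw [← Complex.norm_exp, hexp,
        show expShift c w i + c i = (z₀ i + c i) + (expShift c w i - z₀ i) by ring]
      exact (norm_add_le _ _).trans (add_le_add le_rfl (hw i))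
    have h2 : (w i).re ≤ Real.log (M i) := by
      rw [← Real.log_exp (w i).re]; exact Real.log_le_log (Real.exp_pos _) h1
    have h3 := Finset.single_le_sum (f := fun i => |Real.log (M i)|) (fun _ _ => abs_nonneg _)
      (Finset.mem_univ i)
    have h4 := le_abs_self (Real.log (M i))
    have h5 := abs_nonneg (Real.log δ)
    linarith
  have hlow : ∀ z ∈ P', ∀ i, θ i = 0 → δ ≤ ‖z i + c i‖ := by
    intro z hz i hi
    have h1 : z i + c i = ((R i + 6 * δ : ℝ) : ℂ) + (z i - z₀ i) := by
      simp only [hcdef, shift, if_pos hi]; ring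
    have h2 := norm_sub_le_norm_add ((R i + 6 * δ : ℝ) : ℂ) (z i - z₀ i)
    have h3 : ‖((R i + 6 * δ : ℝ) : ℂ)‖ = R i + 6 * δ := by
      rw [Complex.norm_real, Real.norm_of_nonneg]
      have := hR i; positivity
    have h4 : ‖z i - z₀ i‖ < R i + δ := hz i
    rw [h1]; linarith
  have hPc : ∀ z ∈ P', z ∈ regularSet θ → ∀ i, z i + c i ≠ 0 := by
    intro z hz hr i
    by_cases hi : θ i = 0
    · exact norm_pos_iff.mp (hδ.trans_le (hlow z hz i hi))
    · rw [hc i hi, add_zero]; exact hr i hi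
  have hwlow : ∀ w, expShift c w ∈ P' → ∀ i, θ i = 0 → -B ≤ (w i).re := by
    intro w hw i hi
    have h1 := hlow _ hw i hi
    rw [← hexp, Complex.norm_exp] at h1
    have h2 := Real.log_le_log hδ h1
    rw [Real.log_exp] at h2
    have h3 := neg_abs_le (Real.log δ)
    have h5 : 0 ≤ ∑ i, |Real.log (M i)| := Finset.sum_nonneg fun _ _ => abs_nonneg _
    linarith
  obtain ⟨hG, hGd⟩ := logForm_of_section hP hAP hc hF hχ hχs hχA he (hem.trans (min_le_left _ _))
    (hem.trans (min_le_right _ _)) hB hwA (fun I K z hz hr => h₁ I K z hz hr)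
    (fun I K z hz hr => h₂ I K z hz hr)
  have hlam : ∀ i, 0 ≤ θ i / (2 * Real.pi) ∧ θ i / (2 * Real.pi) < 1 := fun i =>
    ⟨div_nonneg (hθ i).1 Real.two_pi_pos.le, (div_lt_one Real.two_pi_pos).mpr (hθ i).2⟩
  have hcut : ∀ z ∈ P₃, ∀ I K, (fun z => χ z * F I K z) =ᶠ[𝓝 z] F I K := fun z hz I K => by
    filter_upwards [hχ1 z hz] with y hy
    simp [hy]
  obtain ⟨G', hG', hGG⟩ := exists_primitive (a := fun i => z₀ i + c i) (ρ₀ := fun i => R i + δ)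
    (ρ₁ := fun i => R i + 2 * δ) (ρ₂ := fun i => R i + 3 * δ)
    (fun i => by
      rw [logExponent]
      split_ifs with h
      · simp [h]; norm_num
      · linarith [(hlam i).2])
    (fun i => by
      rw [logExponent]
      split_ifs with h
      · simp [h]
      · exact heθ i h)
    hq hG (fun i => by have := hR i; positivity) (fun i => by linarith) (fun i => by linarith)
    (fun I K w hw => by
      rw [mem_logRegion_iff] at hw
      rw [dbar_pre_mul (F := fun I K z => χ z * F I K z)
        fun I K => hGd I K _ (expShift_mem_regularSet hc w), dbar_congr (hcut _ hw),
        hcl I K _ (hP3P hw) (expShift_mem_regularSet hc w), mul_zero])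
  have hdb : ∀ I K, ∀ z ∈ P', z ∈ regularSet θ → dbar (descend θ c G') I K z = F I K z := by
    intro I K z hz hr
    have hz' := expShift_logShift (hPc z hz hr)
    have h1 := hGG I K (logShift c z) (by rw [mem_logRegion_iff, hz']; exact hz)
    rw [eq_pre_mul_descend hG' c, dbar_pre_mul (fun I K => by
      rw [hz']
      exact (contDiffAt_descend hG' (hPc z hz hr) I K).differentiableAt (by simp)), hz',
      (hχ1 z (hP'3 hz)).eq_of_nhds, one_mul] at h1
    exact mul_left_cancel₀ (pre_ne_zero _ _ _) h1
  have hq1 : q - 1 + 1 = q := Nat.sub_add_cancel hq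
  refine ⟨descend θ c G', isRankOneSection_descend (F := F) hP' hc hPc hB hwlow he hG' ?_ ?_ hdb, hdb⟩
  · rw [hq1]; exact hF.2.1.mono (hP'3.trans hP3P)
  · rw [hq1]; exact hF.2.2.1.mono (hP'3.trans hP3P)

end RankOnePrimitive

/-! ### Frames of the local system and d'' on the cover. -/

section Cover

open MeasureTheory Filter Topology ComplexConjugate

variable {d N : ℕ} {p q : ℕ}

section

variable {θ : Fin d → ℝ} {V : Type*} [NormedAddCommGroup V] [NormedSpace ℂ V]

lemma delZbar_sum_smul {ι : Type*} [Fintype ι] {g : ι → (Fin d → ℂ) → ℂ} (m : ι → V)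
    {z : Fin d → ℂ} (hg : ∀ a, DifferentiableAt ℝ (g a) z) (j : Fin d) :
    delZbar j (fun z => ∑ a, g a z • m a) z = ∑ a, delZbar j (g a) z • m a := by
  have h : HasFDerivAt (fun z => ∑ a, g a z • m a) (∑ a, (fderiv ℝ (g a) z).smulRight (m a)) z :=
    HasFDerivAt.fun_sum fun a _ => (hg a).hasFDerivAt.smul_const (m a)
  rw [delZbar, h.fderiv]
  simp only [delZbar, sum_apply, ContinuousLinearMap.smulRight_apply, Finset.smul_sum]
  rw [← Finset.sum_add_distrib, Finset.smul_sum]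
  refine Finset.sum_congr rfl fun a _ => ?_
  simp only [smul_smul, ← add_smul, smul_eq_mul]

lemma delZbar_mul_of_eq_zero {f g : (Fin d → ℂ) → ℂ} {z : Fin d → ℂ} (hf : DifferentiableAt ℝ f z)
    (hg : DifferentiableAt ℂ g z) (j : Fin d) :
    delZbar j (fun z => f z * g z) z = delZbar j f z * g z := by
  have hg' : HasFDerivAt g ((fderiv ℂ g z).restrictScalars ℝ) z := hg.hasFDerivAt.restrictScalars ℝ
  have h1 : fderiv ℂ g z (Pi.single j Complex.I) = Complex.I * fderiv ℂ g z (Pi.single j 1) := by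
    rw [← smul_eq_mul, ← map_smul, ← Pi.single_smul, smul_eq_mul, mul_one]
  rw [delZbar, delZbar, (hf.hasFDerivAt.fun_mul hg').fderiv]
  simp only [add_apply, smul_apply, ContinuousLinearMap.coe_restrictScalars', smul_eq_mul, h1]
  linear_combination (1 / 2 * f z * fderiv ℂ g z (Pi.single j 1)) * Complex.I_sq

/-- The ratio `μ(z) / μ(w)` in a horizontal frame, for `∇ μ = ∑ θ_i / 2π · dz_i / z_i ⊗ μ`. -/
def frameRatio (θ : Fin d → ℝ) (w z : Fin d → ℂ) : ℂ :=
  Complex.exp (∑ i, ((θ i / (2 * Real.pi) : ℝ) : ℂ) * Complex.log (z i / w i))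

lemma frameRatio_self (w : Fin d → ℂ) : frameRatio θ w w = 1 := by
  have : ∀ i, Complex.log (w i / w i) = 0 := fun i => by
    by_cases h : w i = 0 <;> simp [h]
  simp [frameRatio, this]

lemma differentiableAt_frameRatio {w : Fin d → ℂ} (hw : w ∈ regularSet θ) :
    DifferentiableAt ℂ (frameRatio θ w) w := by
  refine DifferentiableAt.cexp (DifferentiableAt.fun_sum fun i _ => ?_)
  by_cases h : θ i = 0
  · simp [h]
  · have h1 : DifferentiableAt ℂ (fun z : Fin d → ℂ => z i) w := differentiableAt_apply i w
    refine DifferentiableAt.const_mul (DifferentiableAt.clog ?_ ?_) _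
    · simp only [div_eq_mul_inv]; exact h1.mul_const _
    · rw [div_self (hw i h)]; exact Complex.one_mem_slitPlane

end

variable {X : Type*} [TopologicalSpace X] {D : Set X} {b : ↥Dᶜ}
  {e : OpenPartialHomeomorph X (Fin d → ℂ)} {J : Finset (Fin d)}
  {ρ : FundamentalGroup ↥Dᶜ b →* Matrix.unitaryGroup (Fin N) ℂ}

lemma coord_ne_zero (hJ : IsAdapted e J D) {u : ↥Dᶜ} (hu : (u : X) ∈ e.source) {i : Fin d}
    (hi : i ∈ J) : e (u : X) i ≠ 0 := fun h =>
  u.2 ((hJ _ hu).mpr ⟨i, hi, h⟩)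

/-- Near e(u) the ratios z_i / e(u)_i with i ∈ J stay in the slit plane along the whole segment.
This keeps the segment off D and makes the principal logarithm of the ratios continuous along it. -/
lemma eventually_segment (hJ : IsAdapted e J D) {P : Set (Fin d → ℂ)} (hP : IsOpen P)
    (hPe : P ⊆ e.target) {u : ↥Dᶜ} (hu : u ∈ domainOver D e P) :
    ∀ᶠ z in 𝓝 (e (u : X)), (∃ (v : ↥Dᶜ) (γ : Path u v), ∀ t, (γ t : X) ∈ e.source ∧
      e (γ t : X) = AffineMap.lineMap (k := ℝ) (e (u : X)) z (t : ℝ)) ∧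
      ∀ t : unitInterval, AffineMap.lineMap (k := ℝ) (e (u : X)) z (t : ℝ) ∈ P ∧ ∀ i ∈ J,
        (AffineMap.lineMap (k := ℝ) (e (u : X)) z (t : ℝ) : Fin d → ℂ) i / e (u : X) i ∈
          Complex.slitPlane := by
  have hne := fun i (hi : i ∈ J) => coord_ne_zero hJ hu.1 hi
  have h1 : ∀ᶠ z in 𝓝 (e (u : X)), z ∈ P ∧ ∀ i ∈ J, z i / e (u : X) i ∈ Complex.slitPlane := by
    refine (show ∀ᶠ z in 𝓝 (e (u : X)), z ∈ P from hP.mem_nhds hu.2).and ((Finset.eventually_all J).mpr fun i hi => ?_)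
    have hc : ContinuousAt (fun z : Fin d → ℂ => z i / e (u : X) i) (e (u : X)) :=
      ((continuous_apply i).div_const _).continuousAt
    refine hc (Complex.isOpen_slitPlane.mem_nhds ?_)
    simp only [div_self (hne i hi)]; exact Complex.one_mem_slitPlane
  obtain ⟨r, hr, hball⟩ := Metric.eventually_nhds_iff_ball.mp h1
  filter_upwards [Metric.ball_mem_nhds _ hr] with z hz
  have hseg : ∀ t : unitInterval,
      AffineMap.lineMap (k := ℝ) (e (u : X)) z (t : ℝ) ∈ Metric.ball (e (u : X)) r := fun t =>
    (convex_ball _ _).lineMap_mem (Metric.mem_ball_self hr) hz t.2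
  have hprop := fun t => hball _ (hseg t)
  refine ⟨?_, hprop⟩
  have hnD : ∀ t : unitInterval, e.symm (AffineMap.lineMap (k := ℝ) (e (u : X)) z (t : ℝ)) ∈ Dᶜ := by
    intro t ht
    have ht' := hPe (hprop t).1
    obtain ⟨i, hi, h0⟩ := (hJ _ (e.map_target ht')).mp ht
    rw [e.right_inv ht'] at h0
    have := (hprop t).2 i hi
    rw [h0, zero_div] at this
    exact Complex.slitPlane_ne_zero this rfl
  have hcont : Continuous fun t : unitInterval =>
      e.symm (AffineMap.lineMap (k := ℝ) (e (u : X)) z (t : ℝ)) :=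
    e.continuousOn_symm.comp_continuous
      (AffineMap.lineMap_continuous.comp continuous_subtype_val) fun t => hPe (hprop t).1
  refine ⟨⟨e.symm z, ?_⟩, ⟨⟨fun t => ⟨_, hnD t⟩, hcont.subtype_mk _⟩, ?_, ?_⟩, fun t => ?_⟩
  · simpa using hnD 1
  · refine Subtype.ext ?_
    simp [e.left_inv hu.1]
  · refine Subtype.ext ?_
    simp
  · exact ⟨e.map_target (hPe (hprop t).1), e.right_inv (hPe (hprop t).1)⟩

lemma branch_eventuallyEq (hJ : IsAdapted e J D) {P : Set (Fin d → ℂ)} (hP : IsOpen P)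
    (hPe : P ⊆ e.target) {θ : Fin (N * N) → Fin d → ℝ} {μ : Fin (N * N) → CoverFun N b}
    (hμ : IsSplitting e J ρ P θ μ) {f : Fin (N * N) → (Fin d → ℂ) → ℂ} {s : CoverFun N b}
    (hs : ∀ u ∈ domainOver D e P, ∀ c, s u c = ∑ a, f a (e (u : X)) • μ a u c) {u : ↥Dᶜ}
    (hu : u ∈ domainOver D e P) (c : Path.Homotopic.Quotient b u) :
    branch e s u c =ᶠ[𝓝 (e (u : X))]
      fun z => ∑ a, (f a z * frameRatio (θ a) (e (u : X)) z) • μ a u c := by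
  filter_upwards [eventually_segment hJ hP hPe hu] with z ⟨hex, hprop⟩
  rw [branch, dif_pos hex]
  have hγ := hex.choose_spec.choose_spec
  set v := hex.choose
  set γ : Path u v := hex.choose_spec.choose
  have hdom : ∀ t, γ t ∈ domainOver D e P := fun t =>
    ⟨(hγ t).1, by rw [(hγ t).2]; exact (hprop t).1⟩
  have hv : e (v : X) = z := by simpa using (hγ 1).2
  have hvd : v ∈ domainOver D e P := by simpa using hdom 1
  have hne := fun i (hi : i ∈ J) => coord_ne_zero hJ hu.1 hi
  rw [hs v hvd]
  refine Finset.sum_congr rfl fun a _ => ?_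
  have hlc : Continuous fun t : unitInterval =>
      (AffineMap.lineMap (k := ℝ) (e (u : X)) z (t : ℝ) : Fin d → ℂ) :=
    AffineMap.lineMap_continuous.comp continuous_subtype_val
  let ℓ : C(unitInterval, Fin d → ℂ) := ⟨fun t i => if i ∈ J then
    Complex.log ((AffineMap.lineMap (k := ℝ) (e (u : X)) z (t : ℝ) : Fin d → ℂ) i / e (u : X) i) +
      Complex.log (e (u : X) i) else 0, by
    refine continuous_pi fun i => ?_
    by_cases hi : i ∈ J
    · simp only [if_pos hi]
      exact ((((continuous_apply i).comp hlc).div_const _).clog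
        fun t => (hprop t).2 i hi).add continuous_const
    · simp only [if_neg hi]; exact continuous_const⟩
  have hJθ : ∀ i, θ a i ≠ 0 → i ∈ J := fun i hi => by
    by_contra h; exact hi (hμ.theta_eq_zero a i h)
  have key := (hμ.eigen a).2 u v γ ℓ hdom (fun t i hi => by
    have hiJ := hJθ i hi
    simp only [ℓ, ContinuousMap.coe_mk, if_pos hiJ]
    rw [Complex.exp_add, Complex.exp_log (Complex.slitPlane_ne_zero ((hprop t).2 i hiJ)),
      Complex.exp_log (hne i hiJ), div_mul_cancel₀ _ (hne i hiJ), (hγ t).2]) c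
  rw [key, hv, smul_smul, frameRatio]
  have hsum : ∀ i, ((θ a i / (2 * Real.pi) : ℝ) : ℂ) * (ℓ 1 i - ℓ 0 i) =
      ((θ a i / (2 * Real.pi) : ℝ) : ℂ) * Complex.log (z i / e (u : X) i) := fun i => ?_
  · rw [Finset.sum_congr rfl fun i _ => hsum i]
  by_cases hi : θ a i = 0
  · simp [hi]
  · have hiJ := hJθ i hi
    simp [ℓ, if_pos hiJ, div_self (hne i hiJ)]

lemma mem_regularSet (hJ : IsAdapted e J D) {P : Set (Fin d → ℂ)}
    {θ : Fin (N * N) → Fin d → ℝ} {μ : Fin (N * N) → CoverFun N b}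
    (hμ : IsSplitting e J ρ P θ μ) {u : ↥Dᶜ} (hu : (u : X) ∈ e.source) (a : Fin (N * N)) :
    e (u : X) ∈ regularSet (θ a) := fun i hi =>
  coord_ne_zero hJ hu (by by_contra h; exact hi (hμ.theta_eq_zero a i h))

/-- By `branch_eventuallyEq` a branch is a combination of fixed matrices with coefficients F_a times
`frameRatio`. That ratio is holomorphic and equals 1 at the base point, so d'' sees only F_a. -/
theorem coverDbar_eq (hJ : IsAdapted e J D) {P : Set (Fin d → ℂ)} (hP : IsOpen P)
    (hPe : P ⊆ e.target) {θ : Fin (N * N) → Fin d → ℝ} {μ : Fin (N * N) → CoverFun N b}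
    (hμ : IsSplitting e J ρ P θ μ) {F : Fin (N * N) → Form d ℂ}
    (hF : ∀ a, IsRankOneSection p q (θ a) P (F a)) {η : CoverForm d N b}
    (hη : ∀ I K, ∀ u ∈ domainOver D e P, ∀ c, η I K u c = ∑ a, F a I K (e (u : X)) • μ a u c)
    (I K : Finset (Fin d)) {u : ↥Dᶜ} (hu : u ∈ domainOver D e P)
    (c : Path.Homotopic.Quotient b u) :
    coverDbar e η I K u c = ∑ a, dbar (F a) I K (e (u : X)) • μ a u c := by
  have hreg := mem_regularSet hJ hμ hu.1
  have hd : ∀ a I K, DifferentiableAt ℝ (F a I K) (e (u : X)) := fun a I K =>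
    (((hF a).2.1.1 I K).contDiffAt ((hP.inter (isOpen_regularSet (θ a))).mem_nhds
      ⟨hu.2, hreg a⟩)).differentiableAt (by simp)
  simp only [coverDbar, dbar, Finset.sum_smul]
  rw [Finset.sum_comm]
  refine Finset.sum_congr rfl fun j _ => ?_
  rw [delZbar_congr (branch_eventuallyEq hJ hP hPe hμ (hη I (K.erase j)) hu c),
    delZbar_sum_smul (g := fun a z => F a I (K.erase j) z * frameRatio (θ a) (e (u : X)) z) _
      fun a => (hd a _ _).fun_mul ((differentiableAt_frameRatio (hreg a)).restrictScalars ℝ), Finset.smul_sum]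
  refine Finset.sum_congr rfl fun a _ => ?_
  rw [delZbar_mul_of_eq_zero (hd a _ _) (differentiableAt_frameRatio (hreg a)), frameRatio_self,
    mul_one, smul_smul, smul_eq_mul]

lemma IsSplitting.mono {P P' : Set (Fin d → ℂ)} (h : P' ⊆ P)
    {θ : Fin (N * N) → Fin d → ℝ} {μ : Fin (N * N) → CoverFun N b}
    (hμ : IsSplitting e J ρ P θ μ) : IsSplitting e J ρ P' θ μ where
  theta_mem := hμ.theta_mem
  theta_eq_zero := hμ.theta_eq_zero
  eigen a := ⟨fun u hu => (hμ.eigen a).1 u ⟨hu.1, h hu.2⟩, fun u v γ ℓ hγ =>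
    (hμ.eigen a).2 u v γ ℓ fun t => ⟨(hγ t).1, h (hγ t).2⟩⟩
  basis u hu := hμ.basis u ⟨hu.1, h hu.2⟩

lemma IsRankOneSection.mono {θ : Fin d → ℝ} {P P' : Set (Fin d → ℂ)} (h : P' ⊆ P) {F : Form d ℂ}
    (hF : IsRankOneSection p q θ P F) : IsRankOneSection p q θ P' F :=
  ⟨hF.1, hF.2.1.mono h, hF.2.2.1.mono h, hF.2.2.2.1.mono h, hF.2.2.2.2.mono h⟩

/-- Density: z + t(1, …, 1) avoids all coordinate hyperplanes for small real t ≠ 0. -/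
lemma eq_zero_of_eq_zero_off_hyperplanes {f : (Fin d → ℂ) → ℂ} {O : Set (Fin d → ℂ)} (hO : IsOpen O)
    (hf : ContinuousOn f O) (h0 : ∀ z ∈ O, (∀ i, z i ≠ 0) → f z = 0) {z : Fin d → ℂ} (hz : z ∈ O) :
    f z = 0 := by
  have hL : Tendsto (fun t : ℝ => fun i => z i + (t : ℂ)) (𝓝[≠] 0) (𝓝 z) := by
    have : Continuous fun t : ℝ => fun i => z i + (t : ℂ) := by fun_prop
    simpa using (this.tendsto 0).mono_left nhdsWithin_le_nhds
  have h1 : ∀ᶠ t : ℝ in 𝓝[≠] 0, ∀ i, z i + (t : ℂ) ≠ 0 := by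
    rw [eventually_all]
    intro i
    by_cases hi : z i = 0
    · filter_upwards [self_mem_nhdsWithin] with t ht
      simpa [hi] using ht
    · have : Continuous fun t : ℝ => z i + (t : ℂ) := by fun_prop
      exact nhdsWithin_le_nhds (this.continuousAt.eventually_ne (by simpa using hi))
  have h2 : (fun t : ℝ => f fun i => z i + (t : ℂ)) =ᶠ[𝓝[≠] 0] fun _ => 0 := by
    filter_upwards [h1, hL (hO.mem_nhds hz)] with t ht hO' using h0 _ hO' ht
  exact tendsto_nhds_unique (((hf.continuousAt (hO.mem_nhds hz)).tendsto.comp hL).congr' h2)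
    tendsto_const_nhds

/-- Over U the components are separated by linear independence of the frame. The coefficient of a
component extends smoothly across those parts of D around which that component has no monodromy;
there the vanishing follows by continuity. -/
lemma dbar_component_eq_zero [PathConnectedSpace ↥Dᶜ] (hJ : IsAdapted e J D)
    {P : Set (Fin d → ℂ)} (hP : IsOpen P)
    (hPe : P ⊆ e.target) {θ : Fin (N * N) → Fin d → ℝ} {μ : Fin (N * N) → CoverFun N b}
    (hμ : IsSplitting e J ρ P θ μ) {F : Fin (N * N) → Form d ℂ}
    (hF : ∀ a, IsRankOneSection p q (θ a) P (F a)) {η : CoverForm d N b}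
    (hη : ∀ I K, ∀ u ∈ domainOver D e P, ∀ c, η I K u c = ∑ a, F a I K (e (u : X)) • μ a u c)
    (hclosed : ∀ I K, ∀ u ∈ domainOver D e P, ∀ c, coverDbar e η I K u c = 0)
    (a : Fin (N * N)) (I K : Finset (Fin d)) {z : Fin d → ℂ} (hz : z ∈ P)
    (hr : z ∈ regularSet (θ a)) : dbar (F a) I K z = 0 := by
  refine eq_zero_of_eq_zero_off_hyperplanes (hP.inter (isOpen_regularSet (θ a)))
    ((hF a).2.2.2.1.1 I K).continuousOn (fun y hy hne => ?_) ⟨hz, hr⟩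
  have hyt := hPe hy.1
  have hnD : e.symm y ∈ Dᶜ := fun h => by
    obtain ⟨i, _, h0⟩ := (hJ _ (e.map_target hyt)).mp h
    rw [e.right_inv hyt] at h0
    exact hne i h0
  let u : ↥Dᶜ := ⟨e.symm y, hnD⟩
  have hue : e (u : X) = y := e.right_inv hyt
  have hu : u ∈ domainOver D e P := ⟨e.map_target hyt, by rw [hue]; exact hy.1⟩
  -- Path-connectedness of U is used here: without a path class from b the closedness hypothesis
  -- would be vacuous at u.
  let c : Path.Homotopic.Quotient b u := Path.Homotopic.Quotient.mk (PathConnectedSpace.somePath b u)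
  have h := coverDbar_eq hJ hP hPe hμ hF hη I K hu c
  rw [hclosed I K u hu c, hue] at h
  exact Fintype.linearIndependent_iff.mp (hμ.basis u hu c) (fun a => dbar (F a) I K y) h.symm a

/-- Scaling by R_i/(R_i + δ) towards the centre carries the larger polydisc into the closed one and
moves each coordinate by less than δ, so the larger one lies in a δ-thickening. -/
lemma exists_openPolydisc_subset {z₀ : Fin d → ℂ} {R : Fin d → ℝ} (hR : ∀ i, 0 < R i)
    {W : Set (Fin d → ℂ)} (hW : IsOpen W) (h : closedPolydisc z₀ R ⊆ W) :
    ∃ δ > 0, openPolydisc z₀ (fun i => R i + δ) ⊆ W := by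
  obtain ⟨δ, hδ, hsub⟩ := (isCompact_closedPolydisc z₀ R).exists_thickening_subset_open hW h
  refine ⟨δ, hδ, fun z hz => hsub (Metric.mem_thickening_iff.mpr
    ⟨fun i => z₀ i + (R i / (R i + δ) : ℝ) * (z i - z₀ i), fun i => ?_, ?_⟩)⟩
  · have h1 := hR i
    have h2 : ‖z i - z₀ i‖ < R i + δ := hz i
    rw [add_sub_cancel_left, norm_mul, Complex.norm_real, Real.norm_of_nonneg (by positivity)]
    calc R i / (R i + δ) * ‖z i - z₀ i‖ ≤ R i / (R i + δ) * (R i + δ) := by gcongr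
      _ = R i := by field_simp
  · refine (dist_pi_lt_iff hδ).mpr fun i => ?_
    have h1 := hR i
    have h2 : ‖z i - z₀ i‖ < R i + δ := hz i
    have h3 : z i - (z₀ i + (R i / (R i + δ) : ℝ) * (z i - z₀ i)) =
        ((δ / (R i + δ) : ℝ) : ℂ) * (z i - z₀ i) := by
      have h4 : (δ / (R i + δ) : ℝ) = 1 - R i / (R i + δ) := by field_simp; ring
      rw [h4]; push_cast; ring
    rw [dist_eq_norm, h3, norm_mul, Complex.norm_real, Real.norm_of_nonneg (by positivity)]
    calc δ / (R i + δ) * ‖z i - z₀ i‖ < δ / (R i + δ) * (R i + δ) := by gcongr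
      _ = δ := by field_simp

end Cover

end

end LogDolbeault

/-! ### Assembling the components. -/

open LogDolbeault in
theorem lemma3p4 {d N : ℕ} {X : Type*} [TopologicalSpace X] [T2Space X]
    [ChartedSpace (Fin d → ℂ) X] [IsManifold 𝓘(ℂ, Fin d → ℂ) ω X]
    (D : Set X) (hD : IsNormalCrossing d D) [PathConnectedSpace ↥Dᶜ] (b : ↥Dᶜ)
    (ρ : FundamentalGroup ↥Dᶜ b →* Matrix.unitaryGroup (Fin N) ℂ)
    (e : OpenPartialHomeomorph X (Fin d → ℂ))
    (he : e ∈ IsManifold.maximalAtlas 𝓘(ℂ, Fin d → ℂ) ω X)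
    (J : Finset (Fin d)) (hJ : IsAdapted e J D)
    (z₀ : Fin d → ℂ) (R : Fin d → ℝ) (hR : ∀ i, 0 < R i)
    (p q : ℕ) (hq : 0 < q)
    (W : Set (Fin d → ℂ)) (hW : IsOpen W) (hWe : W ⊆ e.target) (hRW : closedPolydisc z₀ R ⊆ W)
    (η : CoverForm d N b) (hη : IsSection e J ρ p q W η)
    (hclosed : ∀ I K, ∀ u ∈ domainOver D e W, ∀ c, coverDbar e η I K u c = 0) :
    ∃ W' : Set (Fin d → ℂ), IsOpen W' ∧ closedPolydisc z₀ R ⊆ W' ∧ W' ⊆ W ∧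
      ∃ α : CoverForm d N b, IsSection e J ρ p (q - 1) W' α ∧
        ∀ I K, ∀ u ∈ domainOver D e W', ∀ c, coverDbar e α I K u c = η I K u c := by
  obtain ⟨δ', hδ', hsub'⟩ := exists_openPolydisc_subset hR hW hRW
  obtain ⟨δ, rfl⟩ : ∃ δ, δ' = 5 * δ := ⟨δ' / 5, by ring⟩
  have hδ : 0 < δ := by linarith
  set P := openPolydisc z₀ fun i => R i + 5 * δ with hPdef
  set P' := openPolydisc z₀ fun i => R i + δ with hP'def
  have hP : IsOpen P := isOpen_openPolydisc _ _
  have hP' : IsOpen P' := isOpen_openPolydisc _ _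
  have hPP : P' ⊆ P := fun z hz i => lt_trans (hz i) (by linarith)
  obtain ⟨θ, μ, F, hμ, hF, hηF⟩ := hη z₀ _ (fun i => by have := hR i; positivity) hsub'
  have hcl := dbar_component_eq_zero hJ hP (hsub'.trans hWe) hμ hF hηF
    fun I K u hu => hclosed I K u ⟨hu.1, hsub' hu.2⟩
  choose F' hF' hFF' using fun a => rankOne_primitive hR hδ (hμ.theta_mem a) hq (hF a)
    fun I K z hz hr => hcl a I K hz hr
  -- The primitive is built from the splitting chosen on the largest polydisc; restricting this
  -- splitting shows that it is a section over every polydisc in `P'`.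
  refine ⟨P', hP', fun z hz i => lt_of_le_of_lt (hz i) (by linarith), hPP.trans hsub',
    fun I K u c => ∑ a, F' a I K (e (u : X)) • μ a u c, fun c₀ R₀ _ hsub => ?_, fun I K u hu c => ?_⟩
  · exact ⟨θ, μ, F', hμ.mono (hsub.trans hPP), fun a => (hF' a).mono hsub, fun _ _ _ _ _ => rfl⟩
  · rw [coverDbar_eq hJ hP' ((hPP.trans hsub').trans hWe) (hμ.mono hPP) hF'
      (fun _ _ _ _ _ => rfl) I K hu c, hηF I K u ⟨hu.1, hPP hu.2⟩ c]
    exact Finset.sum_congr rfl fun a _ => by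
      rw [hFF' a I K _ hu.2 (mem_regularSet hJ hμ hu.1 a)]
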